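/- Let $n\ge 4$, let $p$ be a prime and $\Lambda_n=GL_n(\mathbb Z)$, viewed inside $GL_n(\mathbb Q)$. For $g\in GL_n(\mathbb Q)$ let $\deg(g)=\mathrm{card}(\Lambda_n\backslash\Lambda_n g\Lambda_n)$ be the number of right cosets $\Lambda_n x$ contained in $\Lambda_n g\Lambda_n$. On the free $\mathbb Z$-module generated by the double cosets $\Lambda_n g\Lambda_n$, $g\in GL_n(\mathbb Q)$ (the absolute Hecke algebra), let $*$ be the bilinear product with $$\Lambda_ng_1\Lambda_n*\Lambda_ng_2\Lambda_n=\sum_{\Lambda_nh\Lambda_n\subset\Lambda_ng_1\Lambda_ng_2\Lambda_n}m(g_1,g_2;h)\,\Lambda_nh\Lambda_n,\qquad m(g_1,g_2;h)=\mathrm{card}\{(i,j):\alpha_i\beta_j\in\Lambda_nh\},$$ where $\Lambda_ng_1\Lambda_n=\bigsqcup_i\Lambda_n\alpha_i$ and $\Lambda_ng_2\Lambda_n=\bigsqcup_j\Lambda_n\beta_j$. For an integral $n\times n$ matrix $C$ let $d_k(C)\ge 0$ be the greatest common divisor of its $k\times k$ minors. Let $R_0^{(n)}(p)$ be the set of upper-triangular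 integral $n\times n$ matrices $C=(c_{i,j})$ with $d_k(C)=p^{k-1}$ for $1\le k\le n-1$, $d_n(C)=p^n$, $c_{i,i}=p$ for all $i$, and $0\le c_{i,j}<p$ for all $i<j$. Let $R_1^{(n)}(p)$ be the set of upper-triangular integral $n\times n$ matrices $C=(c_{i,j})$ with $c_{i,i}\in\{1,p,p^2\}$ for all $i$, with exactly one $i$ such that $c_{i,i}=1$ and exactly one $i$ such that $c_{i,i}=p^2$, with $0\le c_{i,j}<c_{j,j}$ for all $i<j$, and such that $p\mid c_{i,i}$ implies $p\mid c_{i,j}$ for all $j>i$. 1. The sets $R_0^{(n)}(p)$ and $R_1^{(n)}(p)$ are disjoint, and $R^{(n)}(p)=R_0^{(n)}(p)\sqcup R_1^{(n)}(p)$ is a finite set of cardinality $$\deg\bigl(\mathrm{diag}(1,\underbrace{p,\dots,p}_{n-2},p^2)\bigr)=p\,\frac{(p^{n-1}-1)(p^n-1)}{(p-1)^2}$$ which is a complete system of representatives of the distinct right cosets $\Lambda_n x$ contained in $\Lambda_n\mathrm{diag}(1,p,\dots,p,p^2)\Lambda_n$. 2. The following formulas hold: $$\deg\bigl(\mathrm{diag}(p,\underbrace{p^2,\dots,p^2}_{n-2},p^3)\bigr)=p\,\frac{(p^{n-1}-1)(p^n-1)}{(p-1)^2},$$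 $$\deg\bigl(\mathrm{diag}(1,\underbrace{p^2,\dots,p^2}_{n-3},p^3,p^3)\bigr)=p^{n+1}\frac{(p^{n-2}-1)(p^{n-1}-1)(p^n-1)}{(p-1)^2(p^2-1)},$$ $$\deg\bigl(\mathrm{diag}(1,\underbrace{p^2,\dots,p^2}_{n-2},p^4)\bigr)=p^{2n-1}\frac{(p^{n-1}-1)(p^n-1)}{(p-1)^2},$$ $$\deg\bigl(\mathrm{diag}(p,p,\underbrace{p^2,\dots,p^2}_{n-3},p^4)\bigr)=p^{n+1}\frac{(p^{n-2}-1)(p^{n-1}-1)(p^n-1)}{(p-1)^2(p^2-1)},$$ $$\deg\bigl(\mathrm{diag}(p,p,\underbrace{p^2,\dots,p^2}_{n-4},p^3,p^3)\bigr)=p^4\frac{(p^{n-3}-1)(p^{n-2}-1)(p^{n-1}-1)(p^n-1)}{(p-1)^2(p^2-1)^2}.$$ 3. Writing $[D]=\Lambda_nD\Lambda_n$, one has in the absolute Hecke algebra $$[\mathrm{diag}(1,\underbrace{p,\dots,p}_{n-2},p^2)]*[\mathrm{diag}(1,\underbrace{p,\dots,p}_{n-2},p^2)]=\frac{2p^n-p^2-2p+1}{p-1}\,[\mathrm{diag}(p,\underbrace{p^2,\dots,p^2}_{n-2},p^3)]+p\,\frac{(p^{n-1}-1)(p^n-1)}{(p-1)^2}\,[\mathrm{diag}(\underbrace{p^2,\dots,p^2}_{n})]$$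 $$+[\mathrm{diag}(1,\underbrace{p^2,\dots,p^2}_{n-2},p^4)]+(p+1)\,[\mathrm{diag}(1,\underbrace{p^2,\dots,p^2}_{n-3},p^3,p^3)]+(p+1)\,[\mathrm{diag}(p,p,\underbrace{p^2,\dots,p^2}_{n-3},p^4)]+(p+1)^2\,[\mathrm{diag}(p,p,\underbrace{p^2,\dots,p^2}_{n-4},p^3,p^3)],$$ where the two quotients are integers. -/

import Mathlib

namespace HeckeGL

open Matrix

/-- `Λ_n = GL_n(ℤ)`, as a subgroup of `GL_n(ℚ)`. -/
def Lam (n : ℕ) : Subgroup (GL (Fin n) ℚ) :=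
  (Matrix.GeneralLinearGroup.map (n := Fin n) (Int.castRingHom ℚ)).range

/-- The set `Λ_n \ GL_n(ℚ)` of right cosets `Λ_n x`. -/
abbrev RightCoset (n : ℕ) : Type := Quotient (QuotientGroup.rightRel (Lam n))

/-- The right coset `Λ_n x`. -/
abbrev rightCoset {n : ℕ} (x : GL (Fin n) ℚ) : RightCoset n :=
  Quotient.mk (QuotientGroup.rightRel (Lam n)) x

/-- The double coset `Λ_n g Λ_n`, as a subset of `GL_n(ℚ)`. -/
def doubleCoset {n : ℕ} (g : GL (Fin n) ℚ) : Set (GL (Fin n) ℚ) :=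
  DoubleCoset.doubleCoset g (Lam n : Set (GL (Fin n) ℚ)) (Lam n : Set (GL (Fin n) ℚ))

/-- `Λ_n \ Λ_n g Λ_n`: the right cosets contained in `Λ_n g Λ_n`. -/
def cosetsIn {n : ℕ} (g : GL (Fin n) ℚ) : Set (RightCoset n) :=
  rightCoset '' doubleCoset g

/-- `deg(g) = card (Λ_n \ Λ_n g Λ_n)`. -/
noncomputable def degree {n : ℕ} (g : GL (Fin n) ℚ) : ℕ := (cosetsIn g).ncard

/-! ### Finiteness of the set of right cosets in a double coset -/

lemma rightCoset_eq_iff {n : ℕ} {x y : GL (Fin n) ℚ} :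
    rightCoset x = rightCoset y ↔ y * x⁻¹ ∈ Lam n := by
  rw [Quotient.eq (r := QuotientGroup.rightRel (Lam n)), QuotientGroup.rightRel_apply]

lemma exists_clear_denominators {n : ℕ} (M : Matrix (Fin n) (Fin n) ℚ) :
    ∃ N : ℤ, N ≠ 0 ∧ ∃ A : Matrix (Fin n) (Fin n) ℤ,
      A.map (Int.castRingHom ℚ) = (N : ℚ) • M := by
  obtain ⟨b, hb⟩ := IsLocalization.exist_integer_multiples (nonZeroDivisors ℤ)
    (Finset.univ : Finset (Fin n × Fin n)) (fun q => M q.1 q.2)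
  refine ⟨b, nonZeroDivisors.coe_ne_zero b, ?_⟩
  choose f hf using fun q => hb q (Finset.mem_univ q)
  refine ⟨fun i j => f (i, j), ?_⟩
  ext i j
  have h := hf (i, j)
  rw [zsmul_eq_mul] at h
  exact h

lemma conj_mem {n : ℕ} (g : GL (Fin n) ℚ) :
    ∃ m : ℕ, m ≠ 0 ∧ ∀ γ : GL (Fin n) ℤ,
      Matrix.GeneralLinearGroup.map (Int.castRingHom (ZMod m)) γ = 1 →
      g * Matrix.GeneralLinearGroup.map (Int.castRingHom ℚ) γ * g⁻¹ ∈ Lam n := by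
  obtain ⟨N₁, hN₁, A, hA⟩ := exists_clear_denominators (g : Matrix (Fin n) (Fin n) ℚ)
  obtain ⟨N₂, hN₂, B, hB⟩ :=
    exists_clear_denominators ((g⁻¹ : GL (Fin n) ℚ) : Matrix (Fin n) (Fin n) ℚ)
  refine ⟨(N₁ * N₂).natAbs, by simp [hN₁, hN₂], ?_⟩
  set m := (N₁ * N₂).natAbs with hm
  have key : ∀ γ : GL (Fin n) ℤ,
      Matrix.GeneralLinearGroup.map (Int.castRingHom (ZMod m)) γ = 1 →
      ∃ C : Matrix (Fin n) (Fin n) ℤ, C.map (Int.castRingHom ℚ) =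
        ((g * Matrix.GeneralLinearGroup.map (Int.castRingHom ℚ) γ * g⁻¹ : GL (Fin n) ℚ) :
          Matrix (Fin n) (Fin n) ℚ) := by
    intro γ hγ
    have hX : ∃ X : Matrix (Fin n) (Fin n) ℤ,
        (γ : Matrix (Fin n) (Fin n) ℤ) = 1 + (N₁ * N₂) • X := by
      have hd : ∀ i j, (N₁ * N₂) ∣ ((γ : Matrix (Fin n) (Fin n) ℤ) - 1) i j := by
        intro i j
        have h1 : (((γ : Matrix (Fin n) (Fin n) ℤ) i j : ℤ) : ZMod m) =
            (1 : Matrix (Fin n) (Fin n) (ZMod m)) i j := by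
          have := congrArg (fun u : GL (Fin n) (ZMod m) =>
            (u : Matrix (Fin n) (Fin n) (ZMod m)) i j) hγ
          simpa using this
        rw [← Int.natAbs_dvd, ← hm, ← ZMod.intCast_zmod_eq_zero_iff_dvd]
        rw [Matrix.sub_apply, Int.cast_sub, h1]
        by_cases hij : i = j <;> simp [Matrix.one_apply, hij]
      choose X hX using hd
      refine ⟨Matrix.of X, ?_⟩
      ext i j
      have := hX i j
      simp only [Matrix.sub_apply] at this
      simp only [Matrix.add_apply, Matrix.smul_apply, Matrix.of_apply, smul_eq_mul]
      linarith
    obtain ⟨X, hX⟩ := hX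
    refine ⟨1 + A * X * B, ?_⟩
    have e1 : ((Matrix.GeneralLinearGroup.map (Int.castRingHom ℚ) γ : GL (Fin n) ℚ) :
        Matrix (Fin n) (Fin n) ℚ) =
        1 + ((N₁ : ℚ) * (N₂ : ℚ)) • X.map (Int.castRingHom ℚ) := by
      have : ((Matrix.GeneralLinearGroup.map (Int.castRingHom ℚ) γ : GL (Fin n) ℚ) :
        Matrix (Fin n) (Fin n) ℚ) =
          (γ : Matrix (Fin n) (Fin n) ℤ).map (Int.castRingHom ℚ) := rfl
      rw [this, hX]
      ext i j
      rw [Matrix.map_apply, Matrix.add_apply, Matrix.add_apply, Matrix.smul_apply,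
        Matrix.smul_apply, Matrix.map_apply, smul_eq_mul, smul_eq_mul]
      by_cases hij : i = j <;> simp [Matrix.one_apply, hij]
    have e2 : (1 + A * X * B).map (Int.castRingHom ℚ) =
        1 + A.map (Int.castRingHom ℚ) * X.map (Int.castRingHom ℚ) *
          B.map (Int.castRingHom ℚ) := by
      rw [Matrix.map_add _ (by simp), Matrix.map_mul, Matrix.map_mul]
      simp
    have e3 : ((g : GL (Fin n) ℚ) : Matrix (Fin n) (Fin n) ℚ) *
        ((g⁻¹ : GL (Fin n) ℚ) : Matrix (Fin n) (Fin n) ℚ) = 1 := Units.mul_inv g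
    rw [e2, hA, hB, Units.val_mul, Units.val_mul, e1, mul_add, add_mul, mul_one, e3]
    congr 1
    simp only [Matrix.smul_mul, Matrix.mul_smul, smul_smul]
    rw [mul_comm]
  intro γ hγ
  obtain ⟨C, hC⟩ := key γ hγ
  obtain ⟨C', hC'⟩ := key γ⁻¹ (by rw [map_inv, hγ, inv_one])
  have hinj : Function.Injective
      (fun M : Matrix (Fin n) (Fin n) ℤ => M.map (Int.castRingHom ℚ)) :=
    Matrix.map_injective (RingHom.injective_int (Int.castRingHom ℚ))
  have h1 : C * C' = 1 := by
    apply hinj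
    simp only
    rw [Matrix.map_mul, hC, hC', ← Units.val_mul]
    simp
  have h2 : C' * C = 1 := by
    apply hinj
    simp only
    rw [Matrix.map_mul, hC, hC', ← Units.val_mul]
    simp
  exact ⟨⟨C, C', h1, h2⟩, Units.ext hC⟩

lemma cosetsIn_finite {n : ℕ} (g : GL (Fin n) ℚ) : (cosetsIn g).Finite := by
  obtain ⟨m, hm, hconj⟩ := conj_mem g
  have : NeZero m := ⟨hm⟩
  let red := Matrix.GeneralLinearGroup.map (n := Fin n) (Int.castRingHom (ZMod m))
  let inc := Matrix.GeneralLinearGroup.map (n := Fin n) (Int.castRingHom ℚ)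
  let F : GL (Fin n) (ZMod m) → RightCoset n := fun u =>
    rightCoset (g * inc (Function.invFun red u))
  refine (Set.finite_range F).subset ?_
  rintro _ ⟨x, hx, rfl⟩
  obtain ⟨a, ha, b, ⟨γ, rfl⟩, rfl⟩ := DoubleCoset.mem_doubleCoset.1 hx
  refine ⟨red γ, ?_⟩
  have h : red (Function.invFun red (red γ)) = red γ := Function.invFun_eq ⟨γ, rfl⟩
  set δ := Function.invFun red (red γ)
  have h2 := hconj (γ * δ⁻¹) (by
    change red (γ * δ⁻¹) = 1
    rw [map_mul, map_inv, h, mul_inv_cancel])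
  change rightCoset (g * inc δ) = _
  rw [rightCoset_eq_iff]
  have : a * g * inc γ * (g * inc δ)⁻¹ = a * (g * inc (γ * δ⁻¹) * g⁻¹) := by
    simp only [map_mul, map_inv]
    group
  change a * g * inc γ * (g * inc δ)⁻¹ ∈ Lam n
  rw [this]
  exact (Lam n).mul_mem ha h2

/-! ### The Hecke ring -/

/-- The structure constant `m(g₁, g₂; h) = card {(i, j) | α_i β_j ∈ Λ_n h}`, where the `α_i` and
the `β_j` represent the right cosets in `Λ_n g₁ Λ_n` and in `Λ_n g₂ Λ_n`. -/
noncomputable def mult {n : ℕ} (g₁ g₂ h : GL (Fin n) ℚ) : ℕ :=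
  {x : RightCoset n × RightCoset n | x.1 ∈ cosetsIn g₁ ∧ x.2 ∈ cosetsIn g₂ ∧
    rightCoset (x.1.out * x.2.out) = rightCoset h}.ncard

/-- The double cosets `Λ_n g Λ_n`, `g ∈ GL_n(ℚ)`. -/
abbrev DCoset (n : ℕ) : Type := HeckeCoset (⊤ : Submonoid (GL (Fin n) ℚ)) (Lam n) (Lam n)

/-- The absolute Hecke algebra: the free `ℤ`-module on the double cosets. -/
abbrev HeckeAlgebra (n : ℕ) : Type :=
  HeckeRing (⊤ : Submonoid (GL (Fin n) ℚ)) (Lam n) ℤ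

/-- A representative in `GL_n(ℚ)` of a double coset. -/
noncomputable def rep {n : ℕ} (D : DCoset n) : GL (Fin n) ℚ := (Quotient.out D).1

lemma mult_support_finite {n : ℕ} (D₁ D₂ : DCoset n) :
    (Function.support fun D : DCoset n => (mult (rep D₁) (rep D₂) (rep D) : ℤ)).Finite := by
  refine (((cosetsIn_finite (rep D₁)).prod (cosetsIn_finite (rep D₂))).image
    (fun x => (HeckeCoset.mk (Lam n) (Lam n) ⟨x.1.out * x.2.out, trivial⟩ : DCoset n))).subset ?_
  intro D hD
  have hne : mult (rep D₁) (rep D₂) (rep D) ≠ 0 := by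
    intro h0
    exact hD (by simp [h0])
  obtain ⟨x, h1, h2, h3⟩ := Set.nonempty_of_ncard_ne_zero hne
  refine ⟨x, ⟨h1, h2⟩, ?_⟩
  rw [rightCoset_eq_iff] at h3
  conv_rhs => rw [← Quotient.out_eq D]
  refine Quotient.sound ?_
  change DoubleCoset.setoid (Lam n : Set (GL (Fin n) ℚ)) (Lam n) _ _
  rw [DoubleCoset.rel_iff]
  exact ⟨_, h3, 1, (Lam n).one_mem, by simp only [rep]; group⟩

/-- The product of two double cosets,
`Λ_n g₁ Λ_n * Λ_n g₂ Λ_n = ∑ m(g₁, g₂; h) Λ_n h Λ_n`. The sum may be taken over all double cosets,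
as `m(g₁, g₂; h) = 0` unless `Λ_n h Λ_n ⊆ Λ_n g₁ Λ_n g₂ Λ_n`. -/
noncomputable def cosetMul {n : ℕ} (D₁ D₂ : DCoset n) : HeckeAlgebra n :=
  HeckeCosetModule.of (Finsupp.ofSupportFinite
    (fun D => (mult (rep D₁) (rep D₂) (rep D) : ℤ)) (mult_support_finite D₁ D₂))

/-- The multiplication of the Hecke algebra: the bilinear extension of the product of double
cosets. -/
noncomputable instance instMulHecke {n : ℕ} : Mul (HeckeAlgebra n) where
  mul x y := (HeckeCosetModule.of.symm x).sum fun D₁ a =>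
    (HeckeCosetModule.of.symm y).sum fun D₂ b => (a * b) • cosetMul D₁ D₂

/-- The double coset `Λ_n g Λ_n` as an element of the Hecke algebra. -/
noncomputable def T {n : ℕ} (g : GL (Fin n) ℚ) : HeckeAlgebra n :=
  HeckeCosetModule.of (Finsupp.single (HeckeCoset.mk (Lam n) (Lam n) ⟨g, trivial⟩) 1)

/-! #### The structure constants do not depend on the choices made -/

lemma mem_cosetsIn_iff {n : ℕ} {g x : GL (Fin n) ℚ} :
    rightCoset x ∈ cosetsIn g ↔ x ∈ doubleCoset g := by
  refine ⟨?_, fun h => ⟨x, h, rfl⟩⟩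
  rintro ⟨y, hy, hyx⟩
  rw [rightCoset_eq_iff] at hyx
  obtain ⟨a, ha, b, hb, rfl⟩ := DoubleCoset.mem_doubleCoset.1 hy
  refine DoubleCoset.mem_doubleCoset.2 ⟨x * (a * g * b)⁻¹ * a, (Lam n).mul_mem hyx ha, b, hb, ?_⟩
  group

/-- For all systems of representatives `α`, `β` of the right cosets, `card {(i, j) | α_i β_j ∈ Λ_n h}`
is the number of the right cosets `Λ_n y ⊆ Λ_n g₂ Λ_n` with `h y⁻¹ ∈ Λ_n g₁ Λ_n`. -/
lemma card_pairs {n : ℕ} (g₁ g₂ h : GL (Fin n) ℚ) (α β : RightCoset n → GL (Fin n) ℚ)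
    (hα : ∀ q, rightCoset (α q) = q) (hβ : ∀ q, rightCoset (β q) = q) :
    {x : RightCoset n × RightCoset n | x.1 ∈ cosetsIn g₁ ∧ x.2 ∈ cosetsIn g₂ ∧
      rightCoset (α x.1 * β x.2) = rightCoset h}.ncard =
    (rightCoset '' {y | y ∈ doubleCoset g₂ ∧ h * y⁻¹ ∈ doubleCoset g₁}).ncard := by
  have fwd : ∀ q q', rightCoset (α q * β q') = rightCoset h →
      rightCoset (h * (β q')⁻¹) = q := by
    intro q q' hh
    rw [← hα q]
    symm
    rw [rightCoset_eq_iff] at hh ⊢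
    simpa [mul_assoc] using hh
  refine Set.ncard_congr (fun x _ => x.2) ?_ ?_ ?_
  · rintro ⟨q, q'⟩ ⟨h1, h2, h3⟩
    refine ⟨β q', ⟨?_, ?_⟩, hβ q'⟩
    · rw [← mem_cosetsIn_iff, hβ]; exact h2
    · rw [← mem_cosetsIn_iff, fwd q q' h3]; exact h1
  · rintro ⟨q, q'⟩ ⟨r, r'⟩ ⟨h1, h2, h3⟩ ⟨k1, k2, k3⟩ hq
    obtain rfl : q' = r' := hq
    rw [Prod.mk.injEq, ← fwd q q' h3, ← fwd r q' k3]
    exact ⟨rfl, rfl⟩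
  · rintro _ ⟨y, ⟨hy2, hy1⟩, rfl⟩
    have hb : rightCoset (β (rightCoset y)) = rightCoset y := hβ _
    rw [eq_comm, rightCoset_eq_iff] at hb
    have hmem : h * (β (rightCoset y))⁻¹ ∈ doubleCoset g₁ := by
      obtain ⟨a, ha, b, hb', he⟩ := DoubleCoset.mem_doubleCoset.1 hy1
      refine DoubleCoset.mem_doubleCoset.2 ⟨a, ha, b * (β (rightCoset y) * y⁻¹)⁻¹,
        (Lam n).mul_mem hb' ((Lam n).inv_mem hb), ?_⟩
      have : h = a * g₁ * b * y := by rw [← he]; group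
      rw [this]; group
    refine ⟨(rightCoset (h * (β (rightCoset y))⁻¹), rightCoset y),
      ⟨mem_cosetsIn_iff.2 hmem, mem_cosetsIn_iff.2 hy2, ?_⟩, rfl⟩
    have ha := hα (rightCoset (h * (β (rightCoset y))⁻¹))
    rw [rightCoset_eq_iff] at ha ⊢
    simpa [mul_assoc] using ha

lemma doubleCoset_eq_of_rel {n : ℕ} {g g' a b : GL (Fin n) ℚ} (ha : a ∈ Lam n) (hb : b ∈ Lam n)
    (h : g' = a * g * b) : doubleCoset g' = doubleCoset g :=
  DoubleCoset.doubleCoset_eq_of_mem (DoubleCoset.mem_doubleCoset.2 ⟨a, ha, b, hb, h⟩)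

/-- The structure constants depend only on the three double cosets. -/
lemma mult_congr {n : ℕ} {g₁ g₁' g₂ g₂' h h' : GL (Fin n) ℚ}
    (h₁ : doubleCoset g₁ = doubleCoset g₁') (h₂ : doubleCoset g₂ = doubleCoset g₂')
    (hh : doubleCoset h = doubleCoset h') : mult g₁ g₂ h = mult g₁' g₂' h' := by
  have hout : ∀ q : RightCoset n, rightCoset q.out = q := Quotient.out_eq
  unfold mult
  rw [card_pairs g₁ g₂ h Quotient.out Quotient.out hout hout,
    card_pairs g₁' g₂' h' Quotient.out Quotient.out hout hout, ← h₁, ← h₂]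
  have hmem : h' ∈ doubleCoset h := by
    rw [hh]; exact DoubleCoset.mem_doubleCoset_self _ _ _
  obtain ⟨u, hu, v, hv, rfl⟩ := DoubleCoset.mem_doubleCoset.1 hmem
  refine Set.ncard_congr (fun q _ => rightCoset (q.out * v)) ?_ ?_ ?_
  · rintro _ ⟨y, ⟨hy2, hy1⟩, rfl⟩
    have ho := (hout (rightCoset y)).symm
    rw [rightCoset_eq_iff] at ho
    set z := (rightCoset y).out
    have e2 : z * v = z * y⁻¹ * y * v := by group
    have e1 : u * h * v * (y * v)⁻¹ = u * (h * y⁻¹) := by group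
    refine ⟨y * v, ⟨?_, ?_⟩, ?_⟩
    · obtain ⟨a, ha, b, hb, rfl⟩ := DoubleCoset.mem_doubleCoset.1 hy2
      exact DoubleCoset.mem_doubleCoset.2 ⟨a, ha, b * v, (Lam n).mul_mem hb hv, by group⟩
    · rw [e1]
      obtain ⟨a, ha, b, hb, he⟩ := DoubleCoset.mem_doubleCoset.1 hy1
      exact DoubleCoset.mem_doubleCoset.2 ⟨u * a, (Lam n).mul_mem hu ha, b, hb, by
        rw [he]; group⟩
    · rw [rightCoset_eq_iff]
      simpa [mul_assoc] using ho
  · intro q q' _ _ he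
    rw [rightCoset_eq_iff] at he
    rw [← hout q, ← hout q', rightCoset_eq_iff]
    simpa [mul_assoc] using he
  · rintro _ ⟨y, ⟨hy2, hy1⟩, rfl⟩
    refine ⟨rightCoset (y * v⁻¹), ⟨y * v⁻¹, ⟨?_, ?_⟩, rfl⟩, ?_⟩
    · obtain ⟨a, ha, b, hb, rfl⟩ := DoubleCoset.mem_doubleCoset.1 hy2
      exact DoubleCoset.mem_doubleCoset.2
        ⟨a, ha, b * v⁻¹, (Lam n).mul_mem hb ((Lam n).inv_mem hv), by group⟩
    · obtain ⟨a, ha, b, hb, he⟩ := DoubleCoset.mem_doubleCoset.1 hy1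
      refine DoubleCoset.mem_doubleCoset.2
        ⟨u⁻¹ * a, (Lam n).mul_mem ((Lam n).inv_mem hu) ha, b, hb, ?_⟩
      have : h * (y * v⁻¹)⁻¹ = u⁻¹ * (u * h * v * y⁻¹) := by group
      rw [this, he]; group
    · have ho := hout (rightCoset (y * v⁻¹))
      rw [rightCoset_eq_iff] at ho ⊢
      simpa [mul_assoc] using ho

lemma doubleCoset_rep {n : ℕ} (g : GL (Fin n) ℚ) :
    doubleCoset (rep (HeckeCoset.mk (Lam n) (Lam n) ⟨g, trivial⟩ : DCoset n)) = doubleCoset g :=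
  Quotient.mk_out (s := HeckeCoset.setoid (⊤ : Submonoid (GL (Fin n) ℚ)) (Lam n) (Lam n))
    ⟨g, trivial⟩

/-- In the product of `Λ_n g₁ Λ_n` and `Λ_n g₂ Λ_n` the coefficient of `Λ_n h Λ_n` is
`m(g₁, g₂; h)`. -/
lemma T_mul_T_apply {n : ℕ} (g₁ g₂ h : GL (Fin n) ℚ) :
    (T g₁ * T g₂ : HeckeAlgebra n) (HeckeCoset.mk (Lam n) (Lam n) ⟨h, trivial⟩) =
      (mult g₁ g₂ h : ℤ) := by
  have e : T g₁ * T g₂ = cosetMul (HeckeCoset.mk (Lam n) (Lam n) ⟨g₁, trivial⟩)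
      (HeckeCoset.mk (Lam n) (Lam n) ⟨g₂, trivial⟩) := by
    change Finsupp.sum (Finsupp.single _ _) _ = _
    rw [Finsupp.sum_single_index (by simp)]
    change Finsupp.sum (Finsupp.single _ _) _ = _
    rw [Finsupp.sum_single_index (by simp)]
    simp
  rw [e]
  change (mult _ _ _ : ℤ) = _
  rw [mult_congr (doubleCoset_rep g₁) (doubleCoset_rep g₂) (doubleCoset_rep h)]

/-! ### Diagonal matrices -/

/-- `diag(p^{e_1}, …, p^{e_n})` as an element of `GL_n(ℚ)`. -/
def diagPow {n : ℕ} (p : ℕ) [NeZero p] (e : Fin n → ℕ) : GL (Fin n) ℚ where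
  val := Matrix.diagonal fun i => (p : ℚ) ^ e i
  inv := Matrix.diagonal fun i => ((p : ℚ) ^ e i)⁻¹
  val_inv := by
    have hp : (p : ℚ) ≠ 0 := Nat.cast_ne_zero.2 (NeZero.ne p)
    rw [Matrix.diagonal_mul_diagonal, Matrix.diagonal_eq_one]
    funext i
    exact mul_inv_cancel₀ (pow_ne_zero _ hp)
  inv_val := by
    have hp : (p : ℚ) ≠ 0 := Nat.cast_ne_zero.2 (NeZero.ne p)
    rw [Matrix.diagonal_mul_diagonal, Matrix.diagonal_eq_one]
    funext i
    exact inv_mul_cancel₀ (pow_ne_zero _ hp)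

/-- The exponents `(a, …, a, b, …, b, c, …, c)` with `r` terms `a`, `n - r - s` terms `b` and
`s` terms `c` (for `r + s ≤ n`). -/
def blocks (n r a b c s : ℕ) : Fin n → ℕ := fun i =>
  if (i : ℕ) < r then a else if (i : ℕ) < n - s then b else c

/-! ### Representatives -/

/-- The `k`-th determinantal divisor: the gcd of all `k × k` minors. -/
def detDivisor {n : ℕ} (k : ℕ) (C : Matrix (Fin n) (Fin n) ℤ) : ℤ :=
  (Finset.univ : Finset ({s : Finset (Fin n) // s.card = k} × {s : Finset (Fin n) // s.card = k})).gcd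
    fun q => (C.submatrix (q.1.1.orderEmbOfFin q.1.2) (q.2.1.orderEmbOfFin q.2.2)).det

/-- The set `R_0^{(n)}(p)`. -/
def R₀ (n p : ℕ) : Set (Matrix (Fin n) (Fin n) ℤ) :=
  {C | C.BlockTriangular id ∧
    (∀ k, 1 ≤ k → k < n → detDivisor k C = (p : ℤ) ^ (k - 1)) ∧
    detDivisor n C = (p : ℤ) ^ n ∧
    (∀ i, C i i = p) ∧
    (∀ i j, i < j → 0 ≤ C i j ∧ C i j < p)}

/-- The set `R_1^{(n)}(p)`. -/
def R₁ (n p : ℕ) : Set (Matrix (Fin n) (Fin n) ℤ) :=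
  {C | C.BlockTriangular id ∧
    (∀ i, C i i = 1 ∨ C i i = p ∨ C i i = (p : ℤ) ^ 2) ∧
    (∃! i, C i i = 1) ∧
    (∃! i, C i i = (p : ℤ) ^ 2) ∧
    (∀ i j, i < j → 0 ≤ C i j ∧ C i j < C j j) ∧
    (∀ i, (p : ℤ) ∣ C i i → ∀ j, i < j → (p : ℤ) ∣ C i j)}

/-- The set `R^{(n)}(p)`. -/
def R (n p : ℕ) : Set (Matrix (Fin n) (Fin n) ℤ) := R₀ n p ∪ R₁ n p

/-- `S` is a complete system of representatives of the distinct right cosets `Λ_n x` contained in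
`Λ_n g Λ_n`: the elements of `S` lie in `Λ_n g Λ_n`, and every element of `Λ_n g Λ_n` lies in
`Λ_n C` for exactly one `C ∈ S`. -/
def IsCompleteSystem {n : ℕ} (S : Set (Matrix (Fin n) (Fin n) ℤ)) (g : GL (Fin n) ℚ) : Prop :=
  (∀ C ∈ S, ∃ x ∈ doubleCoset g,
    (x : Matrix (Fin n) (Fin n) ℚ) = C.map (Int.castRingHom ℚ)) ∧
  ∀ x ∈ doubleCoset g, ∃! C, C ∈ S ∧ ∃ u ∈ Lam n,
    (x : Matrix (Fin n) (Fin n) ℚ) = (u : Matrix (Fin n) (Fin n) ℚ) * C.map (Int.castRingHom ℚ)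

end HeckeGL

namespace HeckeGL

/-! ### Counting subgroups -/

section Counting

/-- The number `1 + p + ⋯ + p ^ (k - 1)` of points of a projective space of dimension `k - 1` over
the field with `p` elements. -/
def geomSum (p k : ℕ) : ℕ := ∑ i ∈ Finset.range k, p ^ i

lemma card_finrank_one (p : ℕ) [Fact p.Prime] (Q : Type*) [AddCommGroup Q] [Module (ZMod p) Q]
    [Finite Q] :
    {H : Submodule (ZMod p) Q | Module.finrank (ZMod p) H = 1}.ncard =
      geomSum p (Module.finrank (ZMod p) Q) := by
  rw [← Nat.card_coe_set_eq]
  change Nat.card {H : Submodule (ZMod p) Q // Module.finrank (ZMod p) H = 1} = _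
  rw [← Nat.card_congr (Projectivization.equivSubmodule (ZMod p) Q),
    Projectivization.card_of_finrank (ZMod p) Q rfl, Nat.card_zmod]
  rfl

lemma finrank_eq_of_card_eq_pow {p : ℕ} [Fact p.Prime] {Q : Type*} [AddCommGroup Q]
    [Module (ZMod p) Q] [Finite Q] {k : ℕ} (h : Nat.card Q = p ^ k) :
    Module.finrank (ZMod p) Q = k := by
  rw [Module.natCard_eq_pow_finrank (K := ZMod p), Nat.card_zmod] at h
  exact Nat.pow_right_injective (Fact.out : p.Prime).two_le h

/-- Taking annihilators turns hyperplanes of Q into lines of the dual space, which has the same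
dimension. -/
lemma card_hyperplane (p : ℕ) [Fact p.Prime] (Q : Type*) [AddCommGroup Q] [Module (ZMod p) Q]
    [Finite Q] :
    {H : Submodule (ZMod p) Q | Module.finrank (ZMod p) H + 1 = Module.finrank (ZMod p) Q}.ncard =
      geomSum p (Module.finrank (ZMod p) Q) := by
  have : Finite (Module.Dual (ZMod p) Q) := Module.finite_of_finite (ZMod p)
  rw [← Subspace.dual_finrank_eq, ← card_finrank_one]
  refine Set.ncard_congr (fun H _ => H.dualAnnihilator) ?_ ?_ ?_
  · intro H hH
    have := Subspace.finrank_add_finrank_dualAnnihilator_eq H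
    rw [Set.mem_ofPred_eq, Subspace.dual_finrank_eq] at hH
    rw [Set.mem_ofPred_eq]
    omega
  · intro H H' _ _ h
    exact Subspace.dualAnnihilator_inj.1 h
  · intro W hW
    refine ⟨W.dualCoannihilator, ?_, Subspace.dualCoannihilator_dualAnnihilator_eq⟩
    have := Subspace.finrank_add_finrank_dualAnnihilator_eq W.dualCoannihilator
    rw [Subspace.dualCoannihilator_dualAnnihilator_eq,
      show Module.finrank (ZMod p) W = 1 from hW] at this
    rw [Set.mem_ofPred_eq, Subspace.dual_finrank_eq, this]

variable {p : ℕ} [hp : Fact p.Prime]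

lemma card_addSubgroup_of_module {Q : Type*} [AddCommGroup Q] [Module (ZMod p) Q] [Finite Q]
    {k : ℕ} (hk : Nat.card Q = p ^ k) :
    {H : AddSubgroup Q | Nat.card H = p}.ncard = geomSum p k ∧
    {H : AddSubgroup Q | H.index = p}.ncard = geomSum p k := by
  have hfr := finrank_eq_of_card_eq_pow hk
  constructor
  · rw [← hfr, ← card_finrank_one]
    refine Set.ncard_congr (fun H _ => AddSubgroup.toZModSubmodule p H) ?_ ?_ ?_
    · intro H hH
      apply finrank_eq_of_card_eq_pow
      rw [pow_one]
      exact hH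
    · intro H H' _ _ h
      exact (AddSubgroup.toZModSubmodule p).injective h
    · intro W hW
      refine ⟨W.toAddSubgroup, ?_, rfl⟩
      have := Module.natCard_eq_pow_finrank (K := ZMod p) (V := W)
      rw [show Module.finrank (ZMod p) W = 1 from hW, Nat.card_zmod, pow_one] at this
      exact this
  · rw [← hfr, ← card_hyperplane]
    have key (W : Submodule (ZMod p) Q) : W.toAddSubgroup.index = p ↔
        Module.finrank (ZMod p) W + 1 = Module.finrank (ZMod p) Q := by
      have h1 := W.toAddSubgroup.card_mul_index
      have h2 : Nat.card W.toAddSubgroup = p ^ Module.finrank (ZMod p) W := by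
        have := Module.natCard_eq_pow_finrank (K := ZMod p) (V := W)
        rwa [Nat.card_zmod] at this
      have h3 := Module.natCard_eq_pow_finrank (K := ZMod p) (V := Q)
      rw [Nat.card_zmod] at h3
      rw [h2, h3] at h1
      have hpos : 0 < p ^ Module.finrank (ZMod p) W := pow_pos hp.out.pos _
      constructor
      · intro h
        rw [h, ← pow_succ] at h1
        exact Nat.pow_right_injective hp.out.two_le h1
      · intro h
        rw [← h, pow_succ] at h1
        exact Nat.eq_of_mul_eq_mul_left hpos h1
    refine Set.ncard_congr (fun H _ => AddSubgroup.toZModSubmodule p H) ?_ ?_ ?_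
    · intro H hH
      exact (key _).1 hH
    · intro H H' _ _ h
      exact (AddSubgroup.toZModSubmodule p).injective h
    · intro W hW
      exact ⟨W.toAddSubgroup, (key W).2 hW, rfl⟩

/-- A group killed by p is a vector space over the field with p elements, and its subgroups are its
subspaces. -/
lemma card_addSubgroup_of_card {Q : Type*} [AddCommGroup Q] [Finite Q]
    (hQ : ∀ x : Q, p • x = 0) {k : ℕ} (hk : Nat.card Q = p ^ k) :
    {H : AddSubgroup Q | Nat.card H = p}.ncard = geomSum p k ∧
    {H : AddSubgroup Q | H.index = p}.ncard = geomSum p k :=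
  let _ : Module (ZMod p) Q := AddCommGroup.zmodModule hQ
  card_addSubgroup_of_module hk

variable {V : Type*} [AddCommGroup V]

/-- The subgroups between `A` and `T` correspond to the subgroups of `T / A`. -/
lemma card_between {A T : AddSubgroup V} (hAT : A ≤ T) (hpT : ∀ x ∈ T, p • x ∈ A) {k : ℕ}
    (hk : A.relIndex T = p ^ k) :
    {N : AddSubgroup V | A ≤ N ∧ N ≤ T ∧ A.relIndex N = p}.ncard = geomSum p k ∧
    {N : AddSubgroup V | A ≤ N ∧ N ≤ T ∧ N.relIndex T = p}.ncard = geomSum p k := by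
  set A' := A.addSubgroupOf T
  set Q := T ⧸ A'
  have hcard : Nat.card Q = p ^ k := hk
  have : Finite Q := Nat.finite_of_card_ne_zero (by
    rw [hcard]; exact pow_ne_zero _ hp.out.ne_zero)
  have hQ : ∀ x : Q, p • x = 0 := by
    intro x
    obtain ⟨y, rfl⟩ := QuotientAddGroup.mk'_surjective A' x
    rw [← map_nsmul]
    exact (QuotientAddGroup.eq_zero_iff _).2 (hpT y y.2)
  obtain ⟨h1, h2⟩ := card_addSubgroup_of_card hQ hcard
  set π := QuotientAddGroup.mk' A'
  have hπ : Function.Surjective π := QuotientAddGroup.mk'_surjective A'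
  -- `f` takes the preimage of H in T and views it inside V. It is a bijection onto the groups
  -- between A and T and carries order and index of H to the two relative indices.
  set f : AddSubgroup Q → AddSubgroup V := fun H => (H.comap π).map T.subtype with hf
  have hinj : Function.Injective f := by
    intro H H' h
    exact AddSubgroup.comap_injective hπ
      (AddSubgroup.map_injective T.subtype_injective h)
  have hA' : A'.map T.subtype = A := by
    rw [AddSubgroup.addSubgroupOf_map_subtype, inf_eq_left.2 hAT]
  have hAf (H) : A ≤ f H := by
    conv_lhs => rw [← hA']
    refine AddSubgroup.map_mono ?_
    exact (QuotientAddGroup.ker_mk' A').symm.trans_le (AddSubgroup.ker_le_comap π H)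
  have hfT (H) : f H ≤ T := AddSubgroup.map_subtype_le _
  have hsurj (N) (h : A ≤ N) (h' : N ≤ T) : ∃ H, f H = N := by
    refine ⟨(N.addSubgroupOf T).map π, ?_⟩
    simp only [hf]
    rw [AddSubgroup.comap_map_eq, QuotientAddGroup.ker_mk', sup_eq_left.2,
      AddSubgroup.addSubgroupOf_map_subtype, inf_eq_left.2 h']
    exact AddSubgroup.comap_mono h
  have hi1 (H) : A.relIndex (f H) = Nat.card H := by
    conv_lhs => rw [← hA']
    simp only [hf]
    have hker : A'.relIndex (H.comap π) = π.ker.relIndex (H.comap π) :=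
      congrArg (fun B => B.relIndex (H.comap π)) (QuotientAddGroup.ker_mk' A').symm
    rw [AddSubgroup.relIndex_map_map_of_injective _ _ T.subtype_injective, hker,
      AddSubgroup.relIndex_ker, AddSubgroup.map_comap_eq_self_of_surjective hπ]
  have hi2 (H) : (f H).relIndex T = H.index := by
    have : (f H).addSubgroupOf T = H.comap π := by
      simp only [hf, AddSubgroup.addSubgroupOf]
      exact AddSubgroup.comap_map_eq_self_of_injective T.subtype_injective _
    rw [AddSubgroup.relIndex, this, AddSubgroup.index_comap_of_surjective _ hπ]
  constructor
  · rw [← h1]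
    symm
    refine Set.ncard_congr (fun H _ => f H) ?_ (fun _ _ _ _ h => hinj h) ?_
    · intro H hH
      exact ⟨hAf H, hfT H, (hi1 H).trans hH⟩
    · rintro N ⟨h, h', h''⟩
      obtain ⟨H, rfl⟩ := hsurj N h h'
      exact ⟨H, (hi1 H).symm.trans h'', rfl⟩
  · rw [← h2]
    symm
    refine Set.ncard_congr (fun H _ => f H) ?_ (fun _ _ _ _ h => hinj h) ?_
    · intro H hH
      exact ⟨hAf H, hfT H, (hi2 H).trans hH⟩
    · rintro N ⟨h, h', h''⟩
      obtain ⟨H, rfl⟩ := hsurj N h h'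
      exact ⟨H, (hi2 H).symm.trans h'', rfl⟩

/-- Double counting for sets. -/
lemma ncard_mul_eq_ncard_mul {α β : Type*} {s : Set α} {t : Set β} (r : α → β → Prop)
    (hs : s.Finite) (ht : t.Finite) {m k : ℕ} (hm : ∀ a ∈ s, {b ∈ t | r a b}.ncard = m)
    (hk : ∀ b ∈ t, {a ∈ s | r a b}.ncard = k) : s.ncard * m = t.ncard * k := by
  classical
  lift s to Finset α using hs
  lift t to Finset β using ht
  rw [Set.ncard_coe_finset, Set.ncard_coe_finset]
  refine Finset.card_mul_eq_card_mul r ?_ ?_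
  · intro a ha
    rw [← hm a ha, ← Set.ncard_coe_finset]
    congr 1
    ext; simp [Finset.bipartiteAbove]
  · intro b hb
    rw [← hk b hb, ← Set.ncard_coe_finset]
    congr 1
    ext; simp [Finset.bipartiteBelow]

/-- The set of subgroups between two subgroups of finite relative index is finite. -/
lemma finite_between {A T : AddSubgroup V} (h : A.relIndex T ≠ 0) :
    {N : AddSubgroup V | A ≤ N ∧ N ≤ T}.Finite := by
  set A' := A.addSubgroupOf T
  have : Finite (T ⧸ A') := Nat.finite_of_card_ne_zero h
  have : Finite (Set (T ⧸ A')) := inferInstance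
  -- Since N contains A, it is the preimage of its own image in the finite group T / A.
  refine Set.Finite.of_finite_image
    (f := fun N : AddSubgroup V => ((N.addSubgroupOf T).map (QuotientAddGroup.mk' A') : Set (T ⧸ A')))
    (Set.toFinite _) ?_
  rintro N ⟨h1, h2⟩ N' ⟨h1', h2'⟩ he
  have he : (N.addSubgroupOf T).map (QuotientAddGroup.mk' A') =
    (N'.addSubgroupOf T).map (QuotientAddGroup.mk' A') := SetLike.coe_injective he
  have := congrArg (fun H => (H.comap (QuotientAddGroup.mk' A')).map T.subtype) he
  rwa [AddSubgroup.comap_map_eq, QuotientAddGroup.ker_mk', sup_eq_left.2,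
      AddSubgroup.addSubgroupOf_map_subtype, inf_eq_left.2 h2, AddSubgroup.comap_map_eq,
      QuotientAddGroup.ker_mk', sup_eq_left.2,
      AddSubgroup.addSubgroupOf_map_subtype, inf_eq_left.2 h2'] at this
  · exact AddSubgroup.comap_mono h1'
  · exact AddSubgroup.comap_mono h1

end Counting
end HeckeGL

namespace HeckeGL

set_option linter.unusedSectionVars false

/-! ### Subgroups of prime index -/

section Neighbours

variable {p : ℕ} {V : Type*} [AddCommGroup V]

lemma geomSum_succ (p k : ℕ) : geomSum p (k + 1) = geomSum p k + p ^ k :=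
  Finset.sum_range_succ _ _

/-- `p L ≤ A`. -/
def SmulLE (p : ℕ) (L A : AddSubgroup V) : Prop := ∀ x ∈ L, p • x ∈ A

lemma SmulLE.mono {L L' A A' : AddSubgroup V} (h : SmulLE p L A) (hL : L' ≤ L) (hA : A ≤ A') :
    SmulLE p L' A' := fun x hx => hA (h x (hL hx))

lemma SmulLE.inf {L A B : AddSubgroup V} (hA : SmulLE p L A) (hB : SmulLE p L B) :
    SmulLE p L (A ⊓ B) := fun x hx => ⟨hA x hx, hB x hx⟩

lemma SmulLE.sup {L M A : AddSubgroup V} (hL : SmulLE p L A) (hM : SmulLE p M A) :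
    SmulLE p (L ⊔ M) A := by
  have h : L ⊔ M ≤ A.comap (nsmulAddMonoidHom p) := sup_le hL hM
  exact h

lemma SmulLE.self (L : AddSubgroup V) : SmulLE p L L := fun _ hx => L.nsmul_mem hx p

/-- The quotient has order p, so p kills it. -/
lemma smulLE_of_relIndex {A L : AddSubgroup V} (h : A.relIndex L = p) : SmulLE p L A := by
  intro x hx
  have h1 := AddSubgroup.nsmul_index_mem (A.addSubgroupOf L) ⟨x, hx⟩
  have h2 : (A.addSubgroupOf L).index = p := h
  rw [h2] at h1
  exact h1

lemma smulLE_sq_of_relIndex {A L : AddSubgroup V} (h : A.relIndex L = p ^ 2) :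
    SmulLE (p ^ 2) L A := by
  intro x hx
  have h1 := AddSubgroup.nsmul_index_mem (A.addSubgroupOf L) ⟨x, hx⟩
  have h2 : (A.addSubgroupOf L).index = p ^ 2 := h
  rw [h2] at h1
  exact h1

lemma eq_of_le_of_relIndex_eq {A L : AddSubgroup V} (h : A ≤ L) (hi : A.relIndex L = 1) : A = L :=
  le_antisymm h (AddSubgroup.relIndex_eq_one.1 hi)

lemma relIndex_mul {A E L : AddSubgroup V} (h : A ≤ E) (h' : E ≤ L) :
    A.relIndex E * E.relIndex L = A.relIndex L := AddSubgroup.relIndex_mul_relIndex _ _ _ h h'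

/-- The number of subgroups properly between `A` and `L`, when `A` has index `p ^ 2` in `L`. -/
noncomputable def midCount (p : ℕ) (A L : AddSubgroup V) : ℕ :=
  open Classical in if SmulLE p L A then p + 1 else 1

lemma midCount_of_smulLE {A L : AddSubgroup V} (h : SmulLE p L A) : midCount p A L = p + 1 :=
  if_pos h

lemma midCount_of_not_smulLE {A L : AddSubgroup V} (h : ¬ SmulLE p L A) : midCount p A L = 1 :=
  if_neg h

lemma map_nsmul_le_iff {L A : AddSubgroup V} :
    L.map (nsmulAddMonoidHom p) ≤ A ↔ SmulLE p L A := by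
  rw [AddSubgroup.map_le_iff_le_comap]
  rfl

lemma le_comap_nsmul_iff {L A : AddSubgroup V} :
    L ≤ A.comap (nsmulAddMonoidHom p) ↔ SmulLE p L A := Iff.rfl

lemma map_nsmul_le (L : AddSubgroup V) : L.map (nsmulAddMonoidHom p) ≤ L :=
  map_nsmul_le_iff.2 (SmulLE.self L)

lemma le_comap_nsmul (L : AddSubgroup V) : L ≤ L.comap (nsmulAddMonoidHom p) :=
  le_comap_nsmul_iff.2 (SmulLE.self L)

variable [hp : Fact p.Prime]

lemma eq_or_eq_of_between {A E L : AddSubgroup V} (h : A ≤ E) (h' : E ≤ L)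
    (hi : A.relIndex L = p) : E = A ∨ E = L := by
  have h1 := relIndex_mul h h'
  rw [hi] at h1
  rcases (Nat.dvd_prime hp.out).1 (Dvd.intro _ h1) with h2 | h2
  · exact Or.inl (eq_of_le_of_relIndex_eq h h2).symm
  · rw [h2] at h1
    exact Or.inr (eq_of_le_of_relIndex_eq h' (Nat.eq_of_mul_eq_mul_left hp.out.pos (by simpa using h1)))

lemma ne_of_relIndex {A L : AddSubgroup V} (hi : A.relIndex L = p) : ¬ L ≤ A := by
  intro h
  rw [AddSubgroup.relIndex_eq_one.2 h] at hi
  exact hp.out.one_lt.ne hi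

lemma relIndex_mid_iff {A E L : AddSubgroup V} (h : A ≤ E) (h' : E ≤ L)
    (hi : A.relIndex L = p ^ 2) : A.relIndex E = p ↔ E.relIndex L = p := by
  have h1 := relIndex_mul h h'
  rw [hi, sq] at h1
  constructor <;> intro h2 <;> rw [h2] at h1
  · exact Nat.eq_of_mul_eq_mul_left hp.out.pos h1
  · exact Nat.eq_of_mul_eq_mul_right hp.out.pos h1

/-- If L/A is elementary, the count of hyperplanes is positive. Otherwise some px lies outside A,
and A + ⟨px⟩ works because p²x lies in A. -/
lemma exists_between {A L : AddSubgroup V} (h : A ≤ L) (hi : A.relIndex L = p ^ 2) :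
    ∃ E, A ≤ E ∧ E ≤ L ∧ E.relIndex L = p := by
  by_cases hs : SmulLE p L A
  · have := (card_between h hs hi).2
    have h0 : geomSum p 2 ≠ 0 := by simp [geomSum, Finset.sum_range_succ]
    rw [← this] at h0
    exact Set.nonempty_of_ncard_ne_zero h0
  · obtain ⟨x, hx, hpx⟩ : ∃ x ∈ L, p • x ∉ A := by
      simpa [SmulLE] using hs
    refine ⟨A ⊔ AddSubgroup.zmultiples (p • x), le_sup_left, sup_le h ?_, ?_⟩
    · rw [AddSubgroup.zmultiples_le]
      exact L.nsmul_mem hx p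
    · set E := A ⊔ AddSubgroup.zmultiples (p • x) with hE
      have hEL : E ≤ L := sup_le h (by
        rw [AddSubgroup.zmultiples_le]
        exact L.nsmul_mem hx p)
      have h1 := relIndex_mul (A := A) (E := E) (L := L) le_sup_left hEL
      rw [hi] at h1
      -- The index of A in E is that of A ∩ ⟨px⟩ in ⟨px⟩, and the intersection contains ⟨p²x⟩.
      have h2 : A.relIndex E ∣ p := by
        rw [hE, sup_comm, AddSubgroup.relIndex_sup_right]
        have hb : (A ⊓ AddSubgroup.zmultiples (p • x)).relIndex (AddSubgroup.zmultiples (p • x)) ∣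
            p := by
          have hle : AddSubgroup.zmultiples (p • (p • x)) ≤
              A ⊓ AddSubgroup.zmultiples (p • x) := by
            refine (AddSubgroup.zmultiples_le).2 ⟨?_, ?_⟩
            · have := smulLE_sq_of_relIndex hi x hx
              rwa [sq, mul_smul] at this
            · exact AddSubgroup.nsmul_mem _ (AddSubgroup.mem_zmultiples _) p
          refine (AddSubgroup.relIndex_dvd_of_le_left _ hle).trans ?_
          have e1 : AddSubgroup.zmultiples (p • x) =
              (⊤ : AddSubgroup ℤ).map (zmultiplesHom V (p • x)) := by
            ext; simp [AddSubgroup.mem_zmultiples_iff]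
          have e2 : AddSubgroup.zmultiples (p • (p • x)) =
              (AddSubgroup.zmultiples (p : ℤ)).map (zmultiplesHom V (p • x)) := by
            rw [AddMonoidHom.map_zmultiples]
            simp
          rw [e1, e2, AddSubgroup.relIndex_map_map]
          refine (AddSubgroup.relIndex_dvd_of_le_left _ le_sup_left).trans ?_
          rw [top_sup_eq, AddSubgroup.relIndex_top_right, Int.index_zmultiples]
          simp
        rwa [AddSubgroup.inf_relIndex_right] at hb
      rcases (Nat.dvd_prime hp.out).1 h2 with h3 | h3
      · exfalso
        apply hpx
        have := AddSubgroup.relIndex_eq_one.1 h3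
        exact this ((le_sup_right : _ ≤ E) (AddSubgroup.mem_zmultiples _))
      · rw [h3, sq] at h1
        exact Nat.eq_of_mul_eq_mul_left hp.out.pos h1

/-- In the elementary case these are the hyperplanes of a plane. Otherwise two different ones would
meet exactly in A, and as both contain pL this would force pL ≤ A. -/
lemma ncard_between {A L : AddSubgroup V} (h : A ≤ L) (hi : A.relIndex L = p ^ 2) :
    {E : AddSubgroup V | A ≤ E ∧ E ≤ L ∧ E.relIndex L = p}.ncard = midCount p A L := by
  by_cases hs : SmulLE p L A
  · rw [midCount_of_smulLE hs, (card_between h hs hi).2]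
    simp [geomSum, Finset.sum_range_succ, add_comm]
  · rw [midCount_of_not_smulLE hs, Set.ncard_eq_one]
    obtain ⟨E, hE⟩ := exists_between h hi
    refine ⟨E, Set.eq_singleton_iff_unique_mem.2 ⟨hE, ?_⟩⟩
    rintro F ⟨hAF, hFL, hF⟩
    by_contra hne
    apply hs
    have hE' := (relIndex_mid_iff hE.1 hE.2.1 hi).2 hE.2.2
    rcases eq_or_eq_of_between (le_inf hE.1 hAF) inf_le_left hE' with h1 | h1
    · rw [← h1]
      exact (smulLE_of_relIndex hE.2.2).inf (smulLE_of_relIndex hF)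
    · have h2 : E ≤ F := inf_eq_left.1 h1
      rcases eq_or_eq_of_between h2 hFL hE.2.2 with h3 | h3
      · exact absurd h3 hne
      · subst h3
        rw [AddSubgroup.relIndex_self] at hF
        exact absurd hF hp.out.one_lt.ne

lemma ncard_between' {A L : AddSubgroup V} (h : A ≤ L) (hi : A.relIndex L = p ^ 2) :
    {E : AddSubgroup V | A ≤ E ∧ E ≤ L ∧ A.relIndex E = p}.ncard = midCount p A L := by
  rw [← ncard_between h hi]
  congr 1
  ext E
  constructor
  · rintro ⟨h1, h2, h3⟩
    exact ⟨h1, h2, (relIndex_mid_iff h1 h2 hi).1 h3⟩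
  · rintro ⟨h1, h2, h3⟩
    exact ⟨h1, h2, (relIndex_mid_iff h1 h2 hi).2 h3⟩

/-! ### Counting in lattices -/

/-- `[L : p L] = p ^ n`. -/
def HasRank (p n : ℕ) (L : AddSubgroup V) : Prop :=
  (L.map (nsmulAddMonoidHom p)).relIndex L = p ^ n

variable [Module ℚ V]

/-- In a ℚ-vector space multiplication by p is bijective, so p⁻¹A is available as a comap and counts
above A mirror counts below L. -/
lemma nsmul_injective : Function.Injective (nsmulAddMonoidHom p : V →+ V) := by
  intro x y h
  have h : p • x = p • y := h
  rw [← Nat.cast_smul_eq_nsmul ℚ, ← Nat.cast_smul_eq_nsmul ℚ] at h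
  exact smul_right_injective V (Nat.cast_ne_zero.2 hp.out.ne_zero : (p : ℚ) ≠ 0) h

lemma nsmul_surjective : Function.Surjective (nsmulAddMonoidHom p : V →+ V) := by
  intro x
  refine ⟨(p : ℚ)⁻¹ • x, ?_⟩
  change p • _ = x
  rw [← Nat.cast_smul_eq_nsmul ℚ, smul_inv_smul₀ (Nat.cast_ne_zero.2 hp.out.ne_zero)]

variable {n m : ℕ} {L A N M : AddSubgroup V}

/-- Multiplication by p carries the pair L ≤ p⁻¹L to pL ≤ L. -/
lemma HasRank.comap (h : HasRank p n L) :
    L.relIndex (L.comap (nsmulAddMonoidHom p)) = p ^ n := by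
  rw [← AddSubgroup.relIndex_map_map_of_injective _ _ (nsmul_injective (p := p)),
    AddSubgroup.map_comap_eq_self_of_surjective nsmul_surjective]
  exact h

/-- Compute [L : pA] through A and through pL; since [pL : pA] = [L : A], this finite factor
cancels. -/
lemma hasRank_iff_of_le (hAL : A ≤ L) (hi : A.relIndex L ≠ 0) :
    HasRank p n A ↔ HasRank p n L := by
  have h1 := relIndex_mul (map_nsmul_le (p := p) A) hAL
  have h2 := relIndex_mul (AddSubgroup.map_mono (f := nsmulAddMonoidHom p) hAL) (map_nsmul_le L)
  rw [AddSubgroup.relIndex_map_map_of_injective _ _ nsmul_injective, ← h1, mul_comm] at h2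
  have h3 := Nat.eq_of_mul_eq_mul_right (Nat.pos_of_ne_zero hi) h2
  rw [HasRank, HasRank, h3]

/-- A subgroup of index p contains pL, so it is a hyperplane of L/pL. -/
lemma ncard_under (h : HasRank p n L) :
    {A | A ≤ L ∧ A.relIndex L = p}.ncard = geomSum p n := by
  rw [← (card_between (map_nsmul_le (p := p) L)
    (map_nsmul_le_iff.1 le_rfl) h).2]
  congr 1
  ext A
  exact ⟨fun ⟨h1, h2⟩ => ⟨map_nsmul_le_iff.2 (smulLE_of_relIndex h2), h1, h2⟩, fun h => h.2⟩

/-- Such an N lies in p⁻¹A, so it is a line of p⁻¹A/A. -/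
lemma ncard_over (h : HasRank p n A) :
    {N | A ≤ N ∧ A.relIndex N = p}.ncard = geomSum p n := by
  rw [← (card_between (le_comap_nsmul (p := p) A)
    (le_comap_nsmul_iff.1 le_rfl) h.comap).1]
  congr 1
  ext N
  exact ⟨fun ⟨h1, h2⟩ => ⟨h1, le_comap_nsmul_iff.2 (smulLE_of_relIndex h2), h2⟩,
    fun h => ⟨h.1, h.2.2⟩⟩

/-- All these groups contain p²L, which has finite index in L. -/
lemma finite_under (h : HasRank p n L) : {A | A ≤ L ∧ A.relIndex L = p ^ 2}.Finite := by
  have h1 := relIndex_mul (map_nsmul_le (p := p) (L.map (nsmulAddMonoidHom p)))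
    (map_nsmul_le (p := p) L)
  rw [AddSubgroup.relIndex_map_map_of_injective _ _ nsmul_injective, h] at h1
  refine (finite_between (A := (L.map (nsmulAddMonoidHom p)).map (nsmulAddMonoidHom p)) (T := L)
    ?_).subset ?_
  · rw [← h1]
    exact mul_ne_zero (pow_ne_zero _ hp.out.ne_zero) (pow_ne_zero _ hp.out.ne_zero)
  · rintro A ⟨h2, h3⟩
    refine ⟨?_, h2⟩
    rintro _ ⟨_, ⟨x, hx, rfl⟩, rfl⟩
    have := smulLE_sq_of_relIndex h3 x hx
    rwa [sq, mul_smul] at this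

lemma finite_over (h : HasRank p n A) : {N | A ≤ N ∧ A.relIndex N = p ^ 2}.Finite := by
  set f : V →+ V := nsmulAddMonoidHom p
  have hc := h.comap
  have hr : HasRank p n (A.comap f) := by
    rw [← hasRank_iff_of_le (le_comap_nsmul (p := p) A)]
    · exact h
    · rw [hc]
      exact pow_ne_zero _ hp.out.ne_zero
  refine (finite_between (A := A) (T := (A.comap f).comap f) ?_).subset ?_
  · rw [← relIndex_mul (le_comap_nsmul (p := p) A) (le_comap_nsmul (p := p) (A.comap f)), hc,
      hr.comap]
    exact mul_ne_zero (pow_ne_zero _ hp.out.ne_zero) (pow_ne_zero _ hp.out.ne_zero)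
  · rintro N ⟨h2, h3⟩
    refine ⟨h2, ?_⟩
    intro x hx
    have := smulLE_sq_of_relIndex h3 x hx
    rwa [sq, mul_smul] at this

lemma finite_under_prime (h : HasRank p n L) : {A | A ≤ L ∧ A.relIndex L = p}.Finite := by
  refine (finite_between (A := L.map (nsmulAddMonoidHom p)) (T := L) ?_).subset ?_
  · rw [h]
    exact pow_ne_zero _ hp.out.ne_zero
  · rintro A ⟨h2, h3⟩
    exact ⟨map_nsmul_le_iff.2 (smulLE_of_relIndex h3), h2⟩

lemma finite_over_prime (h : HasRank p n A) : {N | A ≤ N ∧ A.relIndex N = p}.Finite := by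
  refine (finite_between (A := A) (T := A.comap (nsmulAddMonoidHom p)) ?_).subset ?_
  · rw [h.comap]
    exact pow_ne_zero _ hp.out.ne_zero
  · rintro N ⟨h2, h3⟩
    exact ⟨h2, le_comap_nsmul_iff.2 (smulLE_of_relIndex h3)⟩

/-- These are the subgroups of index p of N/pL, an elementary group of order p ^ m. -/
lemma ncard_under_smulLE (h : HasRank p (m + 1) L) (hNL : N ≤ L) (hi : N.relIndex L = p) :
    {A | A ≤ N ∧ A.relIndex N = p ∧ SmulLE p L A}.ncard = geomSum p m := by
  have hle : L.map (nsmulAddMonoidHom p) ≤ N := map_nsmul_le_iff.2 (smulLE_of_relIndex hi)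
  have h1 := relIndex_mul hle hNL
  rw [hi, h, pow_succ] at h1
  have h2 := Nat.eq_of_mul_eq_mul_right hp.out.pos h1
  rw [← (card_between hle
    ((map_nsmul_le_iff.1 le_rfl : SmulLE p L _).mono hNL le_rfl) h2).2]
  congr 1
  ext A
  exact ⟨fun ⟨h1, h2, h3⟩ => ⟨map_nsmul_le_iff.2 h3, h1, h2⟩,
    fun ⟨h1, h2, h3⟩ => ⟨h2, h3, map_nsmul_le_iff.1 h1⟩⟩

/-- These are the subgroups of order p of p⁻¹A/N, an elementary group of order p ^ m. -/
lemma ncard_over_smulLE (h : HasRank p (m + 1) A) (hAN : A ≤ N) (hi : A.relIndex N = p) :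
    {M | N ≤ M ∧ N.relIndex M = p ∧ SmulLE p M A}.ncard = geomSum p m := by
  have hle : N ≤ A.comap (nsmulAddMonoidHom p) := le_comap_nsmul_iff.2 (smulLE_of_relIndex hi)
  have h1 := relIndex_mul hAN hle
  rw [hi, h.comap, pow_succ'] at h1
  have h2 := Nat.eq_of_mul_eq_mul_left hp.out.pos h1
  rw [← (card_between hle
    ((le_comap_nsmul_iff.1 le_rfl : SmulLE p _ A).mono le_rfl hAN) h2).1]
  congr 1
  ext M
  exact ⟨fun ⟨h1, h2, h3⟩ => ⟨h1, le_comap_nsmul_iff.2 h3, h2⟩,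
    fun ⟨h1, h2, h3⟩ => ⟨h1, h3, le_comap_nsmul_iff.1 h2⟩⟩

/-- Count flags A < N < L with steps of index p: each N has `geomSum p m` admissible A below it, and
each A has p + 1 intermediate N. -/
lemma ncard_under_sq_smulLE (h : HasRank p (m + 1) L) :
    {A | A ≤ L ∧ A.relIndex L = p ^ 2 ∧ SmulLE p L A}.ncard * (p + 1) =
      geomSum p (m + 1) * geomSum p m := by
  rw [← ncard_under h]
  symm
  refine ncard_mul_eq_ncard_mul (fun N A => A ≤ N) (finite_under_prime h)
    ((finite_under h).subset fun A hA => ⟨hA.1, hA.2.1⟩) ?_ ?_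
  · rintro N ⟨hN, hi⟩
    rw [← ncard_under_smulLE h hN hi]
    congr 1
    ext A
    constructor
    · rintro ⟨⟨h1, h2, h3⟩, h4⟩
      exact ⟨h4, (relIndex_mid_iff h4 hN h2).2 hi, h3⟩
    · rintro ⟨h1, h2, h3⟩
      refine ⟨⟨h1.trans hN, ?_, h3⟩, h1⟩
      rw [← relIndex_mul h1 hN, h2, hi, sq]
  · rintro A ⟨h1, h2, h3⟩
    rw [← midCount_of_smulLE h3, ← ncard_between h1 h2]
    congr 1
    ext N
    exact ⟨fun ⟨⟨h4, h5⟩, h6⟩ => ⟨h6, h4, h5⟩, fun ⟨h4, h5, h6⟩ => ⟨⟨h5, h6⟩, h4⟩⟩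

/-- For cyclic L/A the intermediate N is unique, and each N has `geomSum p (m + 1) - geomSum p m` =
p ^ m such A below it. -/
lemma ncard_under_sq_not_smulLE (h : HasRank p (m + 1) L) :
    {A | A ≤ L ∧ A.relIndex L = p ^ 2 ∧ ¬ SmulLE p L A}.ncard =
      geomSum p (m + 1) * p ^ m := by
  rw [← ncard_under h, ← mul_one (Set.ncard _)]
  symm
  refine ncard_mul_eq_ncard_mul (fun N A => A ≤ N) (finite_under_prime h)
    ((finite_under h).subset fun A hA => ⟨hA.1, hA.2.1⟩) ?_ ?_
  · rintro N ⟨hN, hi⟩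
    have hr : HasRank p (m + 1) N := (hasRank_iff_of_le hN (by rw [hi]; exact hp.out.ne_zero)).2 h
    have e : {A | A ∈ {A | A ≤ L ∧ A.relIndex L = p ^ 2 ∧ ¬ SmulLE p L A} ∧ A ≤ N} =
        {A | A ≤ N ∧ A.relIndex N = p} \ {A | A ≤ N ∧ A.relIndex N = p ∧ SmulLE p L A} := by
      ext A
      constructor
      · rintro ⟨⟨h1, h2, h3⟩, h4⟩
        exact ⟨⟨h4, (relIndex_mid_iff h4 hN h2).2 hi⟩, fun h5 => h3 h5.2.2⟩
      · rintro ⟨⟨h1, h2⟩, h3⟩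
        refine ⟨⟨h1.trans hN, ?_, fun h5 => h3 ⟨h1, h2, h5⟩⟩, h1⟩
        rw [← relIndex_mul h1 hN, h2, hi, sq]
    have hsub : {A | A ≤ N ∧ A.relIndex N = p ∧ SmulLE p L A} ⊆
        {A | A ≤ N ∧ A.relIndex N = p} := fun A hA => ⟨hA.1, hA.2.1⟩
    rw [e, Set.ncard_sdiff hsub ((finite_under_prime hr).subset hsub), ncard_under hr,
      ncard_under_smulLE h hN hi, geomSum_succ, Nat.add_sub_cancel_left]
  · rintro A ⟨h1, h2, h3⟩
    rw [← midCount_of_not_smulLE h3, ← ncard_between h1 h2]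
    congr 1
    ext N
    exact ⟨fun ⟨⟨h4, h5⟩, h6⟩ => ⟨h6, h4, h5⟩, fun ⟨h4, h5, h6⟩ => ⟨⟨h5, h6⟩, h4⟩⟩

end Neighbours
end HeckeGL

namespace HeckeGL

set_option linter.unusedSectionVars false

/-! ### Counting the lattices over A that meet L only in A. -/

section Neighbours

variable {p : ℕ} [hp : Fact p.Prime] {V : Type*} [AddCommGroup V] [Module ℚ V]
  {n m : ℕ} {L A N M B : AddSubgroup V}

/-- The subgroups of order `p` over `A` which are not in `L`. -/
lemma ncard_over_not_le (h : HasRank p n A) (hAL : A ≤ L) (hi : A.relIndex L = p ^ 2) :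
    {N | A ≤ N ∧ A.relIndex N = p ∧ ¬ N ≤ L}.ncard = geomSum p n - midCount p A L := by
  rw [← ncard_over h, ← ncard_between' hAL hi]
  have e : {N | A ≤ N ∧ A.relIndex N = p ∧ ¬ N ≤ L} =
      {N | A ≤ N ∧ A.relIndex N = p} \ {N | A ≤ N ∧ N ≤ L ∧ A.relIndex N = p} := by
    ext N
    exact ⟨fun ⟨h1, h2, h3⟩ => ⟨⟨h1, h2⟩, fun h4 => h3 h4.2.1⟩,
      fun ⟨⟨h1, h2⟩, h3⟩ => ⟨h1, h2, fun h4 => h3 ⟨h1, h4, h2⟩⟩⟩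
  have hsub : {N | A ≤ N ∧ N ≤ L ∧ A.relIndex N = p} ⊆ {N | A ≤ N ∧ A.relIndex N = p} :=
    fun N hN => ⟨hN.1, hN.2.2⟩
  rw [e, Set.ncard_sdiff hsub ((finite_over_prime h).subset hsub)]

lemma inf_eq_of_not_le (hAL : A ≤ L) (hAN : A ≤ N) (hi : A.relIndex N = p) (hNL : ¬ N ≤ L) :
    N ⊓ L = A := by
  rcases eq_or_eq_of_between (le_inf hAN hAL) inf_le_left hi with h | h
  · exact h
  · exact absurd (inf_eq_left.1 h) hNL

lemma relIndex_sup_of_inf_eq (h : N ⊓ L = A) : N.relIndex (L ⊔ N) = A.relIndex L := by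
  rw [AddSubgroup.relIndex_sup_right, ← AddSubgroup.inf_relIndex_right, h]

/-- Between `N` and `L ⊔ N` all subgroups of order `p` over `N` satisfy `p M ≤ A`. -/
lemma smulLE_of_between_sup (hAN : A ≤ N) (hi : A.relIndex N = p)
    (hNL : N ⊓ L = A) (hNM : N ≤ M) (hML : M ≤ L ⊔ N) (hM : N.relIndex M = p) :
    SmulLE p M A := by
  -- By the modular law M = (M ⊓ L) + N, and p sends both summands into A.
  have hmod : (M ⊓ L) ⊔ N = M := by
    rw [inf_sup_assoc_of_le _ hNM, inf_eq_left.2 hML]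
  have h1 : N.relIndex M = A.relIndex (M ⊓ L) := by
    conv_lhs => rw [← hmod]
    apply relIndex_sup_of_inf_eq
    rw [inf_comm M L, ← inf_assoc, hNL, inf_eq_left]
    exact hAN.trans hNM
  rw [← hmod]
  exact (smulLE_of_relIndex (h1.symm.trans hM)).sup (smulLE_of_relIndex hi)

/-- When N is enlarged to M, the intersection with L stays A unless M lies in L + N: inside L + N
the modular law gives M = (M ⊓ L) + N, while otherwise M ⊓ (L ⊔ N) = N. The condition M ⊓ L = A thus
becomes the removal of the M below L ⊔ N. -/
lemma inf_eq_iff_not_le_sup (hAL : A ≤ L) (hAN : A ≤ N)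
    (hNL : N ⊓ L = A) (hNM : N ≤ M) (hM : N.relIndex M = p) : M ⊓ L = A ↔ ¬ M ≤ L ⊔ N := by
  constructor
  · intro h hle
    have hmod : (M ⊓ L) ⊔ N = M := by
      rw [inf_sup_assoc_of_le _ hNM, inf_eq_left.2 hle]
    rw [h, sup_eq_right.2 hAN] at hmod
    rw [hmod, AddSubgroup.relIndex_self] at hM
    exact hp.out.one_lt.ne hM
  · intro h
    rcases eq_or_eq_of_between (E := M ⊓ (L ⊔ N)) (le_inf hNM le_sup_right) inf_le_left hM with
      h1 | h1
    · refine le_antisymm ?_ (le_inf (hAN.trans hNM) hAL)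
      rw [← hNL, ← h1]
      exact le_inf (le_inf inf_le_left (inf_le_right.trans le_sup_left)) inf_le_right
    · exact absurd (inf_eq_left.1 h1) h

/-- The quotient (L + N)/N is isomorphic to L/A, so it has as many intermediate groups. -/
lemma ncard_between_sup (hAN : A ≤ N)
    (hi2 : A.relIndex L = p ^ 2) (hNL : N ⊓ L = A) :
    {M | N ≤ M ∧ M ≤ L ⊔ N ∧ N.relIndex M = p}.ncard = midCount p A L := by
  rw [ncard_between' le_sup_right ((relIndex_sup_of_inf_eq hNL).trans hi2)]
  have : SmulLE p (L ⊔ N) N ↔ SmulLE p L A := by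
    constructor
    · intro h
      rw [← hNL]
      exact (h.mono le_sup_left le_rfl).inf (SmulLE.self L)
    · intro h
      exact (h.mono le_rfl hAN).sup (SmulLE.self N)
  by_cases hs : SmulLE p L A
  · rw [midCount_of_smulLE hs, midCount_of_smulLE (this.2 hs)]
  · rw [midCount_of_not_smulLE hs, midCount_of_not_smulLE (mt this.1 hs)]

lemma relIndex_sq (hAN : A ≤ N) (hNM : N ≤ M) (hi : A.relIndex N = p) (hi' : N.relIndex M = p) :
    A.relIndex M = p ^ 2 := by
  rw [← relIndex_mul hAN hNM, hi, hi', sq]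

/-- Count flags A < N < M with N not in L and M not in L + N. The M below L + N all satisfy pM ≤ A,
so all of them are removed from the `geomSum p m` candidates over N. -/
lemma ncard_over_sq_smulLE (h : HasRank p (m + 1) A) (hAL : A ≤ L) (hi : A.relIndex L = p ^ 2) :
    {M | A ≤ M ∧ A.relIndex M = p ^ 2 ∧ M ⊓ L = A ∧ SmulLE p M A}.ncard * (p + 1) =
      (geomSum p (m + 1) - midCount p A L) * (geomSum p m - midCount p A L) := by
  rw [← ncard_over_not_le h hAL hi]
  symm
  refine ncard_mul_eq_ncard_mul (fun N M => N ≤ M)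
    ((finite_over_prime h).subset fun N hN => ⟨hN.1, hN.2.1⟩)
    ((finite_over h).subset fun A hA => ⟨hA.1, hA.2.1⟩) ?_ ?_
  · rintro N ⟨hAN, hN, hNL⟩
    have hinf := inf_eq_of_not_le hAL hAN hN hNL
    have e : {M | M ∈ {M | A ≤ M ∧ A.relIndex M = p ^ 2 ∧ M ⊓ L = A ∧ SmulLE p M A} ∧ N ≤ M} =
        {M | N ≤ M ∧ N.relIndex M = p ∧ SmulLE p M A} \
          {M | N ≤ M ∧ M ≤ L ⊔ N ∧ N.relIndex M = p} := by
      ext M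
      constructor
      · rintro ⟨⟨h1, h2, h3, h4⟩, h5⟩
        have h6 := (relIndex_mid_iff hAN h5 h2).1 hN
        exact ⟨⟨h5, h6, h4⟩,
          fun h7 => (inf_eq_iff_not_le_sup hAL hAN hinf h5 h6).1 h3 h7.2.1⟩
      · rintro ⟨⟨h1, h2, h3⟩, h4⟩
        exact ⟨⟨hAN.trans h1, relIndex_sq hAN h1 hN h2,
          (inf_eq_iff_not_le_sup hAL hAN hinf h1 h2).2 fun h5 => h4 ⟨h1, h5, h2⟩, h3⟩, h1⟩
    have hsub : {M | N ≤ M ∧ M ≤ L ⊔ N ∧ N.relIndex M = p} ⊆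
        {M | N ≤ M ∧ N.relIndex M = p ∧ SmulLE p M A} := fun M hM =>
      ⟨hM.1, hM.2.2, smulLE_of_between_sup hAN hN hinf hM.1 hM.2.1 hM.2.2⟩
    have hr : HasRank p (m + 1) N := (hasRank_iff_of_le hAN (by rw [hN]; exact hp.out.ne_zero)).1 h
    rw [e, Set.ncard_sdiff hsub ((finite_over_prime hr).subset fun M hM => ⟨hM.1, hM.2.2⟩),
      ncard_over_smulLE h hAN hN, ncard_between_sup hAN hi hinf]
  · rintro M ⟨h1, h2, h3, h4⟩
    rw [← midCount_of_smulLE h4, ← ncard_between' h1 h2]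
    congr 1
    ext N
    constructor
    · rintro ⟨⟨h5, h6, h7⟩, h8⟩
      exact ⟨h5, h8, h6⟩
    · rintro ⟨h5, h6, h7⟩
      exact ⟨⟨h5, h7, fun h8 => ne_of_relIndex h7 ((le_inf h6 h8).trans h3.le)⟩, h6⟩

/-- Here N is determined by M. Nothing has to be removed for meeting L too much, because every M
below L + N has pM ≤ A and is already excluded. -/
lemma ncard_over_sq_not_smulLE (h : HasRank p (m + 1) A) (hAL : A ≤ L)
    (hi : A.relIndex L = p ^ 2) :
    {M | A ≤ M ∧ A.relIndex M = p ^ 2 ∧ M ⊓ L = A ∧ ¬ SmulLE p M A}.ncard =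
      (geomSum p (m + 1) - midCount p A L) * p ^ m := by
  rw [← ncard_over_not_le h hAL hi, ← mul_one (Set.ncard {M | A ≤ M ∧ _})]
  symm
  refine ncard_mul_eq_ncard_mul (fun N M => N ≤ M)
    ((finite_over_prime h).subset fun N hN => ⟨hN.1, hN.2.1⟩)
    ((finite_over h).subset fun A hA => ⟨hA.1, hA.2.1⟩) ?_ ?_
  · rintro N ⟨hAN, hN, hNL⟩
    have hinf := inf_eq_of_not_le hAL hAN hN hNL
    have e : {M | M ∈ {M | A ≤ M ∧ A.relIndex M = p ^ 2 ∧ M ⊓ L = A ∧ ¬ SmulLE p M A} ∧ N ≤ M} =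
        {M | N ≤ M ∧ N.relIndex M = p} \ {M | N ≤ M ∧ N.relIndex M = p ∧ SmulLE p M A} := by
      ext M
      constructor
      · rintro ⟨⟨h1, h2, h3, h4⟩, h5⟩
        exact ⟨⟨h5, (relIndex_mid_iff hAN h5 h2).1 hN⟩, fun h7 => h4 h7.2.2⟩
      · rintro ⟨⟨h1, h2⟩, h4⟩
        exact ⟨⟨hAN.trans h1, relIndex_sq hAN h1 hN h2,
          (inf_eq_iff_not_le_sup hAL hAN hinf h1 h2).2 fun h5 => h4
            ⟨h1, h2, smulLE_of_between_sup hAN hN hinf h1 h5 h2⟩,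
          fun h5 => h4 ⟨h1, h2, h5⟩⟩, h1⟩
    have hsub : {M | N ≤ M ∧ N.relIndex M = p ∧ SmulLE p M A} ⊆
        {M | N ≤ M ∧ N.relIndex M = p} := fun M hM => ⟨hM.1, hM.2.1⟩
    have hr : HasRank p (m + 1) N := (hasRank_iff_of_le hAN (by rw [hN]; exact hp.out.ne_zero)).1 h
    rw [e, Set.ncard_sdiff hsub ((finite_over_prime hr).subset hsub), ncard_over hr,
      ncard_over_smulLE h hAN hN, geomSum_succ, Nat.add_sub_cancel_left]
  · rintro M ⟨h1, h2, h3, h4⟩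
    rw [← midCount_of_not_smulLE h4, ← ncard_between' h1 h2]
    congr 1
    ext N
    constructor
    · rintro ⟨⟨h5, h6, h7⟩, h8⟩
      exact ⟨h5, h8, h6⟩
    · rintro ⟨h5, h6, h7⟩
      exact ⟨⟨h5, h7, fun h8 => ne_of_relIndex h7 ((le_inf h6 h8).trans h3.le)⟩, h6⟩

/-! ### Pairs of lattices -/

/-- `L ⊓ N` has index `q` both in `L` and in `N`. -/
def Dist (q : ℕ) (L N : AddSubgroup V) : Prop := N.relIndex L = q ∧ L.relIndex N = q

lemma Dist.symm {q : ℕ} (h : Dist q L N) : Dist q N L := ⟨h.2, h.1⟩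

lemma dist_iff {q : ℕ} : Dist q L N ↔ (L ⊓ N).relIndex L = q ∧ (L ⊓ N).relIndex N = q := by
  rw [AddSubgroup.inf_relIndex_left, AddSubgroup.inf_relIndex_right]
  rfl

lemma dist_one : Dist 1 L N ↔ L = N := by
  rw [Dist, AddSubgroup.relIndex_eq_one, AddSubgroup.relIndex_eq_one, le_antisymm_iff]

lemma smulLE_inf_iff : SmulLE p L (L ⊓ N) ↔ SmulLE p L N :=
  ⟨fun h => h.mono le_rfl inf_le_right, fun h => (SmulLE.self L).inf h⟩

lemma smulLE_inf_iff' : SmulLE p N (L ⊓ N) ↔ SmulLE p N L :=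
  ⟨fun h => h.mono le_rfl inf_le_left, fun h => h.inf (SmulLE.self N)⟩

/-- Counting the lattices `N` by means of the intersections `L ⊓ N`. -/
lemma ncard_by_inf {P Q : AddSubgroup V → AddSubgroup V → Prop} {q a c w : ℕ} (hw : 0 < w)
    (hfin : {A | A ≤ L ∧ A.relIndex L = q}.Finite)
    (hfin' : ∀ A, A ≤ L → A.relIndex L = q → {N | A ≤ N ∧ A.relIndex N = q}.Finite)
    (ha : {A | A ≤ L ∧ A.relIndex L = q ∧ P L A}.ncard = a)
    (hc : ∀ A, A ≤ L → A.relIndex L = q → P L A →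
      {N | A ≤ N ∧ A.relIndex N = q ∧ N ⊓ L = A ∧ Q N A}.ncard * w = c) :
    {N | Dist q L N ∧ P L (L ⊓ N) ∧ Q N (L ⊓ N)}.ncard * w = a * c := by
  have hfinA : {A | A ≤ L ∧ A.relIndex L = q ∧ P L A}.Finite :=
    hfin.subset fun A hA => ⟨hA.1, hA.2.1⟩
  -- Fibre counts are known only after multiplication by `w`. As soon as one A exists, `w` divides
  -- `c` and each fibre has c / w elements; without any A both sides vanish.
  have hdvd : a = 0 ∨ w ∣ c := by
    by_contra! h
    rw [← ha] at h
    obtain ⟨A, h1, h2, h3⟩ := Set.nonempty_of_ncard_ne_zero h.1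
    exact h.2 ⟨_, (hc A h1 h2 h3).symm.trans (mul_comm _ _)⟩
  suffices h : {N | Dist q L N ∧ P L (L ⊓ N) ∧ Q N (L ⊓ N)}.ncard * 1 = a * (c / w) by
    rw [mul_one] at h
    rw [h]
    rcases hdvd with h0 | h0
    · rw [h0]
      simp
    · rw [mul_assoc, Nat.div_mul_cancel h0]
  rw [← ha]
  symm
  have hfinT : {N | Dist q L N ∧ P L (L ⊓ N) ∧ Q N (L ⊓ N)}.Finite := by
    refine (hfin.biUnion fun A hA => hfin' A hA.1 hA.2).subset ?_
    rintro N ⟨h1, h2, h3⟩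
    rw [dist_iff] at h1
    simp only [Set.mem_iUnion]
    exact ⟨L ⊓ N, ⟨inf_le_left, h1.1⟩, inf_le_right, h1.2⟩
  refine ncard_mul_eq_ncard_mul (fun A N => N ⊓ L = A) hfinA hfinT ?_ ?_
  · rintro A ⟨h1, h2, h3⟩
    rw [← hc A h1 h2 h3, Nat.mul_div_cancel _ hw]
    congr 1
    ext N
    constructor
    · rintro ⟨⟨h4, h5, h6⟩, h7⟩
      rw [dist_iff, inf_comm, h7] at h4
      rw [inf_comm, h7] at h6
      exact ⟨h7 ▸ inf_le_left, h4.2, h7, h6⟩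
    · rintro ⟨h4, h5, h6, h7⟩
      refine ⟨⟨?_, ?_, ?_⟩, h6⟩
      · rw [dist_iff, inf_comm, h6]
        exact ⟨h2, h5⟩
      · rw [inf_comm, h6]
        exact h3
      · rw [inf_comm, h6]
        exact h7
  · rintro N ⟨h1, h2, h3⟩
    rw [Set.ncard_eq_one]
    refine ⟨L ⊓ N, Set.eq_singleton_iff_unique_mem.2
      ⟨⟨⟨inf_le_left, (dist_iff.1 h1).1, h2⟩, inf_comm _ _⟩, ?_⟩⟩
    rintro B ⟨_, h5⟩
    rw [← h5, inf_comm]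

/-- Choose the intersection A as a subgroup of index p of L, then N among the groups of order p over
A other than L itself. -/
lemma ncard_dist (h : HasRank p n L) :
    {N | Dist p L N}.ncard = geomSum p n * (geomSum p n - 1) := by
  have := ncard_by_inf one_pos (L := L) (q := p) (P := fun _ _ => True) (Q := fun _ _ => True)
    (a := geomSum p n) (c := geomSum p n - 1) (finite_under_prime h) ?_ ?_ ?_
  · simpa using this
  · intro A h1 h2
    exact finite_over_prime ((hasRank_iff_of_le h1 (by rw [h2]; exact hp.out.ne_zero)).2 h)
  · simpa using ncard_under h
  · intro A h1 h2 _
    have hr : HasRank p n A := (hasRank_iff_of_le h1 (by rw [h2]; exact hp.out.ne_zero)).2 h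
    rw [mul_one, ← ncard_over hr, ← Set.ncard_sdiff_singleton_of_mem (show L ∈ {N | A ≤ N ∧ A.relIndex N = p} from ⟨h1, h2⟩)]
    congr 1
    ext N
    constructor
    · rintro ⟨h3, h4, h5, _⟩
      refine ⟨⟨h3, h4⟩, ?_⟩
      rintro rfl
      rw [inf_idem] at h5
      rw [h5, AddSubgroup.relIndex_self] at h4
      exact hp.out.one_lt.ne h4
    · rintro ⟨⟨h3, h4⟩, h5⟩
      refine ⟨h3, h4, inf_eq_of_not_le h1 h3 h4 fun h6 => h5 ?_, trivial⟩
      rcases eq_or_eq_of_between h3 h6 h2 with h7 | h7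
      · rw [h7, AddSubgroup.relIndex_self] at h4
        exact absurd h4 hp.out.one_lt.ne
      · exact h7

lemma HasRank.of_under (h : HasRank p n L) {k : ℕ} (hA : A ≤ L) (hi : A.relIndex L = p ^ k) :
    HasRank p n A :=
  (hasRank_iff_of_le hA (by rw [hi]; exact pow_ne_zero _ hp.out.ne_zero)).2 h

/-- At index p² there are four types, as each of the two quotients by L ⊓ N may be elementary or
not. `P` and `Q` stand for either alternative, so one count serves all four. -/
lemma ncard_dist_sq (h : HasRank p n L) {P Q : AddSubgroup V → AddSubgroup V → Prop} {a c w : ℕ}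
    (hw : 0 < w) (hP : ∀ N, P L (L ⊓ N) ↔ P L N) (hQ : ∀ N, Q N (L ⊓ N) ↔ Q N L)
    (ha : {A | A ≤ L ∧ A.relIndex L = p ^ 2 ∧ P L A}.ncard = a)
    (hc : ∀ A, A ≤ L → A.relIndex L = p ^ 2 → P L A →
      {N | A ≤ N ∧ A.relIndex N = p ^ 2 ∧ N ⊓ L = A ∧ Q N A}.ncard * w = c) :
    {N | Dist (p ^ 2) L N ∧ P L N ∧ Q N L}.ncard * w = a * c := by
  rw [← ncard_by_inf hw (finite_under h) (fun A h1 h2 => finite_over (h.of_under h1 h2)) ha hc]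
  simp only [hP, hQ]

lemma ncard_dist_sq_smulLE_smulLE (h : HasRank p (m + 1) L) :
    {N | Dist (p ^ 2) L N ∧ SmulLE p L N ∧ SmulLE p N L}.ncard * (p + 1) ^ 2 =
      geomSum p (m + 1) * geomSum p m * ((geomSum p (m + 1) - (p + 1)) *
        (geomSum p m - (p + 1))) := by
  rw [sq (p + 1), ← mul_assoc (Set.ncard _),
    ncard_dist_sq (P := SmulLE p) (Q := SmulLE p) h p.succ_pos
    (fun _ => smulLE_inf_iff) (fun _ => smulLE_inf_iff') rfl
    (c := (geomSum p (m + 1) - (p + 1)) * (geomSum p m - (p + 1))) ?_,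
    mul_right_comm, ncard_under_sq_smulLE h]
  intro A h1 h2 h3
  rw [ncard_over_sq_smulLE (h.of_under h1 h2) h1 h2, midCount_of_smulLE h3]

lemma ncard_dist_sq_smulLE_not (h : HasRank p (m + 1) L) :
    {N | Dist (p ^ 2) L N ∧ SmulLE p L N ∧ ¬ SmulLE p N L}.ncard * (p + 1) =
      geomSum p (m + 1) * geomSum p m * ((geomSum p (m + 1) - (p + 1)) * p ^ m) := by
  have := ncard_dist_sq (P := SmulLE p) (Q := fun N A => ¬ SmulLE p N A) h one_pos
    (fun _ => smulLE_inf_iff) (fun _ => not_congr smulLE_inf_iff') rfl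
    (c := (geomSum p (m + 1) - (p + 1)) * p ^ m) ?_
  · rw [mul_one] at this
    rw [this, mul_right_comm, ncard_under_sq_smulLE h]
  · intro A h1 h2 h3
    rw [mul_one, ncard_over_sq_not_smulLE (h.of_under h1 h2) h1 h2, midCount_of_smulLE h3]

lemma ncard_dist_sq_not_smulLE (h : HasRank p (m + 1) L) :
    {N | Dist (p ^ 2) L N ∧ ¬ SmulLE p L N ∧ SmulLE p N L}.ncard * (p + 1) =
      geomSum p (m + 1) * p ^ m * ((geomSum p (m + 1) - 1) * (geomSum p m - 1)) := by
  rw [ncard_dist_sq (P := fun N A => ¬ SmulLE p N A) (Q := SmulLE p) h p.succ_pos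
    (fun _ => not_congr smulLE_inf_iff) (fun _ => smulLE_inf_iff') (ncard_under_sq_not_smulLE h)]
  intro A h1 h2 h3
  rw [ncard_over_sq_smulLE (h.of_under h1 h2) h1 h2, midCount_of_not_smulLE h3]

lemma ncard_dist_sq_not_not (h : HasRank p (m + 1) L) :
    {N | Dist (p ^ 2) L N ∧ ¬ SmulLE p L N ∧ ¬ SmulLE p N L}.ncard =
      geomSum p (m + 1) * p ^ m * ((geomSum p (m + 1) - 1) * p ^ m) := by
  rw [← ncard_dist_sq (P := fun N A => ¬ SmulLE p N A) (Q := fun N A => ¬ SmulLE p N A) h one_pos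
    (fun _ => not_congr smulLE_inf_iff) (fun _ => not_congr smulLE_inf_iff')
    (ncard_under_sq_not_smulLE h), mul_one]
  intro A h1 h2 h3
  rw [mul_one, ncard_over_sq_not_smulLE (h.of_under h1 h2) h1 h2, midCount_of_not_smulLE h3]

/-! ### Common neighbours -/

lemma not_dist_self : ¬ Dist p L L := fun h => by
  have := h.1
  rw [AddSubgroup.relIndex_self] at this
  exact hp.out.one_lt.ne this

lemma dist_of_over (hAL : A ≤ L) (hL : A.relIndex L = p) (hAM : A ≤ M) (hM : A.relIndex M = p)
    (hne : M ≠ L) : Dist p L M := by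
  have : M ⊓ L = A := by
    refine inf_eq_of_not_le hAL hAM hM fun h => ?_
    rcases eq_or_eq_of_between hAM h hL with h1 | h1
    · rw [h1, AddSubgroup.relIndex_self] at hM
      exact hp.out.one_lt.ne hM
    · exact hne h1
  rw [dist_iff, inf_comm, this]
  exact ⟨hL, hM⟩

lemma dist_of_under (hLB : L ≤ B) (hL : L.relIndex B = p) (hMB : M ≤ B) (hM : M.relIndex B = p)
    (hne : M ≠ L) : Dist p L M := by
  have : L ⊔ M = B := by
    rcases eq_or_eq_of_between (le_sup_left : L ≤ L ⊔ M) (sup_le hLB hMB) hL with h | h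
    · have hML : M ≤ L := sup_eq_left.1 h
      rcases eq_or_eq_of_between hML hLB hM with h1 | h1
      · exact absurd h1.symm hne
      · rw [h1, AddSubgroup.relIndex_self] at hL
        exact absurd hL hp.out.one_lt.ne
    · exact h
  constructor
  · rw [← AddSubgroup.relIndex_sup_right, this, hM]
  · rw [← AddSubgroup.relIndex_sup_right, sup_comm, this, hL]

lemma Dist.inf_relIndex (h : Dist p L M) (hAL : A ≤ L) (hL : A.relIndex L = p) (hAM : A ≤ M) :
    A.relIndex M = p := by
  rcases eq_or_eq_of_between (le_inf hAL hAM) inf_le_left hL with h1 | h1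
  · rw [← h1]
    exact (dist_iff.1 h).2
  · exact absurd (inf_eq_left.1 h1) (ne_of_relIndex h.1)

lemma Dist.relIndex_sup (h : Dist p L M) (hLB : L ≤ B) (hL : L.relIndex B = p) (hMB : M ≤ B) :
    M.relIndex B = p := by
  rcases eq_or_eq_of_between (le_sup_left : L ≤ L ⊔ M) (sup_le hLB hMB) hL with h1 | h1
  · exact absurd (sup_eq_left.1 h1) (ne_of_relIndex h.2)
  · rw [← h1, AddSubgroup.relIndex_sup_right]
    exact h.1

/-- Both L ⊓ M and M ⊓ N have index p in M. If they coincide, they equal L ⊓ N, which therefore lies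
in M; if they differ, they generate M, which then lies in L ⊔ N. -/
lemma inf_le_or_le_sup (h : Dist p L N) (h1 : Dist p L M) (h2 : Dist p M N) :
    L ⊓ N ≤ M ∨ M ≤ L ⊔ N := by
  rcases eq_or_eq_of_between (E := (L ⊓ M) ⊔ (M ⊓ N)) le_sup_left
    (sup_le inf_le_right inf_le_left) (dist_iff.1 h1).2 with h3 | h3
  · left
    have h4 : M ⊓ N ≤ L ⊓ N := le_inf ((sup_eq_left.1 h3).trans inf_le_left) inf_le_right
    rcases eq_or_eq_of_between h4 inf_le_right (dist_iff.1 h2).2 with h5 | h5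
    · rw [h5]
      exact inf_le_left
    · exact absurd (inf_eq_right.1 h5) (ne_of_relIndex h.2)
  · right
    rw [← h3]
    exact sup_le (inf_le_left.trans le_sup_left) (inf_le_right.trans le_sup_right)

/-- Inclusion and exclusion between the groups of order p over A = L ⊓ N and those of index p in B =
L ⊔ N, leaving out L and N. The p + 1 groups of both kinds contain L and N, so p - 1 groups are
counted twice. -/
lemma ncard_common_of_dist (h : HasRank p n L) (hd : Dist p L N) :
    {M | Dist p L M ∧ Dist p M N}.ncard + (p - 1) = 2 * (geomSum p n - 2) := by
  set A := L ⊓ N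
  set B := L ⊔ N
  have hAL : A.relIndex L = p := (dist_iff.1 hd).1
  have hAN : A.relIndex N = p := (dist_iff.1 hd).2
  have hLB : L.relIndex B = p := by
    rw [show B = N ⊔ L from sup_comm _ _, AddSubgroup.relIndex_sup_right]
    exact hd.2
  have hNB : N.relIndex B = p := by
    rw [AddSubgroup.relIndex_sup_right]
    exact hd.1
  have hAB : A.relIndex B = p ^ 2 := relIndex_sq inf_le_left le_sup_left hAL hLB
  have hrA : HasRank p n A := h.of_under inf_le_left (k := 1) (by rw [hAL, pow_one])
  have hrB : HasRank p n B :=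
    (hasRank_iff_of_le le_sup_left (by rw [hLB]; exact hp.out.ne_zero)).1 h
  have hne : L ≠ N := by
    rintro rfl
    exact not_dist_self hd
  set U : Set (AddSubgroup V) := {M | A ≤ M ∧ A.relIndex M = p}
  set W : Set (AddSubgroup V) := {M | M ≤ B ∧ M.relIndex B = p}
  have hpU : {L, N} ⊆ U := by
    rintro M (rfl | rfl)
    · exact ⟨inf_le_left, hAL⟩
    · exact ⟨inf_le_right, hAN⟩
  have hpW : {L, N} ⊆ W := by
    rintro M (rfl | rfl)
    · exact ⟨le_sup_left, hLB⟩
    · exact ⟨le_sup_right, hNB⟩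
  have hfU : U.Finite := finite_over_prime hrA
  have hfW : W.Finite := finite_under_prime hrB
  have hUW : (U ∩ W).ncard = p + 1 := by
    -- B/A is elementary of order p², being generated by L/A and N/A.
    have hs : SmulLE p B A := (smulLE_of_relIndex hAL).sup (smulLE_of_relIndex hAN)
    rw [← midCount_of_smulLE hs, ← ncard_between (inf_le_left.trans le_sup_left) hAB]
    congr 1
    ext M
    exact ⟨fun ⟨h1, h2⟩ => ⟨h1.1, h2⟩,
      fun ⟨h1, h2, h3⟩ => ⟨⟨h1, (relIndex_mid_iff h1 h2 hAB).2 h3⟩, h2, h3⟩⟩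
  have e : {M | Dist p L M ∧ Dist p M N} = (U \ {L, N}) ∪ (W \ {L, N}) := by
    ext M
    constructor
    · rintro ⟨h1, h2⟩
      have h3 : M ∉ ({L, N} : Set (AddSubgroup V)) := by
        rintro (rfl | rfl)
        · exact not_dist_self h1
        · exact not_dist_self h2
      rcases inf_le_or_le_sup hd h1 h2 with h4 | h4
      · exact Or.inl ⟨⟨h4, h1.inf_relIndex inf_le_left hAL h4⟩, h3⟩
      · exact Or.inr ⟨⟨h4, h1.relIndex_sup le_sup_left hLB h4⟩, h3⟩
    · rintro (⟨⟨h1, h2⟩, h3⟩ | ⟨⟨h1, h2⟩, h3⟩)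
      · exact ⟨dist_of_over inf_le_left hAL h1 h2 fun h4 => h3 (Or.inl h4),
          (dist_of_over inf_le_right hAN h1 h2 fun h4 => h3 (Or.inr h4)).symm⟩
      · exact ⟨dist_of_under le_sup_left hLB h1 h2 fun h4 => h3 (Or.inl h4),
          (dist_of_under le_sup_right hNB h1 h2 fun h4 => h3 (Or.inr h4)).symm⟩
  have h1 := Set.ncard_union_add_ncard_inter (U \ {L, N}) (W \ {L, N}) hfU.sdiff hfW.sdiff
  have h2 : (U \ {L, N}) ∩ (W \ {L, N}) = (U ∩ W) \ {L, N} := by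
    ext; simp only [Set.mem_inter_iff, Set.mem_sdiff]; tauto
  rw [← e, h2, Set.ncard_sdiff (Set.subset_inter hpU hpW) (Set.toFinite _),
    Set.ncard_sdiff hpU (Set.toFinite _), Set.ncard_sdiff hpW (Set.toFinite _), hUW,
    Set.ncard_pair hne, ncard_over hrA, ncard_under hrB] at h1
  omega

/-- In an abelian group these are the indices of N in N + E and in the larger group N + M. -/
lemma relIndex_dvd_of_le {E : AddSubgroup V} (h : E ≤ M) : N.relIndex E ∣ N.relIndex M := by
  rw [← AddSubgroup.relIndex_sup_right (H := E), ← AddSubgroup.relIndex_sup_right (H := M)]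
  exact Dvd.intro _ (relIndex_mul le_sup_right (sup_le_sup_right h N))

lemma Dist.relIndex_dvd (h1 : Dist p L M) (h2 : Dist p M N) :
    ((L ⊓ M) ⊓ N).relIndex L ∣ p ^ 2 := by
  rw [← relIndex_mul (inf_le_left : (L ⊓ M) ⊓ N ≤ L ⊓ M) inf_le_left, (dist_iff.1 h1).1,
    AddSubgroup.inf_relIndex_left, sq]
  refine Nat.mul_dvd_mul_right ?_ p
  rw [← h2.1]
  exact relIndex_dvd_of_le inf_le_right

/-- L ⊓ M ⊓ N has the same index in L, in M and in N, and this index divides p². Hence L ⊓ N also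
has equal indices in L and N, dividing p². -/
lemma Dist.trans (h1 : Dist p L M) (h2 : Dist p M N) :
    Dist 1 L N ∨ Dist p L N ∨ Dist (p ^ 2) L N := by
  set X := (L ⊓ M) ⊓ N with hX
  have hXdvd : X.relIndex L ∣ p ^ 2 := h1.relIndex_dvd h2
  have hX' : X = L ⊓ (M ⊓ N) := inf_assoc _ _ _
  have e1 : X.relIndex L = X.relIndex M := by
    rw [← relIndex_mul (inf_le_left : X ≤ L ⊓ M) inf_le_left, (dist_iff.1 h1).1,
      ← relIndex_mul (inf_le_left : X ≤ L ⊓ M) inf_le_right, (dist_iff.1 h1).2]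
  have hXMN : X ≤ M ⊓ N := hX'.trans_le inf_le_right
  have e2 : X.relIndex M = X.relIndex N := by
    rw [← relIndex_mul hXMN inf_le_left, (dist_iff.1 h2).1,
      ← relIndex_mul hXMN inf_le_right, (dist_iff.1 h2).2]
  have hXLN : X ≤ L ⊓ N := le_inf (inf_le_left.trans inf_le_left) inf_le_right
  have e3 := relIndex_mul hXLN inf_le_left
  have e4 := relIndex_mul hXLN inf_le_right
  have h0 : X.relIndex (L ⊓ N) ≠ 0 := by
    intro h0
    rw [h0, zero_mul] at e3
    rw [← e3] at hXdvd
    exact pow_ne_zero _ hp.out.ne_zero (zero_dvd_iff.1 hXdvd)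
  have e5 : (L ⊓ N).relIndex L = (L ⊓ N).relIndex N := by
    apply Nat.eq_of_mul_eq_mul_left (Nat.pos_of_ne_zero h0)
    rw [e3, e4, e1, e2]
  have hdvd : (L ⊓ N).relIndex L ∣ p ^ 2 := (Dvd.intro_left _ e3).trans hXdvd
  simp only [dist_iff, ← e5, and_self]
  obtain ⟨k, hk, h⟩ := (Nat.dvd_prime_pow hp.out).1 hdvd
  rw [h]
  interval_cases k <;> simp

/-- A common neighbour M is determined by E = L ⊓ M and F = M ⊓ N, which are intermediate groups
between A and L, respectively A and N; conversely M = E + F for any such pair. -/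
lemma ncard_common_of_dist_sq (hd : Dist (p ^ 2) L N) :
    {M | Dist p L M ∧ Dist p M N}.ncard = midCount p (L ⊓ N) L * midCount p (L ⊓ N) N := by
  set A := L ⊓ N
  have hAL : A.relIndex L = p ^ 2 := (dist_iff.1 hd).1
  have hAN : A.relIndex N = p ^ 2 := (dist_iff.1 hd).2
  rw [← ncard_between inf_le_left hAL, ← ncard_between inf_le_right hAN, ← Set.ncard_prod]
  symm
  -- The modular law recovers E and F from E + F.
  have key (E F : AddSubgroup V) (hE : A ≤ E) (hEL : E ≤ L) (hF : A ≤ F) (hFN : F ≤ N) :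
      L ⊓ (E ⊔ F) = E ∧ (E ⊔ F) ⊓ N = F := by
    constructor
    · rw [inf_comm, sup_inf_assoc_of_le _ hEL, sup_eq_left]
      exact (le_inf inf_le_right (inf_le_left.trans hFN)).trans hE
    · rw [sup_comm, sup_inf_assoc_of_le _ hFN, sup_eq_left]
      exact (le_inf (inf_le_left.trans hEL) inf_le_right).trans hF
  refine Set.ncard_congr (fun x _ => x.1 ⊔ x.2) ?_ ?_ ?_
  · rintro ⟨E, F⟩ ⟨⟨hE, hEL, hi⟩, ⟨hF, hFN, hj⟩⟩
    obtain ⟨k1, k2⟩ := key E F hE hEL hF hFN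
    have hEF : E ⊓ F = A := le_antisymm (inf_le_inf hEL hFN) (le_inf hE hF)
    simp only [Set.mem_ofPred_eq, dist_iff, k1, k2]
    refine ⟨⟨hi, ?_⟩, ?_, hj⟩
    · rw [sup_comm, AddSubgroup.relIndex_sup_right, ← AddSubgroup.inf_relIndex_right, hEF]
      exact (relIndex_mid_iff hF hFN hAN).2 hj
    · rw [AddSubgroup.relIndex_sup_right, ← AddSubgroup.inf_relIndex_left, hEF]
      exact (relIndex_mid_iff hE hEL hAL).2 hi
  · rintro ⟨E, F⟩ ⟨E', F'⟩ ⟨⟨hE, hEL, hi⟩, ⟨hF, hFN, hj⟩⟩ ⟨⟨hE', hEL', hi'⟩, ⟨hF', hFN', hj'⟩⟩ h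
    simp only at h hE hEL hF hFN hE' hEL' hF' hFN'
    obtain ⟨k1, k2⟩ := key E F hE hEL hF hFN
    obtain ⟨k1', k2'⟩ := key E' F' hE' hEL' hF' hFN'
    rw [h] at k1 k2
    rw [← k1, ← k2, k1', k2']
  · rintro M ⟨h1, h2⟩
    -- L ⊓ M ⊓ N lies in A and its index in L divides p² = [L : A], so it equals A.
    have hAM : A ≤ M := by
      have hle : (L ⊓ M) ⊓ N ≤ A := le_inf (inf_le_left.trans inf_le_left) inf_le_right
      have h3 := relIndex_mul hle (inf_le_left : A ≤ L)
      have h4 := h1.relIndex_dvd h2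
      rw [← h3, hAL] at h4
      have h5 : ((L ⊓ M) ⊓ N).relIndex A = 1 := by
        have := Nat.dvd_of_mul_dvd_mul_right (pow_pos hp.out.pos 2) (h4.trans (one_mul _).symm.dvd)
        exact Nat.dvd_one.1 this
      rw [← eq_of_le_of_relIndex_eq hle h5]
      exact inf_le_left.trans inf_le_right
    refine ⟨(L ⊓ M, M ⊓ N), ⟨⟨le_inf inf_le_left hAM, inf_le_left, (dist_iff.1 h1).1⟩,
      ⟨le_inf hAM inf_le_right, inf_le_right, (dist_iff.1 h2).2⟩⟩, ?_⟩
    rcases eq_or_eq_of_between (E := (L ⊓ M) ⊔ (M ⊓ N)) le_sup_left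
      (sup_le inf_le_right inf_le_left) (dist_iff.1 h1).2 with h3 | h3
    -- If L ⊓ M and M ⊓ N did not generate M, then M ⊓ N would be A, which has index p² and not p in
    -- N.
    · exfalso
      have h4 : M ⊓ N ≤ A := le_inf ((sup_eq_left.1 h3).trans inf_le_left) inf_le_right
      have h5 : M ⊓ N = A := le_antisymm h4 (le_inf hAM inf_le_right)
      have h6 := (dist_iff.1 h2).2
      rw [h5, hAN] at h6
      have := hp.out.two_le
      nlinarith
    · exact h3

end Neighbours
end HeckeGL

namespace HeckeGL

open Matrix

/-! ### Row lattices -/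

section Lattice

variable {n : ℕ}

/-- The action of `x` on row vectors. -/
def act (x : GL (Fin n) ℚ) : (Fin n → ℚ) →+ (Fin n → ℚ) :=
  (Matrix.vecMulLinear (x : Matrix (Fin n) (Fin n) ℚ)).toAddMonoidHom

lemma act_apply (x : GL (Fin n) ℚ) (v : Fin n → ℚ) :
    act x v = v ᵥ* (x : Matrix (Fin n) (Fin n) ℚ) := rfl

lemma act_mul (x y : GL (Fin n) ℚ) : act (x * y) = (act y).comp (act x) := by
  refine AddMonoidHom.ext fun v => ?_
  rw [AddMonoidHom.comp_apply, act_apply, act_apply, act_apply, Matrix.vecMul_vecMul]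
  rfl

lemma act_one : act (1 : GL (Fin n) ℚ) = AddMonoidHom.id _ := by
  refine AddMonoidHom.ext fun v => ?_
  exact Matrix.vecMul_one v

lemma act_injective (x : GL (Fin n) ℚ) : Function.Injective (act x) := by
  refine Function.LeftInverse.injective (g := act x⁻¹) fun v => ?_
  have := congrArg (fun f => f v) (act_mul x x⁻¹)
  rw [mul_inv_cancel, act_one] at this
  exact this.symm

/-- The inclusion of `ℤ^n` in `ℚ^n`. -/
def intVec (n : ℕ) : (Fin n → ℤ) →+ (Fin n → ℚ) := (Int.castAddHom ℚ).compLeft (Fin n)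

lemma intVec_apply (w : Fin n → ℤ) (i : Fin n) : intVec n w i = w i := rfl

/-- The lattice `ℤ^n x` spanned by the rows of `x`. -/
def lat (x : GL (Fin n) ℚ) : AddSubgroup (Fin n → ℚ) := (intVec n).range.map (act x)

lemma mem_lat {x : GL (Fin n) ℚ} {v : Fin n → ℚ} :
    v ∈ lat x ↔ ∃ w : Fin n → ℤ, act x (intVec n w) = v := by
  simp [lat]

lemma lat_one : lat (1 : GL (Fin n) ℚ) = (intVec n).range := by
  rw [lat, act_one, AddSubgroup.map_id]

lemma lat_mul (x y : GL (Fin n) ℚ) : lat (x * y) = (lat x).map (act y) := by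
  rw [lat, lat, AddSubgroup.map_map, act_mul]

lemma map_act_injective (x : GL (Fin n) ℚ) :
    Function.Injective (AddSubgroup.map (act x)) :=
  AddSubgroup.map_injective (act_injective x)

lemma intVec_vecMul (w : Fin n → ℤ) (C : Matrix (Fin n) (Fin n) ℤ) :
    intVec n w ᵥ* C.map (Int.castRingHom ℚ) = intVec n (w ᵥ* C) := by
  ext j
  simp [Matrix.vecMul, dotProduct, intVec_apply]

/-- The rows of x are the images of the unit vectors, so the inclusion says that they are integral.
-/
lemma lat_le_one_iff {x : GL (Fin n) ℚ} : lat x ≤ lat 1 ↔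
    ∃ C : Matrix (Fin n) (Fin n) ℤ,
      (x : Matrix (Fin n) (Fin n) ℚ) = C.map (Int.castRingHom ℚ) := by
  constructor
  · intro h
    have h1 (i : Fin n) : ∃ w : Fin n → ℤ, intVec n w = (x : Matrix (Fin n) (Fin n) ℚ) i := by
      have : act x (intVec n (Pi.single i 1)) ∈ lat 1 := h (mem_lat.2 ⟨_, rfl⟩)
      rw [lat_one] at this
      obtain ⟨w, hw⟩ := this
      refine ⟨w, hw.trans ?_⟩
      have e : intVec n (Pi.single i 1) = Pi.single i 1 := by
        ext j
        rw [intVec_apply]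
        by_cases hij : j = i
        · subst hij; simp
        · simp [hij]
      rw [act_apply, e, Matrix.single_one_vecMul]
      rfl
    choose w hw using h1
    refine ⟨Matrix.of w, ?_⟩
    ext i j
    rw [← hw i]
    rfl
  · rintro ⟨C, hC⟩ _ hv
    obtain ⟨w, rfl⟩ := mem_lat.1 hv
    rw [act_apply, hC, intVec_vecMul, lat_one]
    exact ⟨_, rfl⟩

/-- Equality means that both x and x⁻¹ are integral. -/
lemma lat_eq_one_iff {x : GL (Fin n) ℚ} : lat x = lat 1 ↔ x ∈ Lam n := by
  constructor
  · intro h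
    obtain ⟨C, hC⟩ := lat_le_one_iff.1 h.le
    have h' : lat x⁻¹ = lat 1 := by
      apply map_act_injective x
      rw [← lat_mul, ← lat_mul, inv_mul_cancel, one_mul, h]
    obtain ⟨C', hC'⟩ := lat_le_one_iff.1 h'.le
    have hinj : Function.Injective
        (fun M : Matrix (Fin n) (Fin n) ℤ => M.map (Int.castRingHom ℚ)) :=
      Matrix.map_injective (RingHom.injective_int (Int.castRingHom ℚ))
    have h1 : C * C' = 1 := by
      apply hinj
      simp only
      rw [Matrix.map_mul, ← hC, ← hC', ← Units.val_mul]
      simp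
    have h2 : C' * C = 1 := by
      apply hinj
      simp only
      rw [Matrix.map_mul, ← hC, ← hC', ← Units.val_mul]
      simp
    exact ⟨⟨C, C', h1, h2⟩, Units.ext hC.symm⟩
  · intro h
    have key (y : GL (Fin n) ℚ) (hy : y ∈ Lam n) : lat y ≤ lat 1 := by
      obtain ⟨γ, rfl⟩ := hy
      exact lat_le_one_iff.2 ⟨γ, rfl⟩
    refine le_antisymm (key x h) ?_
    have := AddSubgroup.map_mono (f := act x) (key x⁻¹ ((Lam n).inv_mem h))
    rwa [← lat_mul, ← lat_mul, inv_mul_cancel, one_mul] at this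

/-- This dictionary turns counts of right cosets into counts of lattices. -/
lemma lat_eq_iff {x y : GL (Fin n) ℚ} : lat x = lat y ↔ rightCoset x = rightCoset y := by
  rw [rightCoset_eq_iff, ← lat_eq_one_iff, ← (map_act_injective x).eq_iff (a := lat (y * x⁻¹)), ← lat_mul, ← lat_mul,
    inv_mul_cancel_right, one_mul, eq_comm]

/-- The left factor from Λ_n is absorbed by the lattice; only the right factor, an automorphism of
ℤ^n, moves it. -/
lemma mem_doubleCoset_iff {g x : GL (Fin n) ℚ} :
    x ∈ doubleCoset g ↔ ∃ u ∈ Lam n, lat x = lat (g * u) := by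
  constructor
  · intro h
    obtain ⟨a, ha, b, hb, rfl⟩ := DoubleCoset.mem_doubleCoset.1 h
    refine ⟨b, hb, ?_⟩
    rw [mul_assoc, lat_mul, lat_eq_one_iff.2 ha, ← lat_mul, one_mul]
  · rintro ⟨u, hu, h⟩
    rw [lat_eq_iff, eq_comm, rightCoset_eq_iff] at h
    refine DoubleCoset.mem_doubleCoset.2 ⟨_, h, u, hu, ?_⟩
    group

lemma dist_map_act {q : ℕ} {L N : AddSubgroup (Fin n → ℚ)} (x : GL (Fin n) ℚ) :
    Dist q (L.map (act x)) (N.map (act x)) ↔ Dist q L N := by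
  rw [Dist, Dist, AddSubgroup.relIndex_map_map_of_injective _ _ (act_injective x),
    AddSubgroup.relIndex_map_map_of_injective _ _ (act_injective x)]

lemma smulLE_map_act {p : ℕ} {L N : AddSubgroup (Fin n → ℚ)} (x : GL (Fin n) ℚ) :
    SmulLE p (L.map (act x)) (N.map (act x)) ↔ SmulLE p L N := by
  constructor
  · intro h v hv
    obtain ⟨w, hw, he⟩ := h (act x v) ⟨v, hv, rfl⟩
    rw [← map_nsmul] at he
    rwa [← act_injective x he]
  · rintro h _ ⟨v, hv, rfl⟩
    exact ⟨p • v, h v hv, map_nsmul _ _ _⟩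

/-! ### Diagonal lattices -/

variable {p : ℕ} [NeZero p]

lemma diagPow_mul (e f : Fin n → ℕ) : diagPow p e * diagPow p f = diagPow p (e + f) := by
  apply Units.ext
  change Matrix.diagonal _ * Matrix.diagonal _ = Matrix.diagonal _
  rw [Matrix.diagonal_mul_diagonal]
  simp only [Pi.add_apply, pow_add]

/-- The scalar matrix `p ^ k`. -/
def scal (n p : ℕ) [NeZero p] (k : ℕ) : GL (Fin n) ℚ := diagPow p fun _ => k

lemma scal_mul_comm (k : ℕ) (x : GL (Fin n) ℚ) : scal n p k * x = x * scal n p k := by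
  apply Units.ext
  change Matrix.diagonal _ * _ = _ * Matrix.diagonal _
  ext i j
  rw [Matrix.diagonal_mul, Matrix.mul_diagonal, mul_comm]

lemma scal_zero : scal n p 0 = 1 := by
  apply Units.ext
  change Matrix.diagonal _ = 1
  simp

lemma lat_scal_mul {u : GL (Fin n) ℚ} (hu : u ∈ Lam n) (k : ℕ) :
    lat (scal n p k * u) = lat (scal n p k) := by
  rw [scal_mul_comm, lat_mul, lat_eq_one_iff.2 hu, ← lat_mul, one_mul]

lemma mem_lat_diagPow {e : Fin n → ℕ} {v : Fin n → ℚ} :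
    v ∈ lat (diagPow p e) ↔ ∀ i, ∃ z : ℤ, (z : ℚ) * (p : ℚ) ^ e i = v i := by
  rw [mem_lat, Classical.skolem]
  refine exists_congr fun w => ?_
  rw [funext_iff]
  refine forall_congr' fun i => ?_
  rw [act_apply]
  change (intVec n w ᵥ* Matrix.diagonal _) i = _ ↔ _
  rw [Matrix.vecMul_diagonal, intVec_apply]

/-- In the coordinates of the first lattice, the second becomes the product of the groups p^(f i - e
i) ℤ. Truncated subtraction is right here: `relIndex` only sees the intersection, so a coordinate
with f i ≤ e i contributes nothing. -/
lemma relIndex_diagPow (e f : Fin n → ℕ) :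
    (lat (diagPow p f)).relIndex (lat (diagPow p e)) = p ^ ∑ i, (f i - e i) := by
  have hp0 : (p : ℚ) ≠ 0 := Nat.cast_ne_zero.2 (NeZero.ne p)
  have h1 : lat (diagPow p e) = ((act (diagPow p e)).comp (intVec n)).range := by
    rw [lat, AddMonoidHom.map_range]
  have h2 : (lat (diagPow p f)).comap ((act (diagPow p e)).comp (intVec n)) =
      AddSubgroup.pi Set.univ fun i => AddSubgroup.zmultiples ((p : ℤ) ^ (f i - e i)) := by
    ext w
    rw [AddSubgroup.mem_comap, mem_lat_diagPow, AddSubgroup.mem_pi]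
    refine forall_congr' fun i => ?_
    rw [AddMonoidHom.comp_apply, act_apply]
    change (∃ z : ℤ, _ = (intVec n w ᵥ* Matrix.diagonal _) i) ↔ _
    rw [Matrix.vecMul_diagonal, intVec_apply]
    simp only [Set.mem_univ, true_imp_iff, Int.mem_zmultiples_iff]
    rcases le_total (f i) (e i) with h | h
    · rw [Nat.sub_eq_zero_of_le h, pow_zero]
      refine ⟨fun _ => one_dvd _, fun _ => ⟨w i * p ^ (e i - f i), ?_⟩⟩
      push_cast
      rw [mul_assoc, ← pow_add, Nat.sub_add_cancel h]
    · obtain ⟨d, hd⟩ := Nat.exists_eq_add_of_le h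
      rw [hd, Nat.add_sub_cancel_left]
      constructor
      · rintro ⟨z, hz⟩
        refine ⟨z, ?_⟩
        rw [pow_add, mul_comm (_ ^ _), ← mul_assoc] at hz
        have := mul_right_cancel₀ (pow_ne_zero _ hp0) hz
        rw [mul_comm]
        exact_mod_cast this.symm
      · rintro ⟨z, hz⟩
        refine ⟨z, ?_⟩
        rw [hz]
        push_cast
        ring
  rw [h1, ← AddSubgroup.index_comap, h2, AddSubgroup.index_pi, ← Finset.prod_pow_eq_pow_sum]
  refine Finset.prod_congr rfl fun i _ => ?_
  rw [Int.index_zmultiples]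
  simp [Int.natAbs_pow]

end Lattice
end HeckeGL

namespace HeckeGL

set_option linter.unusedSectionVars false

open Matrix

/-! ### Relative positions of lattices and elementary divisors. -/

section Types

variable {n p : ℕ} [hp : Fact p.Prime]

lemma lat_diagPow_le_iff {e f : Fin n → ℕ} :
    lat (diagPow p e) ≤ lat (diagPow p f) ↔ f ≤ e := by
  rw [← AddSubgroup.relIndex_eq_one, relIndex_diagPow, Nat.pow_eq_one, Finset.sum_eq_zero_iff]
  simp only [hp.out.ne_one, false_or, Finset.mem_univ, true_imp_iff, Nat.sub_eq_zero_iff_le]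
  rfl

lemma lat_map_nsmul (x : GL (Fin n) ℚ) :
    (lat x).map (nsmulAddMonoidHom p) = lat (scal n p 1 * x) := by
  have h : act (scal n p 1) = nsmulAddMonoidHom p := by
    refine AddMonoidHom.ext fun v => ?_
    change v ᵥ* Matrix.diagonal _ = p • v
    ext i
    rw [Matrix.vecMul_diagonal, pow_one, Pi.smul_apply, nsmul_eq_mul, mul_comm]
  rw [scal_mul_comm, lat_mul, h]

lemma smulLE_iff_le {L A : AddSubgroup (Fin n → ℚ)} :
    SmulLE p L A ↔ L.map (nsmulAddMonoidHom p) ≤ A := map_nsmul_le_iff.symm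

lemma smulLE_diagPow_iff {e f : Fin n → ℕ} :
    SmulLE p (lat (diagPow p e)) (lat (diagPow p f)) ↔ ∀ i, f i ≤ e i + 1 := by
  rw [smulLE_iff_le, lat_map_nsmul, scal, diagPow_mul, lat_diagPow_le_iff, Pi.le_def]
  simp only [Pi.add_apply, add_comm 1]

lemma dist_diagPow_iff {e f : Fin n → ℕ} {s : ℕ} :
    Dist (p ^ s) (lat (diagPow p e)) (lat (diagPow p f)) ↔
      ∑ i, (f i - e i) = s ∧ ∑ i, (e i - f i) = s := by
  rw [Dist, relIndex_diagPow, relIndex_diagPow, (Nat.pow_right_injective hp.out.two_le).eq_iff,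
    (Nat.pow_right_injective hp.out.two_le).eq_iff]

lemma hasRank_lat (x : GL (Fin n) ℚ) : HasRank p n (lat x) := by
  have h : lat x = (lat 1).map (act x) := by rw [← lat_mul, one_mul]
  have h' : lat (scal n p 1 * x) = (lat (scal n p 1)).map (act x) := by rw [← lat_mul]
  rw [HasRank, lat_map_nsmul, h, h',
    AddSubgroup.relIndex_map_map_of_injective _ _ (act_injective x), ← scal_zero (p := p), scal,
    scal, relIndex_diagPow]
  simp

/-- The elementary divisor theorem for lattices between `p ^ k ℤ^n` and `ℤ^n`. -/
lemma exists_eq_lat_diagPow {k : ℕ} {N : AddSubgroup (Fin n → ℚ)} (h1 : lat (scal n p k) ≤ N)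
    (h2 : N ≤ lat 1) : ∃ e : Fin n → ℕ, (∀ i, e i ≤ k) ∧ ∃ u ∈ Lam n, N = lat (diagPow p e * u) := by
  have hp0 : (p : ℚ) ≠ 0 := Nat.cast_ne_zero.2 hp.out.ne_zero
  set N' : Submodule ℤ (Fin n → ℤ) := AddSubgroup.toIntSubmodule (N.comap (intVec n))
  have hmem (w : Fin n → ℤ) : w ∈ N' ↔ intVec n w ∈ N := Iff.rfl
  have hpk (w : Fin n → ℤ) : (p : ℤ) ^ k • w ∈ N' := by
    rw [hmem]
    apply h1
    rw [scal, mem_lat_diagPow]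
    intro i
    refine ⟨w i, ?_⟩
    rw [intVec_apply, Pi.smul_apply, smul_eq_mul]
    push_cast
    ring
  have hpz : (p : ℤ) ^ k ≠ 0 := pow_ne_zero _ (Nat.cast_ne_zero.2 hp.out.ne_zero)
  -- N' contains p^k ℤ^n, so it has full rank and the Smith normal form has n elementary divisors.
  have hrank : Module.finrank ℤ N' = Module.finrank ℤ (Fin n → ℤ) := by
    refine le_antisymm (Submodule.finrank_le N') ?_
    refine LinearMap.finrank_le_finrank_of_injective
      (f := ((p : ℤ) ^ k • (LinearMap.id : (Fin n → ℤ) →ₗ[ℤ] _)).codRestrict N' hpk) ?_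
    intro v w h
    have h : (p : ℤ) ^ k • v = (p : ℤ) ^ k • w := congrArg Subtype.val h
    exact smul_right_injective _ hpz h
  obtain ⟨b, a, c, hc⟩ := Submodule.exists_smith_normal_form_of_rank_eq (Pi.basisFun ℤ (Fin n)) hrank
  have hmemN (w : Fin n → ℤ) : w ∈ N' ↔ ∃ z : Fin n → ℤ, w = ∑ i, (z i * a i) • b i := by
    constructor
    · intro hw
      refine ⟨c.repr ⟨w, hw⟩, ?_⟩
      have := congrArg Subtype.val (c.sum_repr ⟨w, hw⟩)
      refine this.symm.trans ?_
      rw [AddSubmonoidClass.coe_finsetSum]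
      refine Finset.sum_congr rfl fun i _ => ?_
      rw [Submodule.coe_smul, hc, mul_smul]
    · rintro ⟨z, rfl⟩
      refine Submodule.sum_mem _ fun i _ => ?_
      rw [mul_smul, ← hc]
      exact Submodule.smul_mem _ _ (c i).2
  -- Since p^k b i lies in N', the elementary divisor a i divides p^k and is a power of p up to
  -- sign.
  have hdvd (i : Fin n) : a i ∣ (p : ℤ) ^ k := by
    obtain ⟨z, hz⟩ := (hmemN _).1 (hpk (b i))
    have h1 := congrArg (fun w => b.repr w i) hz
    simp only [map_smul, map_sum, Module.Basis.repr_self, Finsupp.smul_apply,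
      Finsupp.finsetSum_apply, Finsupp.single_apply, smul_eq_mul, mul_ite, mul_one, mul_zero,
      Finset.sum_ite_eq', Finset.mem_univ, if_true] at h1
    exact ⟨z i, by rw [h1, mul_comm]⟩
  have hex (i : Fin n) : ∃ e ≤ k, Associated (a i) ((p : ℤ) ^ e) :=
    (dvd_prime_pow (Nat.prime_iff_prime_int.1 hp.out) k).1 (hdvd i)
  choose e he hae using hex
  refine ⟨e, he, ?_⟩
  -- The rows of B are the adapted basis; `toMatrix` writes basis vectors as columns, hence the
  -- transpose.
  set B : Matrix (Fin n) (Fin n) ℤ := ((Pi.basisFun ℤ (Fin n)).toMatrix b)ᵀ with hB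
  set B' : Matrix (Fin n) (Fin n) ℤ := (b.toMatrix (Pi.basisFun ℤ (Fin n)))ᵀ
  have hBB : B * B' = 1 := by
    rw [← Matrix.transpose_mul, Module.Basis.toMatrix_mul_toMatrix_flip, Matrix.transpose_one]
  have hBB' : B' * B = 1 := by
    rw [← Matrix.transpose_mul, Module.Basis.toMatrix_mul_toMatrix_flip, Matrix.transpose_one]
  have hBapp (i j) : B i j = b i j := by
    simp [hB, Module.Basis.toMatrix_apply]
  refine ⟨Matrix.GeneralLinearGroup.map (Int.castRingHom ℚ) ⟨B, B', hBB, hBB'⟩, ⟨_, rfl⟩, ?_⟩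
  have hlat (w : Fin n → ℤ) : act (diagPow p e * Matrix.GeneralLinearGroup.map (Int.castRingHom ℚ)
      ⟨B, B', hBB, hBB'⟩) (intVec n w) = intVec n (∑ i, (w i * (p : ℤ) ^ e i) • b i) := by
    rw [act_mul, AddMonoidHom.comp_apply]
    have e1 : act (diagPow p e) (intVec n w) = intVec n fun i => w i * (p : ℤ) ^ e i := by
      change intVec n w ᵥ* Matrix.diagonal _ = _
      ext i
      rw [Matrix.vecMul_diagonal, intVec_apply, intVec_apply]
      push_cast
      rfl
    rw [e1, act_apply]
    change _ ᵥ* B.map (Int.castRingHom ℚ) = _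
    rw [intVec_vecMul]
    congr 1
    ext j
    simp [Matrix.vecMul, dotProduct, hBapp, Finset.sum_apply]
  ext v
  rw [mem_lat]
  simp only [hlat]
  constructor
  · intro hv
    have := h2 hv
    rw [lat_one] at this
    obtain ⟨w, rfl⟩ := this
    obtain ⟨z, hz⟩ := (hmemN w).1 hv
    -- The signs between a i and p ^ e i are moved into the coefficients.
    choose t ht using fun i => (hae i).symm
    refine ⟨fun i => z i * t i, ?_⟩
    rw [hz]
    congr 1
    refine Finset.sum_congr rfl fun i _ => ?_
    rw [← ht i]
    congr 1
    ring
  · rintro ⟨w, rfl⟩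
    rw [← hmem, hmemN]
    choose t ht using fun i => hae i
    refine ⟨fun i => w i * t i, Finset.sum_congr rfl fun i _ => ?_⟩
    rw [← ht i]
    congr 1
    ring

/-- Permutation matrices lie in Λ_n, so only the multiset of exponents matters. -/
lemma diagPow_comp_perm (e : Fin n → ℕ) (σ : Equiv.Perm (Fin n)) :
    doubleCoset (diagPow p (e ∘ σ)) = doubleCoset (diagPow p e) := by
  have hmul (τ : Equiv.Perm (Fin n)) : τ.permMatrix ℤ * τ⁻¹.permMatrix ℤ = 1 := by
    rw [← Matrix.permMatrix_mul]
    simp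
  have h1 := hmul σ
  have h2 := hmul σ⁻¹
  rw [inv_inv] at h2
  set P : GL (Fin n) ℤ := ⟨σ.permMatrix ℤ, σ⁻¹.permMatrix ℤ, h1, h2⟩
  set P' := Matrix.GeneralLinearGroup.map (Int.castRingHom ℚ) P
  have hP : P' ∈ Lam n := ⟨P, rfl⟩
  refine doubleCoset_eq_of_rel (a := P') (b := P'⁻¹) hP ((Lam n).inv_mem hP) ?_
  rw [eq_mul_inv_iff_mul_eq]
  apply Units.ext
  change Matrix.diagonal _ * (σ.permMatrix ℤ).map _ = (σ.permMatrix ℤ).map _ * Matrix.diagonal _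
  ext i j
  rw [Matrix.diagonal_mul, Matrix.mul_diagonal, Matrix.map_apply]
  simp only [Equiv.Perm.permMatrix, PEquiv.toMatrix_apply, Equiv.toPEquiv_apply, Option.mem_some_iff,
    Function.comp_apply]
  split_ifs with h
  · rw [← h, mul_comm]
  · simp

/-- Let c_v be the multiplicity of the value v. The data are c_3 + 2c_4 ≤ 2, c_1 + 2c_0 ≤ 2, the
total n, and whether c_4 and c_0 vanish. The bounds leave only 0 and 1 for c_4 and c_0, so all
multiplicities are determined. -/
lemma exists_perm_of_sums {e e' : Fin n → ℕ} (he : ∀ i, e i ≤ 4) (he' : ∀ i, e' i ≤ 4)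
    (h1 : ∑ i, (e i - 2) = ∑ i, (e' i - 2)) (h2 : ∑ i, (2 - e i) = ∑ i, (2 - e' i))
    (hs1 : ∑ i, (e' i - 2) ≤ 2) (hs2 : ∑ i, (2 - e' i) ≤ 2)
    (h3 : (∀ i, e i ≤ 3) ↔ ∀ i, e' i ≤ 3) (h4 : (∀ i, 1 ≤ e i) ↔ ∀ i, 1 ≤ e' i) :
    ∃ σ : Equiv.Perm (Fin n), e = e' ∘ σ := by
  have hsum (e : Fin n → ℕ) (he : ∀ i, e i ≤ 4) (f : ℕ → ℕ) :
      ∑ i, f (e i) = ∑ v ∈ Finset.range 5, (Finset.univ.filter fun i => e i = v).card * f v := by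
    rw [← Finset.sum_fiberwise_of_maps_to (s := Finset.univ) (t := Finset.range 5) (g := e)
      (fun i _ => Finset.mem_range.2 (Nat.lt_succ_of_le (he i)))]
    refine Finset.sum_congr rfl fun v _ => ?_
    rw [Finset.card_eq_sum_ones, Finset.sum_mul]
    refine Finset.sum_congr rfl fun i hi => ?_
    rw [(Finset.mem_filter.1 hi).2, one_mul]
  have hc4 (e : Fin n → ℕ) (he : ∀ i, e i ≤ 4) :
      (∀ i, e i ≤ 3) ↔ (Finset.univ.filter fun i => e i = 4).card = 0 := by
    rw [Finset.card_eq_zero, Finset.filter_eq_empty_iff]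
    refine forall_congr' fun i => ?_
    have := he i
    simp only [Finset.mem_univ, true_imp_iff]
    omega
  have hc0 (e : Fin n → ℕ) : (∀ i, 1 ≤ e i) ↔ (Finset.univ.filter fun i => e i = 0).card = 0 := by
    rw [Finset.card_eq_zero, Finset.filter_eq_empty_iff]
    refine forall_congr' fun i => ?_
    simp only [Finset.mem_univ, true_imp_iff]
    omega
  have hcard : ∀ v, (Finset.univ.filter fun i => e i = v).card =
      (Finset.univ.filter fun i => e' i = v).card := by
    have k1 := hsum e he (fun v => v - 2)
    have k1' := hsum e' he' (fun v => v - 2)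
    have k2 := hsum e he (fun v => 2 - v)
    have k2' := hsum e' he' (fun v => 2 - v)
    have k3 := hsum e he (fun v => 1)
    have k3' := hsum e' he' (fun v => 1)
    rw [hc4 e he, hc4 e' he'] at h3
    rw [hc0 e, hc0 e'] at h4
    simp only [Finset.sum_range_succ, Finset.sum_range_zero] at k1 k1' k2 k2' k3 k3'
    intro v
    rcases lt_or_ge 4 v with h | h
    · rw [Finset.filter_false_of_mem, Finset.filter_false_of_mem]
      · intro i _ hi
        have := he' i
        omega
      · intro i _ hi
        have := he i
        omega
    · interval_cases v <;> omega
  have hequiv (v : ℕ) : Nonempty ({i // e i = v} ≃ {i // e' i = v}) := by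
    rw [← Fintype.card_eq, Fintype.card_subtype, Fintype.card_subtype, hcard]
  refine ⟨Equiv.ofFiberEquiv (f := e) (g := e') fun v => (hequiv v).some, ?_⟩
  ext i
  exact (Equiv.ofFiberEquiv_map _ i).symm

/-- With L = p²ℤ^n, a lattice M at distance at most p² satisfies p²L ≤ M and p²M ≤ L, so it lies
between p⁴ℤ^n and ℤ^n. This is why p²ℤ^n is the reference lattice and why exponents run up to 4. -/
lemma exists_eq_lat_of_dist {s : ℕ} (hs : s ≤ 2) {M : AddSubgroup (Fin n → ℚ)}
    (h : Dist (p ^ s) (lat (scal n p 2)) M) :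
    ∃ e : Fin n → ℕ, (∀ i, e i ≤ 4) ∧ ∃ u ∈ Lam n, M = lat (diagPow p e * u) := by
  have hp0 : (p : ℚ) ≠ 0 := Nat.cast_ne_zero.2 hp.out.ne_zero
  have hsq {A L : AddSubgroup (Fin n → ℚ)} (hi : A.relIndex L = p ^ s) : SmulLE (p ^ 2) L A := by
    intro v hv
    have := A.nsmul_mem (smulLE_of_relIndex hi v hv) (p ^ (2 - s))
    rwa [smul_smul, ← pow_add, Nat.sub_add_cancel hs] at this
  have h1 := hsq h.1
  have h2 := hsq h.2
  refine exists_eq_lat_diagPow ?_ ?_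
  · intro v hv
    rw [scal, mem_lat_diagPow] at hv
    choose z hz using hv
    have : p ^ 2 • (fun i => (z i : ℚ) * (p : ℚ) ^ 2) ∈ M := by
      apply h1
      rw [scal, mem_lat_diagPow]
      exact fun i => ⟨z i, rfl⟩
    convert this using 1
    ext i
    rw [← hz i, Pi.smul_apply, nsmul_eq_mul]
    push_cast
    ring
  · intro v hv
    have := h2 v hv
    rw [scal, mem_lat_diagPow] at this
    rw [← scal_zero (p := p), scal, mem_lat_diagPow]
    intro i
    obtain ⟨z, hz⟩ := this i
    refine ⟨z, ?_⟩
    rw [Pi.smul_apply, nsmul_eq_mul, mul_comm] at hz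
    push_cast at hz
    rw [pow_zero, mul_one]
    exact mul_left_cancel₀ (pow_ne_zero 2 hp0) hz

/-- The double coset of a diagonal matrix in terms of the relative position of the lattices. -/
lemma mem_doubleCoset_diagPow_iff {e : Fin n → ℕ} {s : ℕ} (he : ∀ i, e i ≤ 4) (hs : s ≤ 2)
    (h1 : ∑ i, (e i - 2) = s) (h2 : ∑ i, (2 - e i) = s) {x : GL (Fin n) ℚ} :
    x ∈ doubleCoset (diagPow p e) ↔ Dist (p ^ s) (lat (scal n p 2)) (lat x) ∧
      (SmulLE p (lat (scal n p 2)) (lat x) ↔ ∀ i, e i ≤ 3) ∧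
      (SmulLE p (lat x) (lat (scal n p 2)) ↔ ∀ i, 1 ≤ e i) := by
  -- The factor u preserves p²ℤ^n, so it can be removed from both lattices and only diagonal
  -- lattices are compared.
  have key (f : Fin n → ℕ) (u) (hu : u ∈ Lam n) (hx : lat x = lat (diagPow p f * u)) :
      (Dist (p ^ s) (lat (scal n p 2)) (lat x) ↔
        ∑ i, (f i - 2) = s ∧ ∑ i, (2 - f i) = s) ∧
      (SmulLE p (lat (scal n p 2)) (lat x) ↔ ∀ i, f i ≤ 3) ∧
      (SmulLE p (lat x) (lat (scal n p 2)) ↔ ∀ i, 1 ≤ f i) := by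
    rw [hx, ← lat_scal_mul hu 2, lat_mul, lat_mul, dist_map_act, smulLE_map_act, smulLE_map_act,
      scal, dist_diagPow_iff, smulLE_diagPow_iff, smulLE_diagPow_iff]
    simp
  constructor
  · intro h
    obtain ⟨u, hu, hx⟩ := mem_doubleCoset_iff.1 h
    obtain ⟨k1, k2, k3⟩ := key e u hu hx
    exact ⟨k1.2 ⟨h1, h2⟩, k2, k3⟩
  · rintro ⟨hd, h3, h4⟩
    obtain ⟨f, hf, u, hu, hx⟩ := exists_eq_lat_of_dist hs hd
    obtain ⟨k1, k2, k3⟩ := key f u hu hx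
    obtain ⟨h5, h6⟩ := k1.1 hd
    obtain ⟨σ, rfl⟩ := exists_perm_of_sums hf he (h5.trans h1.symm) (h6.trans h2.symm)
      (h1.trans_le hs) (h2.trans_le hs) (k2.symm.trans h3) (k3.symm.trans h4)
    rw [← diagPow_comp_perm e σ]
    exact mem_doubleCoset_iff.2 ⟨u, hu, hx⟩

end Types
end HeckeGL

namespace HeckeGL

set_option linter.unusedSectionVars false

open Matrix

/-! ### Exponent vectors with three constant blocks. -/

section Blocks

lemma sum_blocks {n r s : ℕ} (h : r + s ≤ n) (a b c : ℕ) (f : ℕ → ℕ) :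
    ∑ i, f (blocks n r a b c s i) = r * f a + (n - r - s) * f b + s * f c := by
  obtain ⟨t, rfl⟩ := Nat.exists_eq_add_of_le h
  have e : r + s + t - r - s = t := by omega
  have e' : r + s + t = r + t + s := by omega
  have h1 : ∑ i, f (blocks (r + s + t) r a b c s i) =
      ∑ i ∈ Finset.range (r + t + s), f (if i < r then a else if i < r + t then b else c) := by
    rw [← e', ← Fin.sum_univ_eq_sum_range]
    refine Finset.sum_congr rfl fun i _ => ?_
    rw [blocks, show r + s + t - s = r + t by omega]
  rw [h1, e, Finset.sum_range_add, Finset.sum_range_add]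
  congr 1
  · congr 1
    · rw [Finset.sum_congr rfl (g := fun _ => f a)]
      · simp
      · intro i hi
        rw [if_pos (Finset.mem_range.1 hi)]
    · rw [Finset.sum_congr rfl (g := fun _ => f b)]
      · simp
      · intro i hi
        have := Finset.mem_range.1 hi
        rw [if_neg (by omega), if_pos (by omega)]
  · rw [Finset.sum_congr rfl (g := fun _ => f c)]
    · simp
    · intro i hi
      rw [if_neg (by omega), if_neg (by omega)]

/-- The outer blocks are nonempty, so a and c do occur; the middle block may be empty, as for n = 4
and r = s = 2, so P b is assumed. -/
lemma forall_blocks {n r s : ℕ} (h : r + s ≤ n) (hr : 0 < r) (hs : 0 < s) (a b c : ℕ)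
    {P : ℕ → Prop} (hb : P b) : (∀ i, P (blocks n r a b c s i)) ↔ P a ∧ P c := by
  constructor
  · intro hP
    refine ⟨?_, ?_⟩
    · have := hP ⟨0, by omega⟩
      rwa [blocks, if_pos hr] at this
    · have := hP ⟨n - 1, by omega⟩
      rwa [blocks, if_neg (by simp only; omega), if_neg (by simp only; omega)] at this
  · rintro ⟨ha, hc⟩ i
    rw [blocks]
    split_ifs
    exacts [ha, hb, hc]

end Blocks

/-! ### Degrees and structure constants as numbers of lattices. -/

section Degrees

variable {n p : ℕ} [hp : Fact p.Prime]

/-- Scaling by p^k is harmless for counting. With k = 1 it brings the double coset of diag(1, p, …,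
p, p²) to the reference lattice p²ℤ^n. -/
lemma ncard_rightCoset_image (S : Set (GL (Fin n) ℚ)) (k : ℕ) :
    (rightCoset '' S).ncard = ((fun x => lat (scal n p k * x)) '' S).ncard := by
  have hwd (x y : GL (Fin n) ℚ) : lat (scal n p k * x) = lat (scal n p k * y) ↔
      rightCoset x = rightCoset y := by
    rw [scal_mul_comm, scal_mul_comm, lat_mul, lat_mul, (map_act_injective _).eq_iff, lat_eq_iff]
  let F : RightCoset n → AddSubgroup (Fin n → ℚ) := fun q => lat (scal n p k * q.out)
  have hF (x) : F (rightCoset x) = lat (scal n p k * x) := (hwd _ _).2 (Quotient.out_eq _)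
  have hinj : Function.Injective F := by
    intro q q' h
    rw [← Quotient.out_eq q, ← Quotient.out_eq q']
    exact (hwd _ _).1 h
  rw [← Set.ncard_image_of_injective _ hinj, Set.image_image]
  simp only [hF]

lemma degree_eq_ncard_lat (p : ℕ) [Fact p.Prime] (g : GL (Fin n) ℚ) :
    degree g = (lat '' doubleCoset g).ncard := by
  rw [degree, cosetsIn, ncard_rightCoset_image (p := p) _ 0, scal_zero]
  simp only [one_mul]

/-- The standard relative positions of a lattice to `p ^ 2 ℤ^n`. -/
lemma degree_diagPow {e : Fin n → ℕ} {s : ℕ} (he : ∀ i, e i ≤ 4) (hs : s ≤ 2)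
    (h1 : ∑ i, (e i - 2) = s) (h2 : ∑ i, (2 - e i) = s) :
    degree (diagPow p e) = {N | Dist (p ^ s) (lat (scal n p 2)) N ∧
      (SmulLE p (lat (scal n p 2)) N ↔ ∀ i, e i ≤ 3) ∧
      (SmulLE p N (lat (scal n p 2)) ↔ ∀ i, 1 ≤ e i)}.ncard := by
  rw [degree_eq_ncard_lat p]
  congr 1
  ext N
  constructor
  · rintro ⟨x, hx, rfl⟩
    exact (mem_doubleCoset_diagPow_iff he hs h1 h2).1 hx
  · intro h
    obtain ⟨f, _, u, _, rfl⟩ := exists_eq_lat_of_dist hs h.1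
    exact ⟨_, (mem_doubleCoset_diagPow_iff he hs h1 h2).2 h, rfl⟩

lemma smulLE_of_dist {L N : AddSubgroup (Fin n → ℚ)} (h : Dist p L N) :
    SmulLE p L N ∧ SmulLE p N L :=
  ⟨smulLE_of_relIndex h.1, smulLE_of_relIndex h.2⟩

lemma blocks_conditions {r a c s t : ℕ} (hrs : r + s ≤ n) (hr : 0 < r) (hs : 0 < s)
    (ha : a ≤ 1) (hc : 3 ≤ c) (hc' : c ≤ 4) (h1 : s * (c - 2) = t) (h2 : r * (2 - a) = t) :
    (∀ i, blocks n r a 2 c s i ≤ 4) ∧ ∑ i, (blocks n r a 2 c s i - 2) = t ∧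
      ∑ i, (2 - blocks n r a 2 c s i) = t ∧ ((∀ i, blocks n r a 2 c s i ≤ 3) ↔ c = 3) ∧
      ((∀ i, 1 ≤ blocks n r a 2 c s i) ↔ a = 1) := by
  refine ⟨?_, ?_, ?_, ?_, ?_⟩
  · rw [forall_blocks hrs hr hs (P := (· ≤ 4)) _ _ _ (by omega)]
    omega
  · rw [sum_blocks hrs (f := (· - 2)), ← h1]
    simp [Nat.sub_eq_zero_of_le (show a ≤ 2 by omega)]
  · rw [sum_blocks hrs (f := (2 - ·)), ← h2]
    simp [Nat.sub_eq_zero_of_le (show 2 ≤ c by omega)]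
  · rw [forall_blocks hrs hr hs (P := (· ≤ 3)) _ _ _ (by omega)]
    omega
  · rw [forall_blocks hrs hr hs (P := (1 ≤ ·)) _ _ _ (by omega)]
    omega

/-- At distance p both quotients have order p, so the two `SmulLE` conditions hold automatically. -/
lemma mem_doubleCoset_three (hn : 4 ≤ n) {x : GL (Fin n) ℚ} :
    x ∈ doubleCoset (diagPow p (blocks n 1 1 2 3 1)) ↔ Dist p (lat (scal n p 2)) (lat x) := by
  obtain ⟨h1, h2, h3, h4, h5⟩ := blocks_conditions (n := n) (r := 1) (a := 1) (c := 3) (s := 1)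
    (t := 1) (by omega) (by omega) (by omega) (by omega) (by omega) (by omega) rfl rfl
  rw [mem_doubleCoset_diagPow_iff h1 (by omega) h2 h3, pow_one, h4, h5]
  constructor
  · exact fun h => h.1
  · intro h
    have := smulLE_of_dist h
    exact ⟨h, by simp [this.1], by simp [this.2]⟩

lemma mem_doubleCoset_base (hn : 4 ≤ n) {x : GL (Fin n) ℚ} :
    x ∈ doubleCoset (diagPow p (blocks n 1 0 1 2 1)) ↔
      Dist p (lat (scal n p 2)) (lat (scal n p 1 * x)) := by
  rw [← mem_doubleCoset_three hn]
  have e : diagPow p (blocks n 1 1 2 3 1) = scal n p 1 * diagPow p (blocks n 1 0 1 2 1) := by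
    rw [scal, diagPow_mul]
    congr 1
    ext i
    simp only [blocks, Pi.add_apply]
    split_ifs <;> rfl
  rw [e, mem_doubleCoset_iff, mem_doubleCoset_iff]
  refine exists_congr fun u => and_congr_right fun _ => ?_
  rw [mul_assoc, scal_mul_comm, scal_mul_comm, lat_mul x, lat_mul _ (scal n p 1),
    (map_act_injective _).eq_iff]

lemma degree_three (hn : 4 ≤ n) :
    degree (diagPow p (blocks n 1 1 2 3 1)) = {N | Dist p (lat (scal n p 2)) N}.ncard := by
  rw [degree_eq_ncard_lat p]
  congr 1
  ext N
  constructor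
  · rintro ⟨x, hx, rfl⟩
    exact (mem_doubleCoset_three hn).1 hx
  · intro h
    obtain ⟨f, _, u, _, rfl⟩ := exists_eq_lat_of_dist (s := 1) (by omega)
      (by rw [pow_one]; exact h)
    exact ⟨_, (mem_doubleCoset_three hn).2 h, rfl⟩

lemma exists_eq_lat_scal_mul {M : AddSubgroup (Fin n → ℚ)} (h : Dist p (lat (scal n p 2)) M) :
    ∃ y, M = lat (scal n p 1 * y) := by
  obtain ⟨f, _, u, _, rfl⟩ := exists_eq_lat_of_dist (s := 1) (by omega)
      (by rw [pow_one]; exact h)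
  exact ⟨(scal n p 1)⁻¹ * (diagPow p f * u), by rw [mul_inv_cancel_left]⟩

lemma degree_base (hn : 4 ≤ n) :
    degree (diagPow p (blocks n 1 0 1 2 1)) = {N | Dist p (lat (scal n p 2)) N}.ncard := by
  rw [degree, cosetsIn, ncard_rightCoset_image (p := p) _ 1]
  congr 1
  ext N
  constructor
  · rintro ⟨x, hx, rfl⟩
    exact (mem_doubleCoset_base hn).1 hx
  · intro h
    obtain ⟨y, rfl⟩ := exists_eq_lat_scal_mul h
    exact ⟨_, (mem_doubleCoset_base hn).2 h, rfl⟩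

/-- The structure constants count common neighbours of lattices. -/
lemma mult_base (hn : 4 ≤ n) (h : GL (Fin n) ℚ) :
    mult (diagPow p (blocks n 1 0 1 2 1)) (diagPow p (blocks n 1 0 1 2 1)) h =
      {M | Dist p (lat (scal n p 2)) M ∧ Dist p M (lat h)}.ncard := by
  have hout : ∀ q : RightCoset n, rightCoset q.out = q := Quotient.out_eq
  rw [mult, card_pairs _ _ _ Quotient.out Quotient.out hout hout,
    ncard_rightCoset_image (p := p) _ 1]
  -- Apply p⁻¹ y on the right to both lattices. The two factors carry one scaling by p each, which
  -- together give p²ℤ^n, so h itself needs no scaling.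
  have key (y : GL (Fin n) ℚ) : Dist p (lat (scal n p 2)) (lat (scal n p 1 * (h * y⁻¹))) ↔
      Dist p (lat (scal n p 1 * y)) (lat h) := by
    rw [← dist_map_act ((scal n p 1)⁻¹ * y), ← lat_mul, ← lat_mul]
    have e1 : scal n p 2 * ((scal n p 1)⁻¹ * y) = scal n p 1 * y := by
      have : (scal n p 2) = scal n p 1 * scal n p 1 := by
        rw [scal, scal, diagPow_mul]
        rfl
      rw [this]
      group
    have e2 : scal n p 1 * (h * y⁻¹) * ((scal n p 1)⁻¹ * y) = h := by
      rw [scal_mul_comm]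
      group
    rw [e1, e2]
  congr 1
  ext M
  constructor
  · rintro ⟨y, ⟨h1, h2⟩, rfl⟩
    exact ⟨(mem_doubleCoset_base hn).1 h1, (key y).1 ((mem_doubleCoset_base hn).1 h2)⟩
  · rintro ⟨h1, h2⟩
    obtain ⟨y, rfl⟩ := exists_eq_lat_scal_mul h1
    exact ⟨y, ⟨(mem_doubleCoset_base hn).2 h1, (mem_doubleCoset_base hn).2 ((key y).2 h2)⟩, rfl⟩

lemma T_apply (g h : GL (Fin n) ℚ) [Decidable (h ∈ doubleCoset g)] :
    (T g : HeckeAlgebra n) (HeckeCoset.mk (Lam n) (Lam n) ⟨h, trivial⟩) =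
      if h ∈ doubleCoset g then 1 else 0 := by
  classical
  change (Finsupp.single _ _ : DCoset n →₀ ℤ) _ = _
  rw [Finsupp.single_apply]
  have : (HeckeCoset.mk (Lam n) (Lam n) ⟨g, trivial⟩ : DCoset n) =
      (HeckeCoset.mk (Lam n) (Lam n) ⟨h, trivial⟩ : DCoset n) ↔ h ∈ doubleCoset g := by
    refine (Quotient.eq (r := HeckeCoset.setoid (⊤ : Submonoid (GL (Fin n) ℚ)) (Lam n)
      (Lam n))).trans ?_
    change DoubleCoset.setoid (Lam n : Set (GL (Fin n) ℚ)) (Lam n) g h ↔ _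
    rw [DoubleCoset.rel_iff, doubleCoset, DoubleCoset.mem_doubleCoset]
    simp only [SetLike.mem_coe]
  simp only [this]

/-! ### Numerical values -/

lemma geomSum_cast (k : ℕ) : (geomSum p k : ℚ) = ((p : ℚ) ^ k - 1) / ((p : ℚ) - 1) := by
  rw [geomSum]
  push_cast
  exact geom_sum_eq (by exact_mod_cast hp.out.ne_one) k

lemma geomSum_succ' (k : ℕ) : geomSum p (k + 1) = p * geomSum p k + 1 := by
  rw [geomSum, geomSum, Finset.sum_range_succ', Finset.mul_sum]
  simp [pow_succ']

lemma geomSum_add_two (k : ℕ) : geomSum p (k + 2) = p ^ 2 * geomSum p k + (p + 1) := by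
  rw [geomSum_succ', geomSum_succ']
  ring

lemma one_lt_cast : (1 : ℚ) < p := by exact_mod_cast hp.out.one_lt

lemma degree_neighbours (hn : 4 ≤ n) :
    ({N | Dist p (lat (scal n p 2)) N}.ncard : ℚ) =
      p * (((p : ℚ) ^ (n - 1) - 1) * ((p : ℚ) ^ n - 1) / ((p : ℚ) - 1) ^ 2) := by
  obtain ⟨j, rfl⟩ := Nat.exists_eq_add_of_le' hn
  have h0 : (p : ℚ) - 1 ≠ 0 := (sub_pos.2 one_lt_cast).ne'
  rw [ncard_dist (hasRank_lat _)]
  conv_lhs => rw [show geomSum p (j + 4) - 1 = p * geomSum p (j + 3) by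
    rw [geomSum_succ', Nat.add_sub_cancel]]
  push_cast
  rw [geomSum_cast, geomSum_cast]
  field_simp

lemma degree_of_blocks {r a c s : ℕ} (hrs : r + s ≤ n) (hr : 0 < r) (hs : 0 < s)
    (ha : a ≤ 1) (hc : 3 ≤ c) (hc' : c ≤ 4) (h1 : s * (c - 2) = 2) (h2 : r * (2 - a) = 2) :
    degree (diagPow p (blocks n r a 2 c s)) = {N | Dist (p ^ 2) (lat (scal n p 2)) N ∧
      (SmulLE p (lat (scal n p 2)) N ↔ c = 3) ∧
      (SmulLE p N (lat (scal n p 2)) ↔ a = 1)}.ncard := by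
  obtain ⟨k1, k2, k3, k4, k5⟩ := blocks_conditions hrs hr hs ha hc hc' h1 h2
  rw [degree_diagPow k1 le_rfl k2 k3, k4, k5]

variable {j : ℕ}

/-- Rewriting the truncated differences as products makes the passage to ℚ safe. -/
lemma geomSum_sub_one (k : ℕ) : geomSum p (k + 1) - 1 = p * geomSum p k := by
  rw [geomSum_succ', Nat.add_sub_cancel]

lemma geomSum_sub_add_one (k : ℕ) : geomSum p (k + 2) - (p + 1) = p ^ 2 * geomSum p k := by
  rw [geomSum_add_two, Nat.add_sub_cancel]

lemma sq_sub_one_eq : (p : ℚ) ^ 2 - 1 = (p - 1) * (p + 1) := by ring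

lemma cast_sub_one_ne_zero : (p : ℚ) - 1 ≠ 0 := (sub_pos.2 one_lt_cast).ne'

lemma cast_add_one_ne_zero : (p : ℚ) + 1 ≠ 0 := by positivity

lemma degree_zero_four (j : ℕ) :
    (degree (diagPow p (blocks (j + 4) 1 0 2 4 1)) : ℚ) = (p : ℚ) ^ (2 * (j + 4) - 1) *
      (((p : ℚ) ^ (j + 3) - 1) * ((p : ℚ) ^ (j + 4) - 1) / ((p : ℚ) - 1) ^ 2) := by
  have h0 : (p : ℚ) - 1 ≠ 0 := cast_sub_one_ne_zero
  have := ncard_dist_sq_not_not (hasRank_lat (p := p) (scal (j + 4) p 2))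
  rw [degree_of_blocks (by omega) (by omega) (by omega) (by omega) (by omega) (by omega) rfl rfl]
  simp only [Nat.reduceEqDiff, zero_ne_one, iff_false]
  rw [this, geomSum_sub_one]
  push_cast
  -- The exponent 2n - 1 collects p^(n-1) from the step below L, p^(n-1) from the step above A, and
  -- one factor p from `geomSum p n - 1`.
  rw [geomSum_cast, geomSum_cast, show 2 * (j + 4) - 1 = (j + 3) + (j + 3) + 1 by omega, pow_succ,
    pow_add]
  field_simp
  ring

lemma degree_zero_three (j : ℕ) :
    (degree (diagPow p (blocks (j + 4) 1 0 2 3 2)) : ℚ) = (p : ℚ) ^ (j + 5) *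
      (((p : ℚ) ^ (j + 2) - 1) * ((p : ℚ) ^ (j + 3) - 1) * ((p : ℚ) ^ (j + 4) - 1) /
        (((p : ℚ) - 1) ^ 2 * ((p : ℚ) ^ 2 - 1))) := by
  have h0 : (p : ℚ) - 1 ≠ 0 := cast_sub_one_ne_zero
  have h0' : (p : ℚ) + 1 ≠ 0 := cast_add_one_ne_zero
  have := ncard_dist_sq_smulLE_not (hasRank_lat (p := p) (scal (j + 4) p 2))
  rw [degree_of_blocks (by omega) (by omega) (by omega) (by omega) (by omega) (by omega) rfl rfl]
  simp only [zero_ne_one, iff_false, iff_true]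
  rw [geomSum_sub_add_one] at this
  have := congrArg (Nat.cast (R := ℚ)) this
  push_cast at this
  rw [geomSum_cast, geomSum_cast, geomSum_cast] at this
  -- The flag count carries the factor p + 1; dividing by it turns one p - 1 of the denominator into
  -- p² - 1.
  rw [eq_div_of_mul_eq h0' this, sq_sub_one_eq, show j + 5 = (j + 3) + 2 by omega, pow_add _ _ 2]
  field_simp
  ring

lemma degree_one_four (j : ℕ) :
    (degree (diagPow p (blocks (j + 4) 2 1 2 4 1)) : ℚ) = (p : ℚ) ^ (j + 5) *
      (((p : ℚ) ^ (j + 2) - 1) * ((p : ℚ) ^ (j + 3) - 1) * ((p : ℚ) ^ (j + 4) - 1) /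
        (((p : ℚ) - 1) ^ 2 * ((p : ℚ) ^ 2 - 1))) := by
  have h0 : (p : ℚ) - 1 ≠ 0 := cast_sub_one_ne_zero
  have h0' : (p : ℚ) + 1 ≠ 0 := cast_add_one_ne_zero
  have := ncard_dist_sq_not_smulLE (hasRank_lat (p := p) (scal (j + 4) p 2))
  rw [degree_of_blocks (by omega) (by omega) (by omega) (by omega) (by omega) (by omega) rfl rfl]
  simp only [Nat.reduceEqDiff, iff_false, iff_true]
  rw [geomSum_sub_one, geomSum_sub_one] at this
  have := congrArg (Nat.cast (R := ℚ)) this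
  push_cast at this
  rw [geomSum_cast, geomSum_cast, geomSum_cast] at this
  rw [eq_div_of_mul_eq h0' this, sq_sub_one_eq, show j + 5 = (j + 3) + 2 by omega, pow_add _ _ 2]
  field_simp
  ring

lemma degree_one_three (j : ℕ) :
    (degree (diagPow p (blocks (j + 4) 2 1 2 3 2)) : ℚ) = (p : ℚ) ^ 4 *
      (((p : ℚ) ^ (j + 1) - 1) * ((p : ℚ) ^ (j + 2) - 1) * ((p : ℚ) ^ (j + 3) - 1) *
        ((p : ℚ) ^ (j + 4) - 1) / (((p : ℚ) - 1) ^ 2 * ((p : ℚ) ^ 2 - 1) ^ 2)) := by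
  have h0 : (p : ℚ) - 1 ≠ 0 := cast_sub_one_ne_zero
  have h0' : (p : ℚ) + 1 ≠ 0 := cast_add_one_ne_zero
  have := ncard_dist_sq_smulLE_smulLE (hasRank_lat (p := p) (scal (j + 4) p 2))
  rw [degree_of_blocks (by omega) (by omega) (by omega) (by omega) (by omega) (by omega) rfl rfl]
  simp only [iff_true]
  rw [geomSum_sub_add_one, geomSum_sub_add_one] at this
  have := congrArg (Nat.cast (R := ℚ)) this
  push_cast at this
  rw [geomSum_cast, geomSum_cast, geomSum_cast, geomSum_cast] at this
  rw [eq_div_of_mul_eq (pow_ne_zero 2 h0') this, sq_sub_one_eq]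
  field_simp

end Degrees
end HeckeGL

namespace HeckeGL

open Matrix

/-! ### The square in the Hecke algebra. -/

section Product

variable {n p : ℕ} [hp : Fact p.Prime]

lemma mem_doubleCoset_scal {x : GL (Fin n) ℚ} :
    x ∈ doubleCoset (diagPow p fun _ : Fin n => 2) ↔ Dist 1 (lat (scal n p 2)) (lat x) := by
  rw [mem_doubleCoset_iff, dist_one]
  constructor
  · rintro ⟨u, hu, h⟩
    rw [h]
    exact (lat_scal_mul hu 2).symm
  · intro h
    exact ⟨1, (Lam n).one_mem, by rw [mul_one, ← h, scal]⟩

lemma mem_doubleCoset_blocks {r a c s : ℕ} (hrs : r + s ≤ n) (hr : 0 < r) (hs : 0 < s)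
    (ha : a ≤ 1) (hc : 3 ≤ c) (hc' : c ≤ 4) (h1 : s * (c - 2) = 2) (h2 : r * (2 - a) = 2)
    {x : GL (Fin n) ℚ} :
    x ∈ doubleCoset (diagPow p (blocks n r a 2 c s)) ↔ Dist (p ^ 2) (lat (scal n p 2)) (lat x) ∧
      (SmulLE p (lat (scal n p 2)) (lat x) ↔ c = 3) ∧
      (SmulLE p (lat x) (lat (scal n p 2)) ↔ a = 1) := by
  obtain ⟨k1, k2, k3, k4, k5⟩ := blocks_conditions hrs hr hs ha hc hc' h1 h2
  rw [mem_doubleCoset_diagPow_iff k1 le_rfl k2 k3, k4, k5]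

lemma Dist.ne {V : Type*} [AddCommGroup V] {L N : AddSubgroup V} {q q' : ℕ} (h : Dist q L N)
    (hne : q ≠ q') : ¬ Dist q' L N := fun h' => hne (h.1.symm.trans h'.1)

lemma one_ne_sq : 1 ≠ p ^ 2 := (Nat.one_lt_pow two_ne_zero hp.out.one_lt).ne

lemma prime_ne_sq : p ≠ p ^ 2 := by
  have := hp.out.two_le
  nlinarith

lemma add_apply' (x y : HeckeAlgebra n) (D : DCoset n) : (x + y) D = x D + y D := rfl

lemma zsmul_apply' (a : ℤ) (x : HeckeAlgebra n) (D : DCoset n) : (a • x) D = a * x D := by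
  exact (Finsupp.smul_apply (M := ℤ) a (HeckeCosetModule.of.symm x) D).trans (smul_eq_mul _ _)

lemma two_le_geomSum (j : ℕ) : p + 1 ≤ geomSum p (j + 2) := by
  rw [geomSum_add_two]
  omega

/-- Compare coefficients at each double coset h. The six double cosets on the right are distinct
relative positions of L and N = `lat h`, so at most one term survives, and the left side is the
number of common neighbours of L and N. -/
lemma T_base_mul_T_base (hn : 4 ≤ n) :
    T (diagPow p (blocks n 1 0 1 2 1)) * T (diagPow p (blocks n 1 0 1 2 1)) =
      (2 * ((geomSum p n : ℤ) - 2) - (p - 1)) • T (diagPow p (blocks n 1 1 2 3 1)) +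
      ({N | Dist p (lat (scal n p 2)) N}.ncard : ℤ) • T (diagPow p (fun _ : Fin n => 2)) +
      T (diagPow p (blocks n 1 0 2 4 1)) +
      ((p : ℤ) + 1) • T (diagPow p (blocks n 1 0 2 3 2)) +
      ((p : ℤ) + 1) • T (diagPow p (blocks n 2 1 2 4 1)) +
      ((p : ℤ) + 1) ^ 2 • T (diagPow p (blocks n 2 1 2 3 2)) := by
  classical
  apply HeckeCosetModule.ext
  intro D
  obtain ⟨⟨h, _⟩, rfl⟩ := Quotient.exists_rep D
  change _ = (_ : HeckeAlgebra n) (HeckeCoset.mk (Lam n) (Lam n) ⟨h, trivial⟩)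
  refine (T_mul_T_apply _ _ h).trans ?_
  simp only [add_apply', zsmul_apply', T_apply]
  rw [mult_base hn]
  set L := lat (scal n p 2)
  set N := lat h
  have m0 : h ∈ doubleCoset (diagPow p fun _ : Fin n => 2) ↔ Dist 1 L N := mem_doubleCoset_scal
  have m1 : h ∈ doubleCoset (diagPow p (blocks n 1 1 2 3 1)) ↔ Dist p L N :=
    mem_doubleCoset_three hn
  have m2 : h ∈ doubleCoset (diagPow p (blocks n 1 0 2 4 1)) ↔ Dist (p ^ 2) L N ∧
      ¬ SmulLE p L N ∧ ¬ SmulLE p N L := by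
    rw [mem_doubleCoset_blocks] <;> first | omega | simp [L, N]
  have m3 : h ∈ doubleCoset (diagPow p (blocks n 1 0 2 3 2)) ↔ Dist (p ^ 2) L N ∧
      SmulLE p L N ∧ ¬ SmulLE p N L := by
    rw [mem_doubleCoset_blocks] <;> first | omega | simp [L, N]
  have m4 : h ∈ doubleCoset (diagPow p (blocks n 2 1 2 4 1)) ↔ Dist (p ^ 2) L N ∧
      ¬ SmulLE p L N ∧ SmulLE p N L := by
    rw [mem_doubleCoset_blocks] <;> first | omega | simp [L, N]
  have m5 : h ∈ doubleCoset (diagPow p (blocks n 2 1 2 3 2)) ↔ Dist (p ^ 2) L N ∧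
      SmulLE p L N ∧ SmulLE p N L := by
    rw [mem_doubleCoset_blocks] <;> first | omega | simp [L, N]
  simp only [m0, m1, m2, m3, m4, m5]
  clear m0 m1 m2 m3 m4 m5
  have hp1 := hp.out.one_lt
  -- For L = N every neighbour of L is a common one.
  by_cases d0 : Dist 1 L N
  · have d1 : ¬ Dist p L N := d0.ne hp1.ne
    have d2 : ¬ Dist (p ^ 2) L N := d0.ne one_ne_sq
    have hc : {M | Dist p L M ∧ Dist p M N} = {M | Dist p L M} := by
      rw [← dist_one.1 d0]
      ext M
      exact ⟨fun h => h.1, fun h => ⟨h, h.symm⟩⟩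
    rw [hc]
    simp [d0, d1, d2]
  by_cases d1 : Dist p L N
  · have d2 : ¬ Dist (p ^ 2) L N := d1.ne prime_ne_sq
    have hc := ncard_common_of_dist (L := L) (hasRank_lat (scal n p 2)) d1
    obtain ⟨j, rfl⟩ := Nat.exists_eq_add_of_le' (show 2 ≤ n by omega)
    -- This gives `geomSum p n` ≥ p + 1 ≥ 2, so the subtraction of 2 in ℕ is not truncated.
    have := two_le_geomSum (p := p) j
    simp only [d0, d1, d2, if_true, if_false, false_and, mul_one, mul_zero, add_zero]
    omega
  -- Each elementary quotient contributes a factor p + 1 and each cyclic one a factor 1.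
  by_cases d2 : Dist (p ^ 2) L N
  · rw [ncard_common_of_dist_sq d2]
    by_cases s1 : SmulLE p L N <;> by_cases s2 : SmulLE p N L
    · rw [midCount_of_smulLE (smulLE_inf_iff.2 s1), midCount_of_smulLE (smulLE_inf_iff'.2 s2)]
      simp only [d0, d1, d2, s1, s2, if_true, if_false, and_self, mul_zero, mul_one, zero_add,
        not_true, and_false, false_and, add_zero]
      push_cast
      ring
    · rw [midCount_of_smulLE (smulLE_inf_iff.2 s1),
        midCount_of_not_smulLE (mt smulLE_inf_iff'.1 s2)]
      simp [d0, d1, d2, s1, s2]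
    · rw [midCount_of_not_smulLE (mt smulLE_inf_iff.1 s1),
        midCount_of_smulLE (smulLE_inf_iff'.2 s2)]
      simp [d0, d1, d2, s1, s2]
    · rw [midCount_of_not_smulLE (mt smulLE_inf_iff.1 s1),
        midCount_of_not_smulLE (mt smulLE_inf_iff'.1 s2)]
      simp [d0, d1, d2, s1, s2]
  · have hc : {M | Dist p L M ∧ Dist p M N} = ∅ := by
      rw [Set.eq_empty_iff_forall_notMem]
      rintro M ⟨h1, h2⟩
      rcases h1.trans h2 with h3 | h3 | h3
      exacts [d0 h3, d1 h3, d2 h3]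
    rw [hc]
    simp [d0, d1, d2]

lemma coefficient_eq (n : ℕ) : ((2 * ((geomSum p n : ℤ) - 2) - (p - 1) : ℤ) : ℚ) =
    (2 * (p : ℚ) ^ n - (p : ℚ) ^ 2 - 2 * p + 1) / ((p : ℚ) - 1) := by
  have h0 : (p : ℚ) - 1 ≠ 0 := cast_sub_one_ne_zero
  push_cast
  rw [geomSum_cast]
  field_simp
  ring

end Product
end HeckeGL

namespace HeckeGL

open Matrix

/-! ### Determinantal divisors -/

section Minors

variable {n : ℕ}

/-- `d` divides all `k × k` minors of `C`. -/
def DvdMinors (d : ℤ) (k : ℕ) (C : Matrix (Fin n) (Fin n) ℤ) : Prop :=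
  ∀ f g : Fin k → Fin n, d ∣ (C.submatrix f g).det

lemma DvdMinors.transpose {d : ℤ} {k : ℕ} {C : Matrix (Fin n) (Fin n) ℤ} (h : DvdMinors d k C) :
    DvdMinors d k Cᵀ := by
  intro f g
  rw [← Matrix.transpose_submatrix, Matrix.det_transpose]
  exact h g f

/-- Rows of A * C are combinations of rows of C, so by multilinearity a minor of A * C is a
combination of determinants of C with arbitrary row sequences. Hence minors with repeated or
unordered indices are allowed in `DvdMinors`. -/
lemma DvdMinors.mul_left {d : ℤ} {k : ℕ} {C : Matrix (Fin n) (Fin n) ℤ} (h : DvdMinors d k C)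
    (A : Matrix (Fin n) (Fin n) ℤ) : DvdMinors d k (A * C) := by
  intro f g
  have e : (A * C).submatrix f g = fun i => ∑ j, A (f i) j • fun l => C j (g l) := by
    ext i l
    simp [Matrix.mul_apply]
  change d ∣ Matrix.detRowAlternating ((A * C).submatrix f g)
  rw [e]
  have := (Matrix.detRowAlternating (R := ℤ) (n := Fin k)).toMultilinearMap.map_sum
    (fun i (j : Fin n) => A (f i) j • fun l => C j (g l))
  refine (Finset.dvd_sum fun r _ => ?_).trans this.symm.dvd
  rw [MultilinearMap.map_smul_univ, smul_eq_mul]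
  exact (h r g).mul_left _

lemma DvdMinors.mul_right {d : ℤ} {k : ℕ} {C : Matrix (Fin n) (Fin n) ℤ} (h : DvdMinors d k C)
    (A : Matrix (Fin n) (Fin n) ℤ) : DvdMinors d k (C * A) := by
  have := (h.transpose.mul_left Aᵀ).transpose
  rwa [← Matrix.transpose_mul, Matrix.transpose_transpose] at this

lemma dvdMinors_units_mul_mul {d : ℤ} {k : ℕ} {C : Matrix (Fin n) (Fin n) ℤ} (a b : GL (Fin n) ℤ) :
    DvdMinors d k ((a : Matrix (Fin n) (Fin n) ℤ) * C * (b : Matrix (Fin n) (Fin n) ℤ)) ↔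
      DvdMinors d k C := by
  refine ⟨fun h => ?_, fun h => (h.mul_left _).mul_right _⟩
  have := (h.mul_left (a⁻¹ : GL (Fin n) ℤ).val).mul_right (b⁻¹ : GL (Fin n) ℤ).val
  have e : (a⁻¹ : GL (Fin n) ℤ).val * ((a : Matrix (Fin n) (Fin n) ℤ) * C *
      (b : Matrix (Fin n) (Fin n) ℤ)) * (b⁻¹ : GL (Fin n) ℤ).val = C := by
    have h1 : (a⁻¹ : GL (Fin n) ℤ).val * a.val = 1 := a.inv_mul
    have h2 : b.val * (b⁻¹ : GL (Fin n) ℤ).val = 1 := b.mul_inv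
    rw [← mul_assoc, ← mul_assoc, h1, one_mul, mul_assoc, h2, mul_one]
  rwa [e] at this

/-- A choice of k distinct indices is an increasing one followed by a permutation, which changes the
minor by a sign; repeated indices give the minor 0. -/
lemma dvd_detDivisor_iff {d : ℤ} {k : ℕ} {C : Matrix (Fin n) (Fin n) ℤ} :
    d ∣ detDivisor k C ↔ DvdMinors d k C := by
  rw [detDivisor, Finset.dvd_gcd_iff]
  refine ⟨fun h => ?_, fun h q _ => h _ _⟩
  have key (f : Fin k → Fin n) (hf : Function.Injective f) :
      ∃ (s : {s : Finset (Fin n) // s.card = k}) (σ : Equiv.Perm (Fin k)),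
        f = s.1.orderEmbOfFin s.2 ∘ σ := by
    have hs : (Finset.univ.image f).card = k := by
      rw [Finset.card_image_of_injective _ hf, Finset.card_fin]
    refine ⟨⟨Finset.univ.image f, hs⟩, ?_⟩
    have hmem (i : Fin k) : ∃ j, (Finset.univ.image f).orderEmbOfFin hs j = f i := by
      have : f i ∈ Set.range ((Finset.univ.image f).orderEmbOfFin hs) := by
        rw [Finset.range_orderEmbOfFin]
        simp
      exact this
    choose τ hτ using hmem
    have hτi : Function.Injective τ := by
      intro i i' h
      apply hf
      rw [← hτ i, ← hτ i', h]
    refine ⟨Equiv.ofBijective τ (Finite.injective_iff_bijective.1 hτi), ?_⟩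
    ext i
    simp [hτ]
  intro f g
  by_cases hf : Function.Injective f
  · by_cases hg : Function.Injective g
    · obtain ⟨s, σ, rfl⟩ := key f hf
      obtain ⟨t, τ, rfl⟩ := key g hg
      have e : C.submatrix (s.1.orderEmbOfFin s.2 ∘ σ) (t.1.orderEmbOfFin t.2 ∘ τ) =
          ((C.submatrix (s.1.orderEmbOfFin s.2) (t.1.orderEmbOfFin t.2)).submatrix σ id).submatrix
            id τ := rfl
      rw [e, Matrix.det_permute', Matrix.det_permute]
      exact ((h (s, t) (Finset.mem_univ _)).mul_left _).mul_left _
    · obtain ⟨i, j, hij, hne⟩ : ∃ i j, g i = g j ∧ i ≠ j := by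
        simpa [Function.Injective] using hg
      rw [Matrix.det_zero_of_column_eq hne fun l => by simp [hij]]
      exact dvd_zero _
  · obtain ⟨i, j, hij, hne⟩ : ∃ i j, f i = f j ∧ i ≠ j := by
      simpa [Function.Injective] using hf
    rw [Matrix.det_zero_of_row_eq hne (by ext l; simp [hij])]
    exact dvd_zero _

lemma detDivisor_nonneg (k : ℕ) (C : Matrix (Fin n) (Fin n) ℤ) : 0 ≤ detDivisor k C := by
  have h : normalize (detDivisor k C) = detDivisor k C := Finset.normalize_gcd
  rw [← h, ← Int.abs_eq_normalize]
  exact abs_nonneg _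

/-- A nonnegative integer is determined by the set of its divisors. -/
lemma detDivisor_eq_iff {d : ℤ} (hd : 0 ≤ d) {k : ℕ} {C : Matrix (Fin n) (Fin n) ℤ} :
    detDivisor k C = d ↔ ∀ a, DvdMinors a k C ↔ a ∣ d := by
  simp only [← dvd_detDivisor_iff]
  constructor
  · rintro rfl a
    rfl
  · intro h
    exact Int.dvd_antisymm (detDivisor_nonneg k C) hd ((h _).1 dvd_rfl) ((h _).2 dvd_rfl)

variable {p : ℕ}

lemma diagonal_submatrix_det (e : Fin n → ℕ) {k : ℕ} (f g : Fin k → Fin n) :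
    ((Matrix.diagonal fun i => (p : ℤ) ^ e i).submatrix f g).det =
      ((1 : Matrix (Fin n) (Fin n) ℤ).submatrix f g).det * (p : ℤ) ^ ∑ i, e (g i) := by
  have : (Matrix.diagonal fun i => (p : ℤ) ^ e i).submatrix f g =
      (1 : Matrix (Fin n) (Fin n) ℤ).submatrix f g * Matrix.diagonal fun i => (p : ℤ) ^ e (g i) := by
    ext i j
    rw [Matrix.mul_diagonal, Matrix.submatrix_apply, Matrix.submatrix_apply, Matrix.diagonal_apply,
      Matrix.one_apply]
    split_ifs with h
    · rw [h, one_mul]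
    · rw [zero_mul]
  rw [this, Matrix.det_mul, Matrix.det_diagonal, Finset.prod_pow_eq_pow_sum]

lemma diagonal_submatrix_self_det (e : Fin n → ℕ) {k : ℕ} {f : Fin k → Fin n}
    (hf : Function.Injective f) :
    ((Matrix.diagonal fun i => (p : ℤ) ^ e i).submatrix f f).det = (p : ℤ) ^ ∑ i, e (f i) := by
  rw [diagonal_submatrix_det, Matrix.submatrix_one f hf, Matrix.det_one, one_mul]

lemma dvdMinors_diagonal {e : Fin n → ℕ} {k m : ℕ}
    (h : ∀ g : Fin k → Fin n, Function.Injective g → m ≤ ∑ i, e (g i)) :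
    DvdMinors ((p : ℤ) ^ m) k (Matrix.diagonal fun i => (p : ℤ) ^ e i) := by
  intro f g
  by_cases hg : Function.Injective g
  · rw [diagonal_submatrix_det]
    exact (pow_dvd_pow _ (h g hg)).mul_left _
  · obtain ⟨i, j, hij, hne⟩ : ∃ i j, g i = g j ∧ i ≠ j := by
      simpa [Function.Injective] using hg
    rw [Matrix.det_zero_of_column_eq hne fun l => by simp [hij]]
    exact dvd_zero _

lemma detDivisor_diagonal {e : Fin n → ℕ} {k m : ℕ}
    (h : ∀ g : Fin k → Fin n, Function.Injective g → m ≤ ∑ i, e (g i))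
    {f : Fin k → Fin n} (hf : Function.Injective f) (hm : ∑ i, e (f i) = m) :
    detDivisor k (Matrix.diagonal fun i => (p : ℤ) ^ e i) = (p : ℤ) ^ m := by
  rw [detDivisor_eq_iff (by positivity)]
  intro a
  constructor
  · intro ha
    have := ha f f
    rwa [diagonal_submatrix_self_det e hf, hm] at this
  · intro ha f g
    exact ha.trans (dvdMinors_diagonal h f g)

/-- The exponents are 0, 1, …, 1, 2. Any k distinct ones sum to at least k - 1, since only one is
below 1, and for k < n the first k attain this bound; all n of them sum to n. -/
lemma detDivisor_base (hn : 4 ≤ n) {k : ℕ} (hk : 1 ≤ k) (hkn : k ≤ n) :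
    detDivisor k (Matrix.diagonal fun i => (p : ℤ) ^ blocks n 1 0 1 2 1 i) =
      (p : ℤ) ^ if k = n then n else k - 1 := by
  set e := blocks n 1 0 1 2 1 with he
  have hsum : ∑ i, e i = n := by
    have := sum_blocks (n := n) (r := 1) (s := 1) (by omega) 0 1 2 id
    simp only [id] at this
    rw [he, this]
    omega
  split_ifs with h
  · subst h
    refine detDivisor_diagonal (f := id) (fun g hg => ?_) Function.injective_id hsum
    have := (Equiv.ofBijective g (Finite.injective_iff_bijective.1 hg)).sum_comp e
    exact (hsum.symm.trans this.symm).le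
  · refine detDivisor_diagonal (f := Fin.castLE hkn) (fun g hg => ?_) (Fin.castLE_injective hkn) ?_
    · have h1 : ∀ i, 1 ≤ e (g i) + if g i = ⟨0, by omega⟩ then 1 else 0 := by
        intro i
        simp only [he, blocks, Fin.ext_iff]
        split_ifs <;> omega
      have h2 := Finset.sum_le_sum fun i (_ : i ∈ (Finset.univ : Finset (Fin k))) => h1 i
      rw [Finset.sum_add_distrib] at h2
      have h3 : (∑ i, if g i = ⟨0, by omega⟩ then 1 else 0) ≤ 1 := by
        rw [← Finset.card_filter, Finset.card_le_one]
        intro a ha b hb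
        apply hg
        rw [(Finset.mem_filter.1 ha).2, (Finset.mem_filter.1 hb).2]
      simp only [Finset.sum_const, Finset.card_univ, Fintype.card_fin, smul_eq_mul, mul_one] at h2
      omega
    · have h1 : ∀ i : Fin k, e (Fin.castLE hkn i) = if (i : ℕ) < 1 then 0 else 1 := by
        intro i
        have := i.2
        simp only [he, blocks, Fin.val_castLE]
        rw [if_pos (show (i : ℕ) < n - 1 by omega)]
      simp only [h1]
      rw [Fin.sum_univ_eq_sum_range (fun i => if i < 1 then 0 else 1),
        show k = 1 + (k - 1) by omega, Finset.sum_range_add]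
      simp

end Minors
end HeckeGL

namespace HeckeGL

open Matrix

/-! ### The Hermite normal form -/

section Hermite

variable {n : ℕ}

/-- Upper triangular matrices with positive diagonal entries and reduced columns. -/
structure IsHermite (C : Matrix (Fin n) (Fin n) ℤ) : Prop where
  upper : C.BlockTriangular id
  pos : ∀ i, 0 < C i i
  nonneg : ∀ i j, i < j → 0 ≤ C i j
  lt : ∀ i j, i < j → C i j < C j j

/-- The i-th coordinates of the vectors of M vanishing before i form an ideal of ℤ, nonzero because
it contains d. The vector b realises its positive generator. -/
lemma exists_pivot {M : AddSubgroup (Fin n → ℤ)} {d : ℤ} (hd : d ≠ 0)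
    (hM : ∀ w : Fin n → ℤ, d • w ∈ M) (i : Fin n) :
    ∃ b ∈ M, (∀ j < i, b j = 0) ∧ 0 < b i ∧ ∀ w ∈ M, (∀ j < i, w j = 0) → b i ∣ w i := by
  let I : AddSubgroup ℤ :=
    { carrier := {z | ∃ w ∈ M, (∀ j < i, w j = 0) ∧ w i = z}
      zero_mem' := ⟨0, M.zero_mem, fun _ _ => rfl, rfl⟩
      add_mem' := by
        rintro _ _ ⟨v, hv, hv0, rfl⟩ ⟨w, hw, hw0, rfl⟩
        exact ⟨v + w, M.add_mem hv hw, fun j hj => by simp [hv0 j hj, hw0 j hj], rfl⟩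
      neg_mem' := by
        rintro _ ⟨v, hv, hv0, rfl⟩
        exact ⟨-v, M.neg_mem hv, fun j hj => by simp [hv0 j hj], rfl⟩ }
  obtain ⟨c, hc⟩ := Int.subgroup_cyclic I
  have hc : ∀ z, z ∈ I ↔ c ∣ z := by
    intro z
    rw [hc, ← AddSubgroup.zmultiples_eq_closure, Int.mem_zmultiples_iff]
  have hdI : d ∈ I := ⟨d • Pi.single i 1, hM _, fun j hj => by simp [hj.ne], by simp⟩
  have hc0 : c ≠ 0 := by
    rintro rfl
    exact hd (zero_dvd_iff.1 ((hc d).1 hdI))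
  obtain ⟨b, hb, hb0, hbi⟩ : |c| ∈ I := (hc _).2 (by simp)
  refine ⟨b, hb, hb0, by rw [hbi]; exact abs_pos.2 hc0, fun w hw hw0 => ?_⟩
  rw [hbi, abs_dvd]
  exact (hc _).1 ⟨w, hw, hw0, rfl⟩

/-- Every subgroup of finite index of `ℤ^n` is spanned by the rows of a matrix in Hermite normal
form. -/
lemma exists_isHermite {M : AddSubgroup (Fin n → ℤ)} {d : ℤ} (hd : d ≠ 0)
    (hM : ∀ w : Fin n → ℤ, d • w ∈ M) :
    ∃ C, IsHermite C ∧ ∀ w, w ∈ M ↔ ∃ z, z ᵥ* C = w := by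
  choose b hb hb0 hbpos hbdvd using exists_pivot hd hM
  -- Entries are reduced from left to right: subtracting a multiple of the pivot vector `b k`
  -- changes nothing before column k.
  have hred (i : Fin n) (m : ℕ) : ∃ r ∈ M, (∀ j < i, r j = 0) ∧ r i = b i i ∧
      ∀ j, i < j → (j : ℕ) < m → 0 ≤ r j ∧ r j < b j j := by
    induction m with
    | zero => exact ⟨b i, hb i, hb0 i, rfl, fun j _ hj => absurd hj (Nat.not_lt_zero _)⟩
    | succ m ih =>
      obtain ⟨r, hr, hr0, hri, hrj⟩ := ih
      by_cases hm : m < n ∧ (i : ℕ) < m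
      · set k : Fin n := ⟨m, hm.1⟩
        have hik : i < k := hm.2
        refine ⟨r - (r k / b k k) • b k, M.sub_mem hr (M.zsmul_mem (hb k) _), ?_, ?_, ?_⟩
        · intro j hj
          simp [hr0 j hj, hb0 k j (hj.trans hik)]
        · simp [hri, hb0 k i hik]
        · intro j hij hj
          rcases Nat.lt_succ_iff_lt_or_eq.1 hj with h | h
          · have : j < k := h
            simpa [hb0 k j this] using hrj j hij h
          · obtain rfl : j = k := Fin.ext h
            have e : (r - (r k / b k k) • b k) k = r k % b k k := by
              rw [Pi.sub_apply, Pi.smul_apply, smul_eq_mul, Int.emod_def, mul_comm]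
            rw [e]
            exact ⟨Int.emod_nonneg _ (hbpos k).ne', Int.emod_lt_of_pos _ (hbpos k)⟩
      · refine ⟨r, hr, hr0, hri, fun j hij hj => hrj j hij ?_⟩
        have h1 := j.2
        have h2 : (i : ℕ) < j := hij
        omega
  choose r hr hr0 hri hrj using fun i => hred i n
  refine ⟨Matrix.of r, ⟨fun i j hij => hr0 i j hij, fun i => ?_, fun i j hij => (hrj i j hij j.2).1,
    fun i j hij => ?_⟩, fun w => ⟨?_, ?_⟩⟩
  · rw [Matrix.of_apply, hri]
    exact hbpos i
  · rw [Matrix.of_apply, Matrix.of_apply, hri]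
    exact (hrj i j hij j.2).2
  -- Elimination: w vanishes in the first n - m columns, and a multiple of the next row clears one
  -- more column.
  · have key : ∀ m : ℕ, ∀ w ∈ M, (∀ j : Fin n, (j : ℕ) < n - m → w j = 0) →
        ∃ z, z ᵥ* Matrix.of r = w := by
      intro m
      induction m with
      | zero =>
        intro w _ h
        refine ⟨0, ?_⟩
        rw [Matrix.zero_vecMul]
        ext j
        exact (h j j.2).symm
      | succ m ih =>
        intro w hw h
        by_cases hm : m < n
        · set k : Fin n := ⟨n - (m + 1), by omega⟩ with hk
          obtain ⟨t, ht⟩ := hbdvd k w hw fun j hj => h j hj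
          obtain ⟨z, hz⟩ := ih (w - t • r k) (M.sub_mem hw (M.zsmul_mem (hr k) _)) (by
            intro j hj
            rcases lt_or_eq_of_le (show (j : ℕ) ≤ k by simp only [hk]; omega) with h1 | h1
            · simp [h j h1, hr0 k j h1]
            · obtain rfl : j = k := Fin.ext h1
              simp only [Pi.sub_apply, Pi.smul_apply, smul_eq_mul, hri]
              rw [ht]
              ring)
          refine ⟨z + Pi.single k t, ?_⟩
          rw [Matrix.add_vecMul, hz, Matrix.single_vecMul]
          ext j
          simp [Matrix.row]
        · exact ih w hw fun j hj => h j (by omega)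
    exact fun hw => key n w hw fun j hj => absurd hj (by omega)
  · rintro ⟨z, rfl⟩
    rw [Matrix.vecMul_eq_sum]
    exact M.sum_mem fun i _ => M.zsmul_mem (hr i) _

/-- By triangularity and nonzero pivots, the vanishing of the coordinates before i forces the
coefficients z before i to vanish, so only the pivot of row i contributes. -/
lemma IsHermite.dvd_of_vecMul {C : Matrix (Fin n) (Fin n) ℤ} (hC : IsHermite C) {z : Fin n → ℤ}
    {i : Fin n} (h : ∀ j < i, (z ᵥ* C) j = 0) : C i i ∣ (z ᵥ* C) i := by
  have hval (j : Fin n) (hz : ∀ k < j, z k = 0) : (z ᵥ* C) j = z j * C j j := by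
    rw [Matrix.vecMul, dotProduct, Finset.sum_eq_single j]
    · intro k _ hk
      rcases lt_or_gt_of_ne hk with h1 | h1
      · rw [hz k h1, zero_mul]
      · rw [hC.upper h1, mul_zero]
    · simp
  have hz : ∀ j < i, z j = 0 := by
    intro j
    induction j using WellFoundedLT.induction with
    | ind j ih =>
      intro hj
      have h1 := hval j fun k hk => ih k hk (hk.trans hj)
      rw [h j hj] at h1
      exact (mul_eq_zero.1 h1.symm).resolve_right (hC.pos j).ne'
  rw [hval i hz]
  exact dvd_mul_left _ _

/-- The Hermite normal form is unique. -/
lemma IsHermite.eq {C C' : Matrix (Fin n) (Fin n) ℤ} (hC : IsHermite C) (hC' : IsHermite C')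
    (h : ∀ w : Fin n → ℤ, (∃ z, z ᵥ* C = w) ↔ ∃ z, z ᵥ* C' = w) : C = C' := by
  have hrow (D : Matrix (Fin n) (Fin n) ℤ) (i : Fin n) : Pi.single i 1 ᵥ* D = D i := by
    rw [Matrix.single_one_vecMul]
    rfl
  have hdvd {C C' : Matrix (Fin n) (Fin n) ℤ} (hC : IsHermite C) (hC' : IsHermite C')
      (h : ∀ w : Fin n → ℤ, (∃ z, z ᵥ* C = w) ↔ ∃ z, z ᵥ* C' = w) (i : Fin n) :
      C i i ∣ C' i i := by
    obtain ⟨z, hz⟩ := (h _).2 ⟨_, hrow C' i⟩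
    rw [← hz]
    apply hC.dvd_of_vecMul
    intro j hj
    rw [hz]
    exact hC'.upper hj
  have hdiag (i : Fin n) : C i i = C' i i :=
    Int.dvd_antisymm (hC.pos i).le (hC'.pos i).le (hdvd hC hC' h i)
      (hdvd hC' hC (fun w => (h w).symm) i)
  ext i j
  obtain ⟨z, hz⟩ : ∃ z, z ᵥ* C = C i - C' i := by
    obtain ⟨z, hz⟩ := (h _).2 ⟨_, hrow C' i⟩
    exact ⟨Pi.single i 1 - z, by rw [Matrix.sub_vecMul, hrow, hz]⟩
  -- The difference of two i-th rows lies in the lattice. Its first nonzero entry would be a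
  -- multiple of the pivot of its column, yet smaller in absolute value.
  have key : ∀ j, C i j - C' i j = 0 := by
    intro j
    induction j using WellFoundedLT.induction with
    | ind j ih =>
      rcases lt_trichotomy j i with hj | rfl | hj
      · rw [hC.upper hj, hC'.upper hj, sub_zero]
      · rw [hdiag, sub_self]
      · have h1 : C j j ∣ (z ᵥ* C) j := hC.dvd_of_vecMul fun k hk => by rw [hz]; exact ih k hk
        rw [hz] at h1
        refine Int.eq_zero_of_abs_lt_dvd h1 ?_
        have h2 := hC.nonneg i j hj
        have h3 := hC.lt i j hj
        have h4 := hC'.nonneg i j hj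
        have h5 := hC'.lt i j hj
        rw [← hdiag] at h5
        change |C i j - C' i j| < C j j
        rw [abs_lt]
        constructor <;> linarith
  exact sub_eq_zero.1 (key j)

end Hermite
end HeckeGL

namespace HeckeGL

open Matrix

/-! ### Hermite forms in the double coset of diag(1, p, …, p, p²). -/

section Representatives

variable {n p : ℕ}

lemma intMap_injective : Function.Injective
    (fun M : Matrix (Fin n) (Fin n) ℤ => M.map (Int.castRingHom ℚ)) :=
  Matrix.map_injective (RingHom.injective_int (Int.castRingHom ℚ))

lemma exists_GL {C : Matrix (Fin n) (Fin n) ℤ} (h : C.det ≠ 0) :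
    ∃ y : GL (Fin n) ℚ, (y : Matrix (Fin n) (Fin n) ℚ) = C.map (Int.castRingHom ℚ) := by
  refine ⟨Matrix.GeneralLinearGroup.mkOfDetNeZero (C.map (Int.castRingHom ℚ)) ?_, rfl⟩
  rw [← RingHom.mapMatrix_apply, ← RingHom.map_det]
  simpa using h

lemma intVec_injective : Function.Injective (intVec n) := by
  intro v w h
  ext i
  have := congrFun h i
  rw [intVec_apply, intVec_apply] at this
  exact_mod_cast this

lemma mem_lat_of_eq_map {x : GL (Fin n) ℚ} {C : Matrix (Fin n) (Fin n) ℤ}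
    (h : (x : Matrix (Fin n) (Fin n) ℚ) = C.map (Int.castRingHom ℚ)) {v : Fin n → ℚ} :
    v ∈ lat x ↔ ∃ z, intVec n (z ᵥ* C) = v := by
  rw [mem_lat]
  simp only [act_apply, h, intVec_vecMul]

lemma intVec_mem_lat {x : GL (Fin n) ℚ} {C : Matrix (Fin n) (Fin n) ℤ}
    (h : (x : Matrix (Fin n) (Fin n) ℚ) = C.map (Int.castRingHom ℚ)) {w : Fin n → ℤ} :
    intVec n w ∈ lat x ↔ ∃ z, z ᵥ* C = w := by
  rw [mem_lat_of_eq_map h]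
  simp only [intVec_injective.eq_iff]

lemma natAbs_det_of_eq {C : Matrix (Fin n) (Fin n) ℤ} {a b : GL (Fin n) ℤ} {e : Fin n → ℕ}
    (h : C = (a : Matrix (Fin n) (Fin n) ℤ) * (Matrix.diagonal fun i => (p : ℤ) ^ e i) *
      (b : Matrix (Fin n) (Fin n) ℤ)) : C.det.natAbs = p ^ ∑ i, e i := by
  have ha : (a : Matrix (Fin n) (Fin n) ℤ).det.natAbs = 1 :=
    Int.isUnit_iff_natAbs_eq.1 ((Matrix.isUnit_iff_isUnit_det _).1 a.isUnit)
  have hb : (b : Matrix (Fin n) (Fin n) ℤ).det.natAbs = 1 :=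
    Int.isUnit_iff_natAbs_eq.1 ((Matrix.isUnit_iff_isUnit_det _).1 b.isUnit)
  rw [h, Matrix.det_mul, Matrix.det_mul, Int.natAbs_mul, Int.natAbs_mul, ha, hb, one_mul, mul_one,
    Matrix.det_diagonal, Finset.prod_pow_eq_pow_sum, Int.natAbs_pow, Int.natAbs_natCast]

variable [hp : Fact p.Prime]

lemma mem_doubleCoset_iff_int {x : GL (Fin n) ℚ} {C : Matrix (Fin n) (Fin n) ℤ}
    (h : (x : Matrix (Fin n) (Fin n) ℚ) = C.map (Int.castRingHom ℚ)) {e : Fin n → ℕ} :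
    x ∈ doubleCoset (diagPow p e) ↔ ∃ a b : GL (Fin n) ℤ,
      C = (a : Matrix (Fin n) (Fin n) ℤ) * (Matrix.diagonal fun i => (p : ℤ) ^ e i) *
        (b : Matrix (Fin n) (Fin n) ℤ) := by
  have hD : ((diagPow p e : GL (Fin n) ℚ) : Matrix (Fin n) (Fin n) ℚ) =
      (Matrix.diagonal fun i => (p : ℤ) ^ e i).map (Int.castRingHom ℚ) := by
    rw [Matrix.diagonal_map (map_zero _)]
    change Matrix.diagonal _ = _
    congr 1
    ext i
    simp
  rw [doubleCoset, DoubleCoset.mem_doubleCoset]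
  constructor
  · rintro ⟨_, ⟨a, rfl⟩, _, ⟨b, rfl⟩, rfl⟩
    refine ⟨a, b, ?_⟩
    apply intMap_injective
    simp only
    rw [← h, Matrix.map_mul, Matrix.map_mul, ← hD]
    rfl
  · rintro ⟨a, b, rfl⟩
    refine ⟨_, ⟨a, rfl⟩, _, ⟨b, rfl⟩, ?_⟩
    apply Units.ext
    rw [h, Matrix.map_mul, Matrix.map_mul, ← hD]
    rfl

lemma exists_int_of_mem_doubleCoset {x : GL (Fin n) ℚ} {e : Fin n → ℕ}
    (h : x ∈ doubleCoset (diagPow p e)) : ∃ C : Matrix (Fin n) (Fin n) ℤ,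
      (x : Matrix (Fin n) (Fin n) ℚ) = C.map (Int.castRingHom ℚ) := by
  obtain ⟨u, hu, hx⟩ := mem_doubleCoset_iff.1 h
  rw [← lat_le_one_iff, hx, lat_mul, ← lat_eq_one_iff.2 hu, ← one_mul u, lat_mul 1 u]
  rw [one_mul]
  refine AddSubgroup.map_mono ?_
  rw [← scal_zero (p := p), scal, lat_diagPow_le_iff]
  exact fun _ => Nat.zero_le _

/-! ### Exponents with one zero -/

/-- The total is n, so the excess over 1 exactly compensates the single 0. -/
lemma sum_pred_of_unique_zero {f : Fin n → ℕ} (hf : ∑ i, f i = n) {i₀ : Fin n} (h0 : f i₀ = 0)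
    (h : ∀ i ≠ i₀, 1 ≤ f i) : ∑ i, (f i - 1) = 1 ∧ ∑ i, (1 - f i) = 1 := by
  have h1 : ∀ i, f i - 1 + 1 = f i + if i = i₀ then 1 else 0 := by
    intro i
    split_ifs with hi
    · rw [hi, h0]
    · have := h i hi
      omega
  have h2 : ∀ i, 1 - f i = if i = i₀ then 1 else 0 := by
    intro i
    split_ifs with hi
    · rw [hi, h0]
    · have := h i hi
      omega
  have h3 := Finset.sum_congr rfl fun i (_ : i ∈ Finset.univ) => h1 i
  rw [Finset.sum_add_distrib, Finset.sum_add_distrib, hf] at h3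
  constructor
  · simp at h3
    omega
  · rw [Finset.sum_congr rfl fun i (_ : i ∈ Finset.univ) => h2 i]
    simp

lemma exists_unique_two {f : Fin n → ℕ} (hf : ∑ i, (f i - 1) = 1) :
    ∃ i₁, f i₁ = 2 ∧ ∀ i ≠ i₁, f i ≤ 1 := by
  obtain ⟨i₁, -, h1⟩ := Finset.exists_ne_zero_of_sum_ne_zero (hf.trans_ne one_ne_zero)
  have h2 := Finset.add_sum_erase Finset.univ (fun i => f i - 1) (Finset.mem_univ i₁)
  rw [hf] at h2
  have h2 : f i₁ - 1 + ∑ i ∈ Finset.univ.erase i₁, (f i - 1) = 1 := h2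
  refine ⟨i₁, by omega, fun i hi => ?_⟩
  have h3 : ∑ i ∈ Finset.univ.erase i₁, (f i - 1) = 0 := by omega
  have := Finset.sum_eq_zero_iff.1 h3 i (Finset.mem_erase.2 ⟨hi, Finset.mem_univ i⟩)
  omega

lemma exists_perm_blocks (hn : 4 ≤ n) {f : Fin n → ℕ} (hf : ∑ i, f i = n) {i₀ : Fin n}
    (h0 : f i₀ = 0) (h : ∀ i ≠ i₀, 1 ≤ f i) :
    ∃ σ : Equiv.Perm (Fin n), f = blocks n 1 0 1 2 1 ∘ σ := by
  obtain ⟨h1, h2⟩ := sum_pred_of_unique_zero hf h0 h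
  obtain ⟨i₁, hi₁, hi⟩ := exists_unique_two h1
  have hle : ∀ i, f i + 1 ≤ 3 := by
    intro i
    rcases eq_or_ne i i₁ with rfl | hne
    · omega
    · have := hi i hne
      omega
  have hb : ∀ i, blocks n 1 0 1 2 1 i + 1 ≤ 3 := by
    intro i
    rw [blocks]
    split_ifs <;> omega
  have k1 : ∑ i, (blocks n 1 0 1 2 1 i + 1 - 2) = 1 := by
    rw [sum_blocks (f := fun v => v + 1 - 2) (by omega)]
    omega
  have k2 : ∑ i, (2 - (blocks n 1 0 1 2 1 i + 1)) = 1 := by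
    rw [sum_blocks (f := fun v => 2 - (v + 1)) (by omega)]
    omega
  -- Adding 1 to all exponents centres them at 2, as `exists_perm_of_sums` requires.
  obtain ⟨σ, hσ⟩ := exists_perm_of_sums (e := fun i => f i + 1)
    (e' := fun i => blocks n 1 0 1 2 1 i + 1) (fun i => (hle i).trans (by omega))
    (fun i => (hb i).trans (by omega)) (h1.trans k1.symm)
    ((Finset.sum_congr rfl fun i _ => by omega).trans (h2.trans k2.symm)) (by omega) (by omega)
    (iff_of_true hle hb) (iff_of_true (fun i => by omega) (fun i => by omega))
  refine ⟨σ, ?_⟩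
  ext i
  exact Nat.succ_injective (congrFun hσ i)

lemma dvdMinors_one_iff {d : ℤ} {C : Matrix (Fin n) (Fin n) ℤ} :
    DvdMinors d 1 C ↔ ∀ i j, d ∣ C i j := by
  constructor
  · intro h i j
    simpa using h (fun _ => i) (fun _ => j)
  · intro h f g
    rw [Matrix.det_fin_one]
    exact h _ _

lemma dvdMinors_two_iff {d : ℤ} {C : Matrix (Fin n) (Fin n) ℤ} :
    DvdMinors d 2 C ↔ ∀ i i' j j', d ∣ C i j * C i' j' - C i j' * C i' j := by
  constructor
  · intro h i i' j j'
    have := h ![i, i'] ![j, j']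
    rw [Matrix.det_fin_two] at this
    simpa using this
  · intro h f g
    rw [Matrix.det_fin_two]
    exact h _ _ _ _

lemma not_prime_dvd_one : ¬ (p : ℤ) ∣ 1 :=
  (Nat.prime_iff_prime_int.1 hp.out).not_dvd_one

/-- A criterion for an integral matrix to be in the double coset of `diag(1, p, …, p, p ^ 2)`. -/
lemma mem_doubleCoset_base_of_minors (hn : 4 ≤ n) {x : GL (Fin n) ℚ}
    {C : Matrix (Fin n) (Fin n) ℤ}
    (h : (x : Matrix (Fin n) (Fin n) ℚ) = C.map (Int.castRingHom ℚ))
    (hdet : C.det = (p : ℤ) ^ n) (h1 : ¬ DvdMinors p 1 C) (h2 : DvdMinors p 2 C) :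
    x ∈ doubleCoset (diagPow p (blocks n 1 0 1 2 1)) := by
  have hle : lat x ≤ lat 1 := lat_le_one_iff.2 ⟨C, h⟩
  -- The adjugate shows that det C · ℤ^n = p^n ℤ^n lies in the row lattice.
  have hle' : lat (scal n p n) ≤ lat x := by
    intro v hv
    rw [scal, mem_lat_diagPow] at hv
    choose z hz using hv
    rw [mem_lat_of_eq_map h]
    refine ⟨z ᵥ* C.adjugate, ?_⟩
    rw [Matrix.vecMul_vecMul, Matrix.adjugate_mul, hdet, Matrix.vecMul_smul, Matrix.vecMul_one]
    ext i
    rw [← hz i, intVec_apply, Pi.smul_apply, smul_eq_mul]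
    push_cast
    ring
  obtain ⟨f, -, u, hu, hx⟩ := exists_eq_lat_diagPow hle' hle
  have hmem : x ∈ doubleCoset (diagPow p f) := mem_doubleCoset_iff.2 ⟨u, hu, hx⟩
  obtain ⟨a, b, hC⟩ := (mem_doubleCoset_iff_int h).1 hmem
  rw [hC, dvdMinors_units_mul_mul] at h1 h2
  -- Some entry is prime to p, so some elementary divisor is 1.
  obtain ⟨i₀, hi₀⟩ : ∃ i, f i = 0 := by
    by_contra! hne
    refine h1 (dvdMinors_one_iff.2 fun i j => ?_)
    rw [Matrix.diagonal_apply]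
    split_ifs
    · exact dvd_pow_self _ (hne i)
    · exact dvd_zero _
  -- A second elementary divisor 1 would give a 2 × 2 minor equal to 1.
  have hone : ∀ i ≠ i₀, 1 ≤ f i := by
    intro i hi
    by_contra hlt
    have h3 := dvdMinors_two_iff.1 h2 i₀ i i₀ i
    rw [Matrix.diagonal_apply_eq, Matrix.diagonal_apply_eq, Matrix.diagonal_apply_ne _ hi,
      hi₀, show f i = 0 by omega] at h3
    exact not_prime_dvd_one (p := p) (by simpa using h3)
  have hsum : ∑ i, f i = n := by
    have h3 := natAbs_det_of_eq hC
    rw [hdet, Int.natAbs_pow, Int.natAbs_natCast] at h3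
    exact (Nat.pow_right_injective hp.out.two_le h3).symm
  obtain ⟨σ, rfl⟩ := exists_perm_blocks hn hsum hi₀ hone
  rwa [diagPow_comp_perm] at hmem

/-! ### The sets of representatives -/

lemma det_of_upper {C : Matrix (Fin n) (Fin n) ℤ} (h : C.BlockTriangular id) :
    C.det = ∏ i, C i i := Matrix.det_of_isUpperTriangular h

lemma IsHermite.of_mem_R₀ {C : Matrix (Fin n) (Fin n) ℤ} (h : C ∈ R₀ n p) : IsHermite C := by
  obtain ⟨h1, -, -, h4, h5⟩ := h
  refine ⟨h1, fun i => ?_, fun i j hij => (h5 i j hij).1, fun i j hij => ?_⟩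
  · rw [h4]
    exact_mod_cast hp.out.pos
  · rw [h4]
    exact (h5 i j hij).2

lemma IsHermite.of_mem_R₁ {C : Matrix (Fin n) (Fin n) ℤ} (h : C ∈ R₁ n p) : IsHermite C := by
  obtain ⟨h1, h2, -, -, h5, -⟩ := h
  refine ⟨h1, fun i => ?_, fun i j hij => (h5 i j hij).1, fun i j hij => (h5 i j hij).2⟩
  have hp0 : (0 : ℤ) < p := by exact_mod_cast hp.out.pos
  rcases h2 i with h | h | h <;> rw [h] <;> positivity

lemma IsHermite.of_mem_R {C : Matrix (Fin n) (Fin n) ℤ} (h : C ∈ R n p) : IsHermite C :=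
  h.elim IsHermite.of_mem_R₀ IsHermite.of_mem_R₁

lemma IsHermite.det_ne_zero {C : Matrix (Fin n) (Fin n) ℤ} (h : IsHermite C) : C.det ≠ 0 := by
  rw [det_of_upper h.upper]
  exact Finset.prod_ne_zero_iff.2 fun i _ => (h.pos i).ne'

/-- For R₀ the conditions on minors are part of the definition. For R₁ all rows but that of the
diagonal entry 1 are divisible by p, so p divides every 2 × 2 minor. -/
lemma mem_doubleCoset_of_mem_R (hn : 4 ≤ n) {x : GL (Fin n) ℚ} {C : Matrix (Fin n) (Fin n) ℤ}
    (h : (x : Matrix (Fin n) (Fin n) ℚ) = C.map (Int.castRingHom ℚ)) (hC : C ∈ R n p) :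
    x ∈ doubleCoset (diagPow p (blocks n 1 0 1 2 1)) := by
  rcases hC with ⟨h1, h2, -, h4, -⟩ | ⟨h1, h2, ⟨i₀, h3, h3'⟩, ⟨i₁, h4, h4'⟩, -, h6⟩
  · refine mem_doubleCoset_base_of_minors hn h ?_ ?_ ?_
    · rw [det_of_upper h1, Finset.prod_congr rfl fun i _ => h4 i]
      simp
    · rw [← dvd_detDivisor_iff, h2 1 le_rfl (by omega)]
      simpa using not_prime_dvd_one (p := p)
    · rw [← dvd_detDivisor_iff, h2 2 (by omega) (by omega)]
      simp
  · simp only at h3 h3' h4 h4'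
    have hp2 : (p : ℤ) ^ 2 ≠ 1 := by
      exact_mod_cast (Nat.one_lt_pow two_ne_zero hp.out.one_lt).ne'
    have hi : i₀ ≠ i₁ := by
      rintro rfl
      exact hp2 (h4.symm.trans h3)
    refine mem_doubleCoset_base_of_minors hn h ?_ ?_ ?_
    · rw [det_of_upper h1, ← Finset.mul_prod_erase _ _ (Finset.mem_univ i₀),
        ← Finset.mul_prod_erase _ _ (Finset.mem_erase.2 ⟨hi.symm, Finset.mem_univ i₁⟩), h3, h4,
        Finset.prod_congr rfl (g := fun _ => (p : ℤ))]
      · rw [Finset.prod_const, Finset.card_erase_of_mem (Finset.mem_erase.2 ⟨hi.symm, Finset.mem_univ i₁⟩),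
          Finset.card_erase_of_mem (Finset.mem_univ i₀), Finset.card_univ, Fintype.card_fin,
          one_mul, ← pow_add]
        congr 1
        omega
      · intro i hi'
        simp only [Finset.mem_erase, Finset.mem_univ, and_true] at hi'
        rcases h2 i with h | h | h
        · exact absurd (h3' i h) hi'.2
        · exact h
        · exact absurd (h4' i h) hi'.1
    · rw [dvdMinors_one_iff]
      intro h
      have := h i₀ i₀
      rw [h3] at this
      exact not_prime_dvd_one this
    · have hrow : ∀ i ≠ i₀, ∀ j, (p : ℤ) ∣ C i j := by
        intro i hi j
        have hd : (p : ℤ) ∣ C i i := by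
          rcases h2 i with h | h | h
          · exact absurd (h3' i h) hi
          · rw [h]
          · rw [h]
            exact dvd_pow_self _ two_ne_zero
        rcases lt_trichotomy i j with hj | rfl | hj
        · exact h6 i hd j hj
        · exact hd
        · rw [h1 hj]
          exact dvd_zero _
      rw [dvdMinors_two_iff]
      intro i i' j j'
      rcases eq_or_ne i i₀ with rfl | hi
      · rcases eq_or_ne i' i with rfl | hi'
        · rw [mul_comm (C i' j'), sub_self]
          exact dvd_zero _
        · exact dvd_sub ((hrow i' hi' j').mul_left _) ((hrow i' hi' j).mul_left _)
      · exact dvd_sub ((hrow i hi j).mul_right _) ((hrow i hi j').mul_right _)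

lemma mem_R_of_isHermite (hn : 4 ≤ n) {C : Matrix (Fin n) (Fin n) ℤ} (hC : IsHermite C)
    {a b : GL (Fin n) ℤ} (h : C = (a : Matrix (Fin n) (Fin n) ℤ) *
      (Matrix.diagonal fun i => (p : ℤ) ^ blocks n 1 0 1 2 1 i) *
        (b : Matrix (Fin n) (Fin n) ℤ)) : C ∈ R n p := by
  have hdd : ∀ k, 1 ≤ k → k ≤ n → detDivisor k C = (p : ℤ) ^ if k = n then n else k - 1 := by
    intro k hk hkn
    have h1 := detDivisor_base (p := p) hn hk hkn
    rw [detDivisor_eq_iff (by positivity)] at h1 ⊢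
    intro d
    rw [h, dvdMinors_units_mul_mul]
    exact h1 d
  have h2 : ∀ i i' j j', (p : ℤ) ∣ C i j * C i' j' - C i j' * C i' j := by
    rw [← dvdMinors_two_iff, ← dvd_detDivisor_iff, hdd 2 (by omega) (by omega),
      if_neg (by omega)]
    simp
  have hdvd : (∏ i, C i i) = (p : ℤ) ^ n := by
    have h3 := natAbs_det_of_eq h
    have h5 : ∑ i, blocks n 1 0 1 2 1 i = n := by
      refine (sum_blocks (n := n) (r := 1) (s := 1) (by omega) 0 1 2 id).trans ?_
      simp only [id]
      omega
    rw [det_of_upper hC.upper, h5] at h3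
    have h4 : 0 < ∏ i, C i i := Finset.prod_pos fun i _ => hC.pos i
    rw [← Int.natAbs_of_nonneg h4.le, h3]
    push_cast
    rfl
  have hpow : ∀ i, ∃ e ≤ n, C i i = (p : ℤ) ^ e := by
    intro i
    have h3 : C i i ∣ (p : ℤ) ^ n := hdvd ▸ Finset.dvd_prod_of_mem _ (Finset.mem_univ i)
    obtain ⟨e, he, h4⟩ := (dvd_prime_pow (Nat.prime_iff_prime_int.1 hp.out) n).1 h3
    exact ⟨e, he, Int.dvd_antisymm (hC.pos i).le (by positivity) h4.dvd h4.symm.dvd⟩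
  choose e _ he using hpow
  have hinj : Function.Injective fun k : ℕ => (p : ℤ) ^ k := by
    intro k l hkl
    have h3 : (p : ℤ) ^ k = (p : ℤ) ^ l := hkl
    have h4 : p ^ k = p ^ l := by exact_mod_cast h3
    exact Nat.pow_right_injective hp.out.two_le h4
  have hsum : ∑ i, e i = n := by
    rw [Finset.prod_congr rfl fun i _ => he i, Finset.prod_pow_eq_pow_sum] at hdvd
    exact hinj hdvd
  by_cases hz : ∃ i₀, e i₀ = 0
  · right
    obtain ⟨i₀, hi₀⟩ := hz
    have h00 : C i₀ i₀ = 1 := by rw [he, hi₀, pow_zero]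
    -- Above a diagonal entry 1 a reduced entry satisfies 0 ≤ c < 1.
    have hcol : ∀ i ≠ i₀, C i i₀ = 0 := by
      intro i hi
      rcases lt_or_gt_of_ne hi with h3 | h3
      · have := hC.nonneg i i₀ h3
        have := hC.lt i i₀ h3
        omega
      · exact hC.upper h3
    -- The 2 × 2 minor of rows i, i₀ and columns j, i₀ is then C i j itself.
    have hrow : ∀ i ≠ i₀, ∀ j, (p : ℤ) ∣ C i j := by
      intro i hi j
      have := h2 i i₀ j i₀
      rwa [h00, hcol i hi, zero_mul, sub_zero, mul_one] at this
    have hone : ∀ i ≠ i₀, 1 ≤ e i := by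
      intro i hi
      by_contra hlt
      have := hrow i hi i
      rw [he, show e i = 0 by omega, pow_zero] at this
      exact not_prime_dvd_one this
    obtain ⟨i₁, hi₁, h1⟩ := exists_unique_two (sum_pred_of_unique_zero hsum hi₀ hone).1
    refine ⟨hC.upper, fun i => ?_, ⟨i₀, h00, fun i hi => ?_⟩, ⟨i₁, by simp only [he, hi₁], fun i hi => ?_⟩,
      fun i j hij => ⟨hC.nonneg i j hij, hC.lt i j hij⟩, fun i hi j _ => ?_⟩
    · rw [he]
      rcases eq_or_ne i i₁ with rfl | hne
      · right; right
        rw [hi₁]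
      · have := h1 i hne
        interval_cases e i <;> simp
    · by_contra hne
      have h3 := hone i hne
      have h4 : e i = 0 := hinj (by simpa [he] using hi)
      omega
    · by_contra hne
      have h3 := h1 i hne
      have h4 : e i = 2 := hinj (by simpa [he] using hi)
      omega
    · refine hrow i ?_ j
      rintro rfl
      rw [h00] at hi
      exact not_prime_dvd_one hi
  · left
    push Not at hz
    -- There are n exponents, all at least 1, with sum n.
    have hone : ∀ i, e i = 1 := by
      have h3 : ∑ i : Fin n, 1 = ∑ i, e i := by rw [hsum]; simp
      have := (Finset.sum_eq_sum_iff_of_le fun i _ => Nat.one_le_iff_ne_zero.2 (hz i)).1 h3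
      exact fun i => (this i (Finset.mem_univ i)).symm
    have hd : ∀ i, C i i = p := fun i => by rw [he, hone, pow_one]
    refine ⟨hC.upper, fun k hk hkn => ?_, ?_, hd, fun i j hij => ⟨hC.nonneg i j hij, ?_⟩⟩
    · rw [hdd k hk hkn.le, if_neg hkn.ne]
    · rw [hdd n (by omega) le_rfl, if_pos rfl]
    · rw [← hd j]
      exact hC.lt i j hij

/-- The Hermite form of the row lattice of x gives the representative, and its uniqueness shows that
no other element of R lies in the same right coset. -/
lemma isCompleteSystem_R (hn : 4 ≤ n) :
    IsCompleteSystem (R n p) (diagPow p (blocks n 1 0 1 2 1)) := by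
  constructor
  · intro C hC
    obtain ⟨x, hx⟩ := exists_GL (IsHermite.of_mem_R hC).det_ne_zero
    exact ⟨x, mem_doubleCoset_of_mem_R hn hx hC, hx⟩
  · intro x hx
    obtain ⟨X, hX⟩ := exists_int_of_mem_doubleCoset hx
    have hXdet : X.det ≠ 0 := by
      intro h0
      have h1 : (x : Matrix (Fin n) (Fin n) ℚ).det ≠ 0 :=
        ((Matrix.isUnit_iff_isUnit_det _).1 x.isUnit).ne_zero
      rw [hX, ← RingHom.mapMatrix_apply, ← RingHom.map_det, h0, map_zero] at h1
      exact h1 rfl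
    have hlat {y : GL (Fin n) ℚ} {C : Matrix (Fin n) (Fin n) ℤ}
        (hy : (y : Matrix (Fin n) (Fin n) ℚ) = C.map (Int.castRingHom ℚ)) :
        lat y = lat x ↔ ∃ u ∈ Lam n, (x : Matrix (Fin n) (Fin n) ℚ) =
          (u : Matrix (Fin n) (Fin n) ℚ) * C.map (Int.castRingHom ℚ) := by
      rw [lat_eq_iff, rightCoset_eq_iff]
      constructor
      · intro h
        refine ⟨_, h, ?_⟩
        rw [← hy, ← Units.val_mul, inv_mul_cancel_right]
      · rintro ⟨u, hu, h⟩
        rw [← hy, ← Units.val_mul] at h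
        rwa [Units.ext h, mul_inv_cancel_right]
    obtain ⟨C, hC, hCX⟩ := exists_isHermite (M := (lat x).comap (intVec n)) hXdet fun w => by
      rw [AddSubgroup.mem_comap, intVec_mem_lat hX]
      refine ⟨w ᵥ* X.adjugate, ?_⟩
      rw [Matrix.vecMul_vecMul, Matrix.adjugate_mul, Matrix.vecMul_smul, Matrix.vecMul_one]
    obtain ⟨y, hy⟩ := exists_GL hC.det_ne_zero
    have hyx : lat y = lat x := by
      ext v
      constructor
      · intro hv
        obtain ⟨z, rfl⟩ := (mem_lat_of_eq_map hy).1 hv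
        exact (hCX _).2 ⟨z, rfl⟩
      · intro hv
        obtain ⟨z, rfl⟩ := (mem_lat_of_eq_map hX).1 hv
        exact (intVec_mem_lat hy).2 ((hCX _).1 hv)
    refine ⟨C, ⟨?_, (hlat hy).1 hyx⟩, ?_⟩
    · obtain ⟨u, hu, h⟩ := mem_doubleCoset_iff.1 hx
      obtain ⟨a, b, hab⟩ := (mem_doubleCoset_iff_int hy).1
        (mem_doubleCoset_iff.2 ⟨u, hu, hyx.trans h⟩)
      exact mem_R_of_isHermite hn hC hab
    · rintro C' ⟨hC', hx'⟩
      have hH := IsHermite.of_mem_R hC'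
      obtain ⟨y', hy'⟩ := exists_GL hH.det_ne_zero
      have hyy := ((hlat hy').2 hx').trans hyx.symm
      refine hH.eq hC fun w => ?_
      rw [← intVec_mem_lat hy', ← intVec_mem_lat hy, hyy]

/-- Sending C to its right coset transfers finiteness and cardinality. The value `rightCoset 1`
outside S is a dummy. -/
lemma exists_bijOn_cosetsIn {S : Set (Matrix (Fin n) (Fin n) ℤ)} {g : GL (Fin n) ℚ}
    (h : IsCompleteSystem S g) :
    ∃ F : Matrix (Fin n) (Fin n) ℤ → RightCoset n, Set.BijOn F S (cosetsIn g) := by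
  classical
  choose x hx hxC using h.1
  refine ⟨fun C => if hC : C ∈ S then rightCoset (x C hC) else rightCoset 1, ?_, ?_, ?_⟩
  · intro C hC
    simp only [dif_pos hC]
    exact ⟨_, hx C hC, rfl⟩
  · intro C hC C' hC' he
    simp only [dif_pos hC, dif_pos hC'] at he
    rw [rightCoset_eq_iff] at he
    obtain ⟨_, _, huniq⟩ := h.2 (x C' hC') (hx C' hC')
    refine (huniq C ⟨hC, _, he, ?_⟩).trans (huniq C' ⟨hC', 1, (Lam n).one_mem, ?_⟩).symm
    · rw [← hxC C hC, ← Units.val_mul, inv_mul_cancel_right]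
    · rw [← hxC C' hC', Units.val_one, one_mul]
  · rintro _ ⟨y, hy, rfl⟩
    obtain ⟨C, ⟨hC, u, hu, he⟩, _⟩ := h.2 y hy
    refine ⟨C, hC, ?_⟩
    simp only [dif_pos hC]
    rw [rightCoset_eq_iff]
    rw [← hxC C hC, ← Units.val_mul] at he
    rwa [Units.ext he, mul_inv_cancel_right]

lemma finite_R (hn : 4 ≤ n) : (R n p).Finite := by
  obtain ⟨F, hF⟩ := exists_bijOn_cosetsIn (isCompleteSystem_R (p := p) hn)
  exact hF.finite_iff_finite.2 (cosetsIn_finite _)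

lemma ncard_R (hn : 4 ≤ n) :
    (R n p).ncard = degree (diagPow p (blocks n 1 0 1 2 1)) := by
  obtain ⟨F, hF⟩ := exists_bijOn_cosetsIn (isCompleteSystem_R (p := p) hn)
  rw [degree, ← hF.image_eq, hF.injOn.ncard_image]

lemma disjoint_R : Disjoint (R₀ n p) (R₁ n p) := by
  rw [Set.disjoint_left]
  rintro C ⟨-, -, -, h, -⟩ ⟨-, -, ⟨i, hi, -⟩, -⟩
  simp only [h] at hi
  exact hp.out.ne_one (by exact_mod_cast hi)

end Representatives
end HeckeGL

/-! ### The three statements together. -/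

theorem theoremA (n : ℕ) (hn : 4 ≤ n) (p : ℕ) [Fact p.Prime] :
    -- the representatives
    (Disjoint (HeckeGL.R₀ n p) (HeckeGL.R₁ n p) ∧
      HeckeGL.IsCompleteSystem (HeckeGL.R n p)
        (HeckeGL.diagPow p (HeckeGL.blocks n 1 0 1 2 1)) ∧
      (HeckeGL.R n p).Finite ∧
      (HeckeGL.R n p).ncard =
        HeckeGL.degree (HeckeGL.diagPow p (HeckeGL.blocks n 1 0 1 2 1)) ∧
      (HeckeGL.degree (HeckeGL.diagPow p (HeckeGL.blocks n 1 0 1 2 1)) : ℚ) =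
        p * (((p : ℚ) ^ (n - 1) - 1) * ((p : ℚ) ^ n - 1) / ((p : ℚ) - 1) ^ 2)) ∧
    -- the degrees
    ((HeckeGL.degree (HeckeGL.diagPow p (HeckeGL.blocks n 1 1 2 3 1)) : ℚ) =
        p * (((p : ℚ) ^ (n - 1) - 1) * ((p : ℚ) ^ n - 1) / ((p : ℚ) - 1) ^ 2) ∧
      (HeckeGL.degree (HeckeGL.diagPow p (HeckeGL.blocks n 1 0 2 3 2)) : ℚ) =
        (p : ℚ) ^ (n + 1) *
          (((p : ℚ) ^ (n - 2) - 1) * ((p : ℚ) ^ (n - 1) - 1) * ((p : ℚ) ^ n - 1) /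
            (((p : ℚ) - 1) ^ 2 * ((p : ℚ) ^ 2 - 1))) ∧
      (HeckeGL.degree (HeckeGL.diagPow p (HeckeGL.blocks n 1 0 2 4 1)) : ℚ) =
        (p : ℚ) ^ (2 * n - 1) *
          (((p : ℚ) ^ (n - 1) - 1) * ((p : ℚ) ^ n - 1) / ((p : ℚ) - 1) ^ 2) ∧
      (HeckeGL.degree (HeckeGL.diagPow p (HeckeGL.blocks n 2 1 2 4 1)) : ℚ) =
        (p : ℚ) ^ (n + 1) *
          (((p : ℚ) ^ (n - 2) - 1) * ((p : ℚ) ^ (n - 1) - 1) * ((p : ℚ) ^ n - 1) /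
            (((p : ℚ) - 1) ^ 2 * ((p : ℚ) ^ 2 - 1))) ∧
      (HeckeGL.degree (HeckeGL.diagPow p (HeckeGL.blocks n 2 1 2 3 2)) : ℚ) =
        (p : ℚ) ^ 4 *
          (((p : ℚ) ^ (n - 3) - 1) * ((p : ℚ) ^ (n - 2) - 1) * ((p : ℚ) ^ (n - 1) - 1) *
              ((p : ℚ) ^ n - 1) /
            (((p : ℚ) - 1) ^ 2 * ((p : ℚ) ^ 2 - 1) ^ 2))) ∧
    -- the square in the Hecke algebra; the two quotients are integers
    (∃ a d : ℤ,
      (a : ℚ) = (2 * (p : ℚ) ^ n - (p : ℚ) ^ 2 - 2 * p + 1) / ((p : ℚ) - 1) ∧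
      (d : ℚ) = p * (((p : ℚ) ^ (n - 1) - 1) * ((p : ℚ) ^ n - 1) / ((p : ℚ) - 1) ^ 2) ∧
      HeckeGL.T (HeckeGL.diagPow p (HeckeGL.blocks n 1 0 1 2 1)) *
          HeckeGL.T (HeckeGL.diagPow p (HeckeGL.blocks n 1 0 1 2 1)) =
        a • HeckeGL.T (HeckeGL.diagPow p (HeckeGL.blocks n 1 1 2 3 1)) +
        d • HeckeGL.T (HeckeGL.diagPow p (fun _ : Fin n => 2)) +
        HeckeGL.T (HeckeGL.diagPow p (HeckeGL.blocks n 1 0 2 4 1)) +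
        ((p : ℤ) + 1) • HeckeGL.T (HeckeGL.diagPow p (HeckeGL.blocks n 1 0 2 3 2)) +
        ((p : ℤ) + 1) • HeckeGL.T (HeckeGL.diagPow p (HeckeGL.blocks n 2 1 2 4 1)) +
        ((p : ℤ) + 1) ^ 2 • HeckeGL.T (HeckeGL.diagPow p (HeckeGL.blocks n 2 1 2 3 2))) := by
  -- With n = j + 4 the differences n - 1, n - 2, n - 3 reduce by computation to j + 3, j + 2, j +
  -- 1.
  obtain ⟨j, rfl⟩ := Nat.exists_eq_add_of_le' hn
  have hd := HeckeGL.degree_neighbours (p := p) hn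
  refine ⟨⟨HeckeGL.disjoint_R, HeckeGL.isCompleteSystem_R hn, HeckeGL.finite_R hn,
    HeckeGL.ncard_R hn, ?_⟩, ⟨?_, HeckeGL.degree_zero_three j, HeckeGL.degree_zero_four j,
    HeckeGL.degree_one_four j, HeckeGL.degree_one_three j⟩,
    _, _, HeckeGL.coefficient_eq (j + 4), ?_, HeckeGL.T_base_mul_T_base hn⟩
  · rw [HeckeGL.degree_base hn, hd]
  · rw [HeckeGL.degree_three hn, hd]
  · exact_mod_cast hd
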